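/- **Setting.** Let $X$ be a real Banach space, $t_0<T$, $3\le p\le 5$, and consider $u'(t)=f(u(t))=Lu(t)+N(u(t))$ with Jacobian $J(v)=L+N'(v)$ (with domain $D(L)$). Assume: (A1) $L$ is the generator of a strongly continuous semigroup $e^{tL}$ on $X$. (A2) $u:[t_0,T]\to X$ is a solution with values in $D(L)$ that is $p+1$ times continuously differentiable in $X$, and $N:X\to X$ is $p+1$ times continuously Fréchet differentiable in a strip $\{v:\ \|v-u(t)\|<R \text{ for some } t\in[t_0,T]\}$, $R>0$. Let $\varphi_0(tA)=e^{tA}$ and $\varphi_k(tA)=\int_0^1 e^{(1-\theta)tA}\frac{\theta^{k-1}}{(k-1)!}\,d\theta$ for $k\ge1$, $t\ge 0$. An explicit $s$-stage EPIRK method computes, for a step $h>0$ from $u_n\in D(L)$ and with $J_n=J(u_n)$, $r(v)=N(v)-N(u_n)-N'(u_n)(v-u_n)$ $(=f(v)-f(u_n)-J_n(v-u_n)$ for $v\in D(L))$, $$U_{ni}=u_n+\alpha_{i1}\psi_{i1}(g_{i1}hJ_n)hf(u_n)+h\sum_{j=2}^{i-1}a_{ij}(hJ_n)r(U_{nj}),\quad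 2\le i\le s,$$ $$u_{n+1}=u_n+\varphi_1(hJ_n)hf(u_n)+h\sum_{j=2}^{s}b_j(hJ_n)r(U_{nj}),$$ where $\psi_{i1}(z)=\sum_{k=1}^{q}p_{i1k}\varphi_k(z)$, all coefficients are real, $g_{i1}\ge0$, and $a_{ij},b_j$ are finite real linear combinations of functions $\varphi_k(\gamma z)$ with $k\ge1$, $\gamma\ge0$. Put $\mathbb P_{im}=\sum_{k=1}^{q}p_{i1k}/(k+m-1)!$ and $$\Psi_i(z)=\tfrac12\sum_{j=2}^{i-1}\alpha_{j1}^2\mathbb P_{j1}^2a_{ij}(z)-\alpha_{i1}g_{i1}^2\sum_{k=1}^{q}p_{i1k}\varphi_{k+2}(g_{i1}z).$$ (A3) For each $2\le i\le s$ and each $1\le k\le q$: $\alpha_{i1}p_{i1k}=g_{i1}$, or $\alpha_{i1}=g_{i1}$, or $p_{i1k}=g_{i1}$. The stiff order conditions, required for all real square matrices $Z,K$ of equal (arbitrary) size, with $\sum=\sum_{i=2}^{s}$, are: for order 3, - (C1) $\sum b_i(Z)\alpha_{i1}^2\mathbb P_{i1}^2=2\varphi_3(Z)$; for order 4, in addition,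 - (C2) $\sum b_i(Z)\alpha_{i1}^2g_{i1}\mathbb P_{i1}\mathbb P_{i2}=3\varphi_4(Z)$, - (C3) $\sum b_i(Z)\alpha_{i1}^3\mathbb P_{i1}^3=6\varphi_4(Z)$; for order 5, in addition, - (C4) $\sum b_i(Z)g_{i1}^2\alpha_{i1}^2\mathbb P_{i1}\mathbb P_{i3}=4\varphi_5(Z)$, - (C5) $\sum b_i(Z)\alpha_{i1}^2g_{i1}^2\mathbb P_{i2}^2=6\varphi_5(Z)$, - (C6) $\sum b_i(Z)g_{i1}\alpha_{i1}^3\mathbb P_{i1}^2\mathbb P_{i2}=12\varphi_5(Z)$, - (C7) $\sum b_i(Z)\alpha_{i1}^4\mathbb P_{i1}^4=24\varphi_5(Z)$, - (C8) $\sum b_i(Z)\alpha_{i1}\mathbb P_{i1}K\Psi_i(Z)=0$. For a grid $t_0<t_1<\dots<t_m\le T$ with $h_n=t_{n+1}-t_n$ and $\tilde J_n=J(u(t_n))$, the stability bound with constant $C_S$ reads $$\|e^{h_n\tilde J_n}e^{h_{n-1}\tilde J_{n-1}}\cdots e^{h_\nu\tilde J_\nu}\|_{X\leftarrow X}\le C_S,\qquad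 0\le\nu\le n<m.$$ **Theorem.** Assume (A1), (A2), and let an explicit EPIRK method satisfy (A3) and the stiff order conditions up to order $p$. Then for every $C_S$ there are $H>0$ and $C$ such that for every grid with all step sizes $h_n\le H$ that satisfies the stability bound with constant $C_S$, the numerical solution with $u_0=u(t_0)$ satisfies $$\|u_n-u(t_n)\|\le C\sum_{\nu=0}^{n-1}h_\nu^{p+1},\qquad 0\le n\le m.$$ The constants $H$ and $C$ do not depend on the grid. (If only $\gamma>0$ occurs in the functions $b_j$, then every step maps $D(L)$ into $D(L)$, so the numerical solution exists on the whole grid; in general the bound is asserted for every sequence $u_0,\dots,u_m$ in $D(L)$ that satisfies the recursion.) -/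

import Mathlib

open Set Filter Topology
open scoped Nat Matrix

noncomputable section

/-! ### Strongly continuous semigroups and their generators -/

/-- `S` (read on `t ≥ 0` only) is a strongly continuous semigroup of bounded operators. -/
structure IsC0Semigroup {X : Type*} [NormedAddCommGroup X] [NormedSpace ℝ X]
    (S : ℝ → X →L[ℝ] X) : Prop where
  zero : S 0 = 1
  add : ∀ s t : ℝ, 0 ≤ s → 0 ≤ t → S (s + t) = S s * S t
  strongly_continuous : ∀ x : X, Tendsto (fun t => S t x) (𝓝[>] 0) (𝓝 x)

/-- The (possibly unbounded) operator `A` is the infinitesimal generator of `S`: its domain is the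
set of all `x` for which `lim_{t → 0+} (S t x - x) / t` exists, and `A x` is that limit. -/
def IsGenerator {X : Type*} [NormedAddCommGroup X] [NormedSpace ℝ X]
    (A : X →ₗ.[ℝ] X) (S : ℝ → X →L[ℝ] X) : Prop :=
  ∀ x y : X, (x, y) ∈ A.graph ↔ Tendsto (fun t : ℝ => t⁻¹ • (S t x - x)) (𝓝[>] 0) (𝓝 y)

/-- `A` generates a strongly continuous semigroup. -/
def GeneratesC0Semigroup {X : Type*} [NormedAddCommGroup X] [NormedSpace ℝ X]
    (A : X →ₗ.[ℝ] X) : Prop :=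
  ∃ S : ℝ → X →L[ℝ] X, IsC0Semigroup S ∧ IsGenerator A S

open Classical in
/-- `e^{tA}` for `t ≥ 0`: the strongly continuous semigroup generated by `A` (which is unique on
`t ≥ 0`), and `0` if `A` does not generate one. -/
def expSemigroup {X : Type*} [NormedAddCommGroup X] [NormedSpace ℝ X]
    (A : X →ₗ.[ℝ] X) : ℝ → X →L[ℝ] X :=
  if hA : GeneratesC0Semigroup A then hA.choose else 0

/-! ### The `φ`-functions -/

/-- `φ_k(tA) x`, where `E t x = e^{tA} x`: one has `φ_0(tA) x = e^{tA} x` and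
`φ_k(tA) x = ∫_0^1 θ^{k-1} / (k-1)! e^{(1-θ)tA} x dθ` for `k ≥ 1`. -/
def phi {X : Type*} [NormedAddCommGroup X] [NormedSpace ℝ X]
    (E : ℝ → X → X) : ℕ → ℝ → X → X
  | 0, t, x => E t x
  | k + 1, t, x => ∫ θ in (0 : ℝ)..1, (θ ^ k / (k ! : ℝ)) • E ((1 - θ) * t) x

/-- A finite real linear combination `z ↦ ∑ c_{k,γ} φ_k(γ z)`; the coefficient of `φ_k(γ ·)` is the
value at `(k, γ)`. -/
abbrev PhiComb : Type := (ℕ × ℝ) →₀ ℝ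

/-- Only `φ_k(γ ·)` with `k ≥ 1` and `γ ≥ 0` occur. -/
def PhiComb.IsAdmissible (c : PhiComb) : Prop :=
  ∀ q ∈ c.support, 1 ≤ q.1 ∧ 0 ≤ q.2

/-- `c(tA) x`, where `E t x = e^{tA} x`. -/
def PhiComb.eval {X : Type*} [NormedAddCommGroup X] [NormedSpace ℝ X]
    (c : PhiComb) (E : ℝ → X → X) (t : ℝ) (x : X) : X :=
  c.sum fun q r => r • phi E q.1 (q.2 * t) x

/-! ### EPIRK methods -/

/-- The coefficients of an explicit `s`-stage (unpartitioned) EPIRK method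
`U_i = u_n + α_{i1} ψ_{i1}(g_{i1} h J) h f(u_n) + h ∑_{j=2}^{i-1} a_{ij}(h J) r(U_j)`, `2 ≤ i ≤ s`,
`u_{n+1} = u_n + φ_1(h J) h f(u_n) + h ∑_{j=2}^{s} b_j(h J) r(U_j)`,
with `ψ_{i1}(z) = ∑_{k=1}^{q} p_{i1k} φ_k(z)`. The functions `a_{ij}` and `b_j` are finite linear
combinations of functions `φ_k(γ z)`; those that arise from forward differences,
`a_{ij}(z) = ∑_{k=j}^{i-1} (-1)^{k-j} (k-1 choose j-1) α_{ik} ψ_{ik}(g_{ik} z)` and likewise `b_j`,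
are of this form. Here `α i`, `g i`, `p i k` are `α_{i1}`, `g_{i1}`, `p_{i1k}`; only the
indices displayed above are ever used. -/
structure EPIRK where
  /-- number of stages -/
  s : ℕ
  /-- number of `φ`-functions in `ψ_{i1}` -/
  q : ℕ
  α : ℕ → ℝ
  g : ℕ → ℝ
  p : ℕ → ℕ → ℝ
  a : ℕ → ℕ → PhiComb
  b : ℕ → PhiComb
  g_nonneg : ∀ i ∈ Finset.Icc 2 s, 0 ≤ g i
  a_admissible : ∀ i ∈ Finset.Icc 2 s, ∀ j ∈ Finset.Ico 2 i, (a i j).IsAdmissible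
  b_admissible : ∀ j ∈ Finset.Icc 2 s, (b j).IsAdmissible

namespace EPIRK

/-- `ℙ_{im} = ∑_{k=1}^{q} p_{i1k} / (k+m-1)!`, for `m ≥ 1`. -/
def P (M : EPIRK) (i m : ℕ) : ℝ :=
  ∑ k ∈ Finset.Icc 1 M.q, M.p i k / ((k + m - 1) ! : ℝ)

variable {X : Type*} [NormedAddCommGroup X] [NormedSpace ℝ X]

/-- `ψ_{i1}(g_{i1} t A) x`, where `E t x = e^{tA} x`. -/
def psi (M : EPIRK) (i : ℕ) (E : ℝ → X → X) (t : ℝ) (x : X) : X :=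
  ∑ k ∈ Finset.Icc 1 M.q, M.p i k • phi E k (M.g i * t) x

/-- `Ψ_i(tA) x`, where `E t x = e^{tA} x` and
`Ψ_i(z) = 1/2 ∑_{j=2}^{i-1} α_{j1}^2 ℙ_{j1}^2 a_{ij}(z)
  - α_{i1} g_{i1}^2 ∑_{k=1}^{q} p_{i1k} φ_{k+2}(g_{i1} z)`. -/
def bigPsi (M : EPIRK) (i : ℕ) (E : ℝ → X → X) (t : ℝ) (x : X) : X :=
  (1 / 2 : ℝ) • ∑ j ∈ Finset.Ico 2 i, (M.α j ^ 2 * M.P j 1 ^ 2) • (M.a i j).eval E t x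
    - (M.α i * M.g i ^ 2) • ∑ k ∈ Finset.Icc 1 M.q, M.p i k • phi E (k + 2) (M.g i * t) x

/-- The stage `U_i`, with `E t x = e^{tJ} x`, `u = u_n` and `y = f(u_n)`. -/
def stage (M : EPIRK) (E : ℝ → X → X) (h : ℝ) (u y : X) (r : X → X) (i : ℕ) : X :=
  u + (M.α i * h) • M.psi i E h y
    + h • ∑ j : Fin i, if 2 ≤ (j : ℕ) then (M.a i j).eval E h (r (M.stage E h u y r j)) else 0
termination_by i
decreasing_by exact j.2

/-- The new value `u_{n+1}`, with `E t x = e^{tJ} x`, `u = u_n` and `y = f(u_n)`. -/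
def update (M : EPIRK) (E : ℝ → X → X) (h : ℝ) (u y : X) (r : X → X) : X :=
  u + h • phi E 1 h y
    + h • ∑ j ∈ Finset.Icc 2 M.s, (M.b j).eval E h (r (M.stage E h u y r j))

end EPIRK

/-- The Jacobian `J(v) = L + N'(v)`, an operator with the domain of `L`. -/
def jacobian {X : Type*} [NormedAddCommGroup X] [NormedSpace ℝ X]
    (L : X →ₗ.[ℝ] X) (N : X → X) (v : X) : X →ₗ.[ℝ] X :=
  (fderiv ℝ N v).toLinearMap +ᵥ L

/-- One step of size `h` from `u ∈ D(L)` of the method `M` applied to `u' = f(u) = L u + N(u)`. The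
remainder `r(v) = f(v) - f(u) - J(u)(v - u)` is written as `N(v) - N(u) - N'(u)(v - u)`, where the
unbounded part has cancelled. -/
def EPIRK.step {X : Type*} [NormedAddCommGroup X] [NormedSpace ℝ X] (M : EPIRK)
    (L : X →ₗ.[ℝ] X) (N : X → X) (h : ℝ) (u : L.domain) : X :=
  M.update (fun t x => expSemigroup (jacobian L N (u : X)) t x) h u (L u + N u)
    (fun v => N v - N u - fderiv ℝ N (u : X) (v - u))

/-- `w_0, …, w_m` is the numerical solution with starting value `u₀` on the grid
`t_0 < … < t_m`. -/
def EPIRK.IsNumericalSolution {X : Type*} [NormedAddCommGroup X] [NormedSpace ℝ X] (M : EPIRK)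
    (L : X →ₗ.[ℝ] X) (N : X → X) (u₀ : X) (t : ℕ → ℝ) (m : ℕ) (w : ℕ → L.domain) : Prop :=
  (w 0 : X) = u₀ ∧ ∀ n < m, (w (n + 1) : X) = M.step L N (t (n + 1) - t n) (w n)

/-! ### Conditions on the coefficients -/

/-- For each stage and each `k`: `α_{i1} p_{i1k} = g_{i1}`, or `α_{i1} = g_{i1}`, or
`p_{i1k} = g_{i1}`. -/
def EPIRK.CoeffRestriction (M : EPIRK) : Prop :=
  ∀ i ∈ Finset.Icc 2 M.s, ∀ k ∈ Finset.Icc 1 M.q,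
    M.α i * M.p i k = M.g i ∨ M.α i = M.g i ∨ M.p i k = M.g i

/-- `(t, v) ↦ e^{tZ} v` for a square matrix `Z`. -/
def matrixExp {n : ℕ} (Z : Matrix (Fin n) (Fin n) ℝ) (t : ℝ) (v : Fin n → ℝ) : Fin n → ℝ :=
  NormedSpace.exp (t • Z) *ᵥ v

/-- The matrix identity `∑_{i=2}^{s} c_i b_i(Z) = d φ_k(Z)` for all real square matrices `Z`. -/
def EPIRK.WeightCondition (M : EPIRK) (c : ℕ → ℝ) (d : ℝ) (k : ℕ) : Prop :=
  ∀ (n : ℕ) (Z : Matrix (Fin n) (Fin n) ℝ) (v : Fin n → ℝ),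
    ∑ i ∈ Finset.Icc 2 M.s, c i • (M.b i).eval (matrixExp Z) 1 v = d • phi (matrixExp Z) k 1 v

/-- The stiff order conditions up to order `p` (for `3 ≤ p ≤ 5`). -/
structure EPIRK.StiffOrderConditions (M : EPIRK) (p : ℕ) : Prop where
  c1 : M.WeightCondition (fun i => M.α i ^ 2 * M.P i 1 ^ 2) 2 3
  c2 : 4 ≤ p → M.WeightCondition (fun i => M.α i ^ 2 * M.g i * M.P i 1 * M.P i 2) 3 4
  c3 : 4 ≤ p → M.WeightCondition (fun i => M.α i ^ 3 * M.P i 1 ^ 3) 6 4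
  c4 : 5 ≤ p → M.WeightCondition (fun i => M.g i ^ 2 * M.α i ^ 2 * M.P i 1 * M.P i 3) 4 5
  c5 : 5 ≤ p → M.WeightCondition (fun i => M.α i ^ 2 * M.g i ^ 2 * M.P i 2 ^ 2) 6 5
  c6 : 5 ≤ p → M.WeightCondition (fun i => M.g i * M.α i ^ 3 * M.P i 1 ^ 2 * M.P i 2) 12 5
  c7 : 5 ≤ p → M.WeightCondition (fun i => M.α i ^ 4 * M.P i 1 ^ 4) 24 5
  c8 : 5 ≤ p → ∀ (n : ℕ) (Z K : Matrix (Fin n) (Fin n) ℝ) (v : Fin n → ℝ),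
    ∑ i ∈ Finset.Icc 2 M.s, (M.α i * M.P i 1) •
      (M.b i).eval (matrixExp Z) 1 (K *ᵥ M.bigPsi i (matrixExp Z) 1 v) = 0

/-! ### The problem, grids and the stability bound -/

/-- `u` is a solution on `[t₀, T]` of `u' = L u + N(u)`, with values in `D(L)`. -/
def IsSolution {X : Type*} [NormedAddCommGroup X] [NormedSpace ℝ X]
    (L : X →ₗ.[ℝ] X) (N : X → X) (t₀ T : ℝ) (u : ℝ → X) : Prop :=
  ∀ t ∈ Icc t₀ T, ∃ hu : u t ∈ L.domain,
    HasDerivWithinAt u (L ⟨u t, hu⟩ + N (u t)) (Icc t₀ T) t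

/-- The open strip of radius `R` along the curve `u` on `[t₀, T]`. -/
def strip {X : Type*} [NormedAddCommGroup X] (u : ℝ → X) (t₀ T R : ℝ) : Set X :=
  {v | ∃ t ∈ Icc t₀ T, ‖v - u t‖ < R}

/-- `t₀ = t_0 < t_1 < … < t_m ≤ T` with step sizes at most `H`. -/
def IsGrid (t₀ T H : ℝ) (t : ℕ → ℝ) (m : ℕ) : Prop :=
  t 0 = t₀ ∧ (∀ n < m, t n < t (n + 1) ∧ t (n + 1) - t n ≤ H) ∧ t m ≤ T

/-- `e^{h_{ν+k-1} J̃_{ν+k-1}} ⋯ e^{h_ν J̃_ν}` with `k` factors, where `h_n = t_{n+1} - t_n` and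
`J̃_n = J(u(t_n))`. -/
def propagatorProd {X : Type*} [NormedAddCommGroup X] [NormedSpace ℝ X]
    (L : X →ₗ.[ℝ] X) (N : X → X) (u : ℝ → X) (t : ℕ → ℝ) (ν : ℕ) : ℕ → X →L[ℝ] X
  | 0 => 1
  | k + 1 => expSemigroup (jacobian L N (u (t (ν + k)))) (t (ν + k + 1) - t (ν + k)) *
      propagatorProd L N u t ν k

/-- The stability bound `‖e^{h_n J̃_n} ⋯ e^{h_ν J̃_ν}‖ ≤ C_S` for all `0 ≤ ν ≤ n < m`. -/
def StabilityBound {X : Type*} [NormedAddCommGroup X] [NormedSpace ℝ X]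
    (L : X →ₗ.[ℝ] X) (N : X → X) (u : ℝ → X) (t : ℕ → ℝ) (m : ℕ) (CS : ℝ) : Prop :=
  ∀ ν n : ℕ, ν ≤ n → n < m → ‖propagatorProd L N u t ν (n - ν + 1)‖ ≤ CS

end

/-! The error is split as in Lady Windermere's fan. Let `e_n = u_n - u(t_n)` and let `J` be the
Jacobian at `u(t_n)`. A step from `u_n` is compared with the same step from the exact value
`u(t_n)`: the two results differ by `e^{hJ} e_n` plus `O(h ‖e_n‖)`, and the step from the exact
value misses `u(t_{n+1})` by `O(h^{p+1})`. Solving this recursion with the products of the `e^{hJ}`,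
which the stability bound controls, and applying a discrete Gronwall inequality gives the theorem.
The two estimates are joined in `exists_error_recursion`.

Stability (`exists_step_stability`). The difficulty is that `f(u_n) - f(u(t_n))` contains the
unbounded `L e_n`. It never has to be estimated: `γhJ φ_{k+1}(γhJ) w = φ_k(γhJ) w - w/k!` replaces
`h φ_{k+1}(γhJ) f(w)` by bounded operators applied to `w` when `γ > 0`, and condition (A3) makes the
coefficient vanish when `g_{i1} = 0`. The stages are then Lipschitz in the starting value. They
enter the update with a factor `h`, so this is enough. For `φ_1(hJ)` the same identity isolates
`e^{hJ} w`. The semigroups for different base points are compared through a Volterra equation, since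
the Jacobians differ by bounded operators; the difference is `O(s ‖v - w‖)` at time `s`.

Consistency (`uniformO_local_error`). Linearization at `c = u(t)` gives `u(t+h) = c + h φ_1(hJ) f(c)
+ ∫ e^{(h-s)J} r(u(t+s)) ds`, and the method replaces the integral by `h ∑ b_j(hJ) r(U_j)`. Both
remainders are expanded in powers. A term `s^k q` of the exact remainder integrates to `k! h^{k+1}
φ_{k+1}(hJ) q`; the order conditions say that the numerical sum produces the same. The stage
expansion applies `J` only to `u'`, `u''`, `u'''`, which lie in `D(L)` because the generator is
closed and the equation can be differentiated. No bound involving powers of `L` on other vectors is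
used.

Order conditions (`eval_eq_zero_of_exp`). They are stated for matrices but needed for semigroups. A
combination of `φ`-functions is a continuous functional on `C([0, Γ])` applied to `s ↦ e^{sz}`. If
it vanishes on all real exponentials, it vanishes on all continuous functions by Stone–Weierstrass,
hence on all scalar orbits `s ↦ ℓ(e^{stA} x)`. The condition with `K` is first decoupled into two
independent scalar variables.

All estimates are made simultaneously for every base point on the solution curve and every small
step, so the constants do not see the grid. -/

/-! ### Strongly continuous semigroups: growth, joint continuity, generators, variation of
constants. -/

section SemigroupBasics

variable {X : Type*} [NormedAddCommGroup X] [NormedSpace ℝ X]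
  {S : ℝ → X →L[ℝ] X} {A : X →ₗ.[ℝ] X}

namespace IsC0Semigroup

theorem tendsto_nhdsGE (hS : IsC0Semigroup S) (x : X) :
    Tendsto (fun t => S t x) (𝓝[≥] 0) (𝓝 x) := by
  rw [← Ioi_insert, nhdsWithin_insert, tendsto_sup]
  refine ⟨?_, hS.strongly_continuous x⟩
  have : S 0 x = x := by rw [hS.zero]; rfl
  simpa [this] using tendsto_pure_nhds (fun t => S t x) (0 : ℝ)

/-- Otherwise there are times `τ n → 0` with `‖S (τ n)‖ > n`. Since `S (τ n) x` converges for each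
`x`, this contradicts the uniform boundedness principle. -/
theorem exists_bound_near_zero [CompleteSpace X] (hS : IsC0Semigroup S) :
    ∃ δ > 0, ∃ M, ∀ t ∈ Icc (0 : ℝ) δ, ‖S t‖ ≤ M := by
  by_contra! hcon
  have h1 : ∀ n : ℕ, ∃ t ∈ Icc (0 : ℝ) (1 / (n + 1)), (n : ℝ) < ‖S t‖ := fun n =>
    hcon (1 / (n + 1)) (by positivity) n
  choose τ hτ hn using h1
  have hτ0 : Tendsto τ atTop (𝓝[≥] 0) := by
    refine tendsto_nhdsWithin_iff.2 ⟨?_, Eventually.of_forall fun n => (hτ n).1⟩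
    exact squeeze_zero (fun n => (hτ n).1) (fun n => (hτ n).2)
      tendsto_one_div_add_atTop_nhds_zero_nat
  obtain ⟨C, hC⟩ := banach_steinhaus (g := fun n => S (τ n)) (fun x => by
    have := ((hS.tendsto_nhdsGE x).comp hτ0).norm.bddAbove_range
    obtain ⟨C, hC⟩ := this
    exact ⟨C, fun i => hC ⟨i, rfl⟩⟩)
  obtain ⟨n, hn'⟩ := exists_nat_gt C
  linarith [hC n, hn n]

theorem exists_exp_bound [CompleteSpace X] (hS : IsC0Semigroup S) :
    ∃ M ω : ℝ, 1 ≤ M ∧ 0 ≤ ω ∧ ∀ t, 0 ≤ t → ‖S t‖ ≤ M * Real.exp (ω * t) := by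
  obtain ⟨δ, hδ, M₀, hM₀⟩ := hS.exists_bound_near_zero
  set M := max M₀ 1
  have hM1 : 1 ≤ M := le_max_right _ _
  have hM : ∀ t ∈ Icc (0 : ℝ) δ, ‖S t‖ ≤ M := fun t ht => (hM₀ t ht).trans (le_max_left _ _)
  have hpow : ∀ n : ℕ, ∀ t, 0 ≤ t → t ≤ (n + 1) * δ → ‖S t‖ ≤ M ^ (n + 1) := by
    intro n
    induction n with
    | zero => intro t h0 h1; simpa using hM t ⟨h0, by simpa using h1⟩
    | succ n ih =>
      intro t h0 h1
      rcases le_total t δ with h | h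
      · exact (hM t ⟨h0, h⟩).trans (le_self_pow₀ hM1 (by simp))
      · have : S t = S (t - δ) * S δ := by
          rw [← hS.add _ _ (by linarith) hδ.le]; congr 1; ring
        rw [this, pow_succ]
        refine (norm_mul_le _ _).trans ?_
        have h2 := ih (t - δ) (by linarith) (by push_cast at h1; linarith)
        exact mul_le_mul h2 (hM δ ⟨hδ.le, le_rfl⟩) (norm_nonneg _) (by positivity)
  -- The rate turns `M ^ ⌊t / δ⌋ ≤ M ^ (t / δ)` into an exponential; the remaining factor `M`
  -- accounts for the last incomplete interval.
  refine ⟨M, Real.log M / δ, hM1, div_nonneg (Real.log_nonneg hM1) hδ.le, fun t ht => ?_⟩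
  have h1 : t ≤ (⌊t / δ⌋₊ + 1) * δ := by
    rw [← div_le_iff₀ hδ]; exact (Nat.lt_floor_add_one _).le
  refine (hpow _ t ht h1).trans ?_
  rw [pow_succ, mul_comm]
  gcongr
  rw [← Real.rpow_natCast, Real.rpow_def_of_pos (by positivity)]
  apply Real.exp_le_exp.2
  have : (⌊t / δ⌋₊ : ℝ) ≤ t / δ := Nat.floor_le (by positivity)
  calc Real.log M * ⌊t / δ⌋₊ ≤ Real.log M * (t / δ) :=
        mul_le_mul_of_nonneg_left this (Real.log_nonneg hM1)
    _ = _ := by ring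

theorem exists_bound [CompleteSpace X] (hS : IsC0Semigroup S) (τ : ℝ) :
    ∃ M : ℝ, 1 ≤ M ∧ ∀ t ∈ Icc (0 : ℝ) τ, ‖S t‖ ≤ M := by
  obtain ⟨M, ω, hM, hω, h⟩ := hS.exists_exp_bound
  rcases lt_or_ge τ 0 with hτ | hτ
  · exact ⟨1, le_rfl, fun t ht => absurd (ht.1.trans ht.2) (not_le.2 hτ)⟩
  refine ⟨M * Real.exp (ω * τ), ?_, fun t ht => (h t ht.1).trans ?_⟩
  · exact one_le_mul_of_one_le_of_one_le hM (Real.one_le_exp (by positivity))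
  · have := ht.2
    gcongr

/-- The semigroup, extended to negative times by the identity, is jointly continuous. -/
theorem continuous_clamp [CompleteSpace X] (hS : IsC0Semigroup S) :
    Continuous fun q : ℝ × X => S (max q.1 0) q.2 := by
  rw [continuous_iff_continuousAt]
  rintro ⟨t, x⟩
  obtain ⟨M, hM1, hM⟩ := hS.exists_bound (max t 0 + 1)
  -- The semigroup law moves continuity at any time, from either side, to strong continuity at `0`;
  -- the local bound `M` makes this uniform.
  have key : ∀ a b : ℝ, 0 ≤ a → 0 ≤ b → a ≤ max t 0 + 1 → b ≤ max t 0 + 1 →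
      ‖S a x - S b x‖ ≤ M * ‖S |a - b| x - x‖ := by
    have main : ∀ a b : ℝ, 0 ≤ a → a ≤ b → a ≤ max t 0 + 1 →
        ‖S a x - S b x‖ ≤ M * ‖S |a - b| x - x‖ := by
      intro a b ha hab ha'
      have : S b = S a * S |a - b| := by
        rw [← hS.add _ _ ha (abs_nonneg _), abs_sub_comm, abs_of_nonneg (sub_nonneg.2 hab)]
        congr 1; ring
      rw [this, mul_apply_eq_comp, ← map_sub, norm_sub_rev (S |a - b| x)]
      exact (S a).le_of_opNorm_le (hM a ⟨ha, ha'⟩) _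
    intro a b ha hb ha' hb'
    rcases le_total a b with h | h
    · exact main a b ha h ha'
    · rw [norm_sub_rev, abs_sub_comm]; exact main b a hb h hb'
  have hlim : Tendsto (fun q : ℝ × X => M * ‖S |max q.1 0 - max t 0| x - x‖ + M * ‖q.2 - x‖)
      (𝓝 (t, x)) (𝓝 0) := by
    have h1 : Tendsto (fun q : ℝ × X => |max q.1 0 - max t 0|) (𝓝 (t, x)) (𝓝[≥] 0) := by
      refine tendsto_nhdsWithin_iff.2 ⟨?_, Eventually.of_forall fun q => mem_Ici.2 (abs_nonneg _)⟩
      have : Continuous fun q : ℝ × X => |max q.1 0 - max t 0| := by fun_prop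
      simpa using this.tendsto (t, x)
    have h2 := ((hS.tendsto_nhdsGE x).comp h1).sub_const x |>.norm.const_mul M
    have h3 : Tendsto (fun q : ℝ × X => M * ‖q.2 - x‖) (𝓝 (t, x)) (𝓝 0) := by
      have : Continuous fun q : ℝ × X => M * ‖q.2 - x‖ := by fun_prop
      simpa using this.tendsto (t, x)
    simpa using h2.add h3
  rw [ContinuousAt, tendsto_iff_norm_sub_tendsto_zero]
  refine squeeze_zero' (Eventually.of_forall fun _ => norm_nonneg _) ?_ hlim
  have hev : ∀ᶠ q : ℝ × X in 𝓝 (t, x), max q.1 0 < max t 0 + 1 := by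
    have : Continuous fun q : ℝ × X => max q.1 0 := by fun_prop
    exact this.continuousAt.eventually_lt continuousAt_const (by simp)
  filter_upwards [hev] with q hq
  have e : S (max q.1 0) q.2 - S (max t 0) x
      = (S (max q.1 0) x - S (max t 0) x) + S (max q.1 0) (q.2 - x) := by
    rw [map_sub]; abel
  rw [e]
  refine (norm_add_le _ _).trans (add_le_add ?_ ?_)
  · exact key _ _ (le_max_right _ _) (le_max_right _ _) hq.le (by simp)
  · exact (S _).le_of_opNorm_le (hM _ ⟨le_max_right _ _, hq.le⟩) _

/-- Orbits carry the clamp `max t 0` throughout: nothing is known about `S` at negative times,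
whereas integration wants functions continuous on all of `ℝ`. -/
theorem continuous_clamp_apply [CompleteSpace X] (hS : IsC0Semigroup S) (x : X) :
    Continuous fun t : ℝ => S (max t 0) x :=
  hS.continuous_clamp.comp (by fun_prop : Continuous fun t : ℝ => (t, x))

theorem apply_comm (hS : IsC0Semigroup S) {s t : ℝ} (hs : 0 ≤ s) (ht : 0 ≤ t) (x : X) :
    S s (S t x) = S t (S s x) := by
  rw [← mul_apply_eq_comp, ← mul_apply_eq_comp, ← hS.add s t hs ht,
    ← hS.add t s ht hs, add_comm]

theorem zero_apply (hS : IsC0Semigroup S) (x : X) : S 0 x = x := by rw [hS.zero]; rfl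

theorem add_apply (hS : IsC0Semigroup S) {s t : ℝ} (hs : 0 ≤ s) (ht : 0 ≤ t) (x : X) :
    S (s + t) x = S s (S t x) := by rw [hS.add s t hs ht]; rfl

/-- `S t x = x + ∫_0^t S s (A x) ds` for `x` in the domain of the generator. -/
theorem apply_eq_add_integral [CompleteSpace X] (hS : IsC0Semigroup S) (hA : IsGenerator A S)
    {x y : X} (hxy : (x, y) ∈ A.graph) {t : ℝ} (ht : 0 ≤ t) :
    S (max t 0) x = x + ∫ s in (0 : ℝ)..t, S (max s 0) y := by
  have hcx := hS.continuous_clamp_apply x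
  have hcy := hS.continuous_clamp_apply y
  have hintegrable : ∀ r, HasDerivAt (fun t => ∫ s in (0 : ℝ)..t, S (max s 0) y) (S (max r 0) y) r :=
    fun r => intervalIntegral.integral_hasDerivAt_right (hcy.intervalIntegrable _ _)
      hcy.stronglyMeasurable.stronglyMeasurableAtFilter hcy.continuousAt
  -- The definition of the generator gives only the right derivative of an orbit; for a continuous
  -- function a vanishing right derivative already forces constancy.
  have hconst := constant_of_has_deriv_right_zero (a := 0) (b := t)
    (f := fun r => S (max r 0) x - ∫ s in (0 : ℝ)..r, S (max s 0) y)
    (hcx.sub (continuous_iff_continuousAt.2 fun r => (hintegrable r).continuousAt)).continuousOn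
    (fun r hr => by
      have h0 := hr.1
      have hd : HasDerivWithinAt (fun r => S (max r 0) x) (S (max r 0) y) (Ici r) r := by
        rw [← hasDerivWithinAt_Ioi_iff_Ici, hasDerivWithinAt_iff_tendsto_slope' (by simp)]
        have h1 := (hA x y).1 hxy
        have h2 := ((S (max r 0)).continuous.tendsto y).comp h1
        have h3 : Tendsto (fun r' => r' - r) (𝓝[>] r) (𝓝[>] 0) := by
          refine tendsto_nhdsWithin_iff.2 ⟨?_, ?_⟩
          · have : Tendsto (fun r' => r' - r) (𝓝 r) (𝓝 0) := by
              simpa using (tendsto_id (x := 𝓝 r)).sub_const r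
            exact this.mono_left nhdsWithin_le_nhds
          · filter_upwards [self_mem_nhdsWithin] with r' hr'
            exact mem_Ioi.2 (sub_pos.2 (mem_Ioi.1 hr'))
        refine (h2.comp h3).congr' ?_
        filter_upwards [self_mem_nhdsWithin] with r' hr'
        have hr'' : r < r' := hr'
        simp only [Function.comp, slope, vsub_eq_sub, map_smul, map_sub]
        congr 2
        rw [max_eq_left h0, max_eq_left (h0.trans hr''.le),
          ← hS.add_apply h0 (sub_nonneg.2 hr''.le), add_sub_cancel]
      have := hd.sub (hintegrable r).hasDerivWithinAt
      rw [sub_self] at this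
      exact this)
  have := hconst t ⟨ht, le_rfl⟩
  simp only [max_self, hS.zero_apply, intervalIntegral.integral_same, sub_zero] at this
  exact sub_eq_iff_eq_add.1 this

/-- Converse of `apply_eq_add_integral`. -/
theorem mem_graph_of_apply_eq [CompleteSpace X] (hS : IsC0Semigroup S) (hA : IsGenerator A S)
    {x y : X} (h : ∀ t, 0 ≤ t → S (max t 0) x = x + ∫ s in (0 : ℝ)..t, S (max s 0) y) :
    (x, y) ∈ A.graph := by
  rw [hA x y]
  have hcy := hS.continuous_clamp_apply y
  have hintegrable : HasDerivAt (fun t => ∫ s in (0 : ℝ)..t, S (max s 0) y) (S (max 0 0) y) 0 :=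
    intervalIntegral.integral_hasDerivAt_right (hcy.intervalIntegrable _ _)
      hcy.stronglyMeasurable.stronglyMeasurableAtFilter hcy.continuousAt
  have h1 := hintegrable.hasDerivWithinAt (s := Ioi 0)
  rw [hasDerivWithinAt_iff_tendsto_slope' (by simp), max_self, hS.zero_apply] at h1
  refine h1.congr' ?_
  filter_upwards [self_mem_nhdsWithin] with t ht
  have ht' : (0 : ℝ) < t := ht
  have := h t ht'.le
  rw [max_eq_left ht'.le] at this
  simp [slope, this]

/-- The generator is a closed operator. -/
theorem mem_graph_of_tendsto [CompleteSpace X] (hS : IsC0Semigroup S) (hA : IsGenerator A S)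
    {ι : Type*} {l : Filter ι} [l.NeBot] {x y : ι → X} {x₀ y₀ : X} (hx : Tendsto x l (𝓝 x₀))
    (hy : Tendsto y l (𝓝 y₀)) (hxy : ∀ᶠ i in l, (x i, y i) ∈ A.graph) : (x₀, y₀) ∈ A.graph := by
  -- Membership in the graph is equivalent to an integral identity whose two sides depend
  -- continuously on the pair.
  refine hS.mem_graph_of_apply_eq hA fun t ht => ?_
  have hc : Continuous fun z : X => ∫ s in (0 : ℝ)..t, S (max s 0) z := by
    apply intervalIntegral.continuous_parametric_intervalIntegral_of_continuous'
    exact hS.continuous_clamp.comp (by fun_prop : Continuous fun q : X × ℝ => (q.2, q.1))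
  have h1 := ((S (max t 0)).continuous.tendsto x₀).comp hx
  have h2 := hx.add ((hc.tendsto y₀).comp hy)
  refine tendsto_nhds_unique (h1.congr' ?_) h2
  filter_upwards [hxy] with i hi
  exact hS.apply_eq_add_integral hA hi ht

/-- Applying `S r` to the integral shifts its interval to `[r, t + r]`, so the difference quotient
is the mean of the orbit over `[t, t + r]` minus its mean over `[0, r]`. -/
theorem integral_mem_graph [CompleteSpace X] (hS : IsC0Semigroup S) (hA : IsGenerator A S)
    (x : X) {t : ℝ} (ht : 0 ≤ t) :
    (∫ s in (0 : ℝ)..t, S (max s 0) x, S t x - x) ∈ A.graph := by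
  rw [hA]
  have hc := hS.continuous_clamp_apply x
  have hII : ∀ a b, IntervalIntegrable (fun s => S (max s 0) x) MeasureTheory.volume a b :=
    fun a b => hc.intervalIntegrable a b
  have hintegrable : ∀ r, HasDerivAt (fun t => ∫ s in (0 : ℝ)..t, S (max s 0) x) (S (max r 0) x) r :=
    fun r => intervalIntegral.integral_hasDerivAt_right (hII _ _)
      hc.stronglyMeasurable.stronglyMeasurableAtFilter hc.continuousAt
  have h1 : HasDerivAt (fun r => ∫ s in (0 : ℝ)..(r + t), S (max s 0) x)
      (S (max t 0) x) 0 := by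
    simpa using HasDerivAt.comp_add_const (x := (0 : ℝ)) (a := t) (by simpa using hintegrable t)
  have h2 := ((h1.sub (hintegrable 0)).hasDerivWithinAt (s := Ioi 0))
  rw [hasDerivWithinAt_iff_tendsto_slope' (by simp), max_self, hS.zero_apply,
    max_eq_left ht] at h2
  refine h2.congr' ?_
  filter_upwards [self_mem_nhdsWithin] with r hr
  have hr' : (0 : ℝ) < r := hr
  simp only [slope, vsub_eq_sub, sub_zero, Pi.sub_apply, zero_add,
    intervalIntegral.integral_same]
  congr 1
  have e1 : S r (∫ s in (0 : ℝ)..t, S (max s 0) x) = ∫ s in r..(t + r), S (max s 0) x := by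
    rw [← ContinuousLinearMap.intervalIntegral_comp_comm _ (hII 0 t)]
    have := intervalIntegral.integral_comp_add_right (a := (0 : ℝ)) (b := t)
      (fun s => S (max s 0) x) r
    rw [zero_add] at this
    rw [← this]
    refine intervalIntegral.integral_congr fun s hs => ?_
    rw [uIcc_of_le ht] at hs
    have hs0 := hs.1
    rw [max_eq_left hs0, max_eq_left (by linarith), add_comm s r, hS.add_apply hr'.le hs0]
  rw [e1, add_comm r t]
  have h3 := intervalIntegral.integral_add_adjacent_intervals (hII 0 r) (hII r (t + r))
  rw [← h3]; abel

/-- The means of an orbit over `[0, r]` lie in the domain by `integral_mem_graph` and tend to its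
starting value. -/
theorem dense_domain [CompleteSpace X] (hS : IsC0Semigroup S) (hA : IsGenerator A S) :
    Dense (A.domain : Set X) := by
  intro x
  have hc := hS.continuous_clamp_apply x
  have hintegrable : HasDerivAt (fun t => ∫ s in (0 : ℝ)..t, S (max s 0) x) (S (max 0 0) x) 0 :=
    intervalIntegral.integral_hasDerivAt_right (hc.intervalIntegrable _ _)
      hc.stronglyMeasurable.stronglyMeasurableAtFilter hc.continuousAt
  have h2 := hintegrable.hasDerivWithinAt (s := Ioi 0)
  rw [hasDerivWithinAt_iff_tendsto_slope' (by simp), max_self, hS.zero_apply] at h2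
  refine mem_closure_of_tendsto h2 ?_
  filter_upwards [self_mem_nhdsWithin] with r hr
  have hr' : (0 : ℝ) < r := hr
  simp only [slope, vsub_eq_sub, sub_zero, intervalIntegral.integral_same]
  obtain ⟨z, hz, -⟩ := (LinearPMap.mem_graph_iff _).1 (hS.integral_mem_graph hA x hr'.le)
  have hz' : (z : X) = ∫ s in (0 : ℝ)..r, S (max s 0) x := hz
  rw [← hz']
  exact A.domain.smul_mem _ z.2

theorem hasDerivAt_clamp [CompleteSpace X] (hS : IsC0Semigroup S) (hA : IsGenerator A S)
    {x y : X} (hxy : (x, y) ∈ A.graph) {t : ℝ} (ht : 0 < t) :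
    HasDerivAt (fun t => S (max t 0) x) (S (max t 0) y) t := by
  have hc := hS.continuous_clamp_apply y
  have hintegrable : HasDerivAt (fun t => x + ∫ s in (0 : ℝ)..t, S (max s 0) y) (S (max t 0) y) t :=
    (intervalIntegral.integral_hasDerivAt_right (hc.intervalIntegrable _ _)
      hc.stronglyMeasurable.stronglyMeasurableAtFilter hc.continuousAt).const_add x
  refine hintegrable.congr_of_eventuallyEq ?_
  filter_upwards [lt_mem_nhds ht] with r hr
  exact hS.apply_eq_add_integral hA hxy hr.le

theorem apply_mem_graph [CompleteSpace X] (hS : IsC0Semigroup S) (hA : IsGenerator A S)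
    {x y : X} (hxy : (x, y) ∈ A.graph) {t : ℝ} (ht : 0 ≤ t) : (S t x, S t y) ∈ A.graph := by
  rw [hA]
  refine (((S t).continuous.tendsto y).comp ((hA x y).1 hxy)).congr' ?_
  filter_upwards [self_mem_nhdsWithin] with r hr
  simp only [Function.comp, map_smul, map_sub]
  rw [hS.apply_comm (le_of_lt hr) ht]

/-- Variation of constants: if `v' = A v + f` then `v h = S h (v 0) + ∫_0^h S (h - s) (f s) ds`. -/
theorem duhamel [CompleteSpace X] (hS : IsC0Semigroup S) (hA : IsGenerator A S) {v v' f : ℝ → X}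
    {h : ℝ} (hh : 0 ≤ h) (hv : ContinuousOn v (Icc 0 h)) (hf : ContinuousOn f (Icc 0 h))
    (hd : ∀ s ∈ Ioo 0 h, HasDerivAt v (v' s) s)
    (hg : ∀ s ∈ Ioo 0 h, (v s, v' s - f s) ∈ A.graph) :
    v h = S h (v 0) + ∫ s in (0 : ℝ)..h, S (max (h - s) 0) (f s) := by
  have hcomp : ∀ w : ℝ → X, ContinuousOn w (Icc 0 h) →
      ContinuousOn (fun s => S (max (h - s) 0) (w s)) (Icc 0 h) := fun w hw =>
    hS.continuous_clamp.comp_continuousOn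
      (f := fun s : ℝ => (h - s, w s)) ((by fun_prop : Continuous fun s : ℝ => h - s).continuousOn.prodMk hw)
  -- In the derivative of `s ↦ S (h - s) (v s)` the terms containing `A` cancel and `S (h - s) (f
  -- s)` remains.
  have key := intervalIntegral.integral_eq_sub_of_hasDerivAt_of_le hh (hcomp v hv)
    (f' := fun s => S (max (h - s) 0) (f s))
    (fun s hs => by
      have h2 : HasDerivAt (fun r => S (max (h - r) 0) (v s))
          (-(S (max (h - s) 0) (v' s - f s))) s := by
        have := (hS.hasDerivAt_clamp hA (hg s hs) (sub_pos.2 hs.2)).scomp s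
          ((hasDerivAt_id s).const_sub h)
        simpa [Function.comp_def] using this
      -- The usual product rule would need differentiability in operator norm. Instead `v r` is
      -- split as `(v r - v s) + v s`: the first part is handled by joint continuity, the second
      -- because `v s` lies in the domain.
      have h1 : HasDerivAt (fun r => S (max (h - r) 0) (v r - v s))
          (S (max (h - s) 0) (v' s)) s := by
        rw [hasDerivAt_iff_tendsto_slope]
        have h3 := hasDerivAt_iff_tendsto_slope.1 (hd s hs)
        have h4 : Tendsto (fun r => h - r) (𝓝[≠] s) (𝓝 (h - s)) :=
          ((by fun_prop : Continuous fun r : ℝ => h - r).tendsto s).mono_left nhdsWithin_le_nhds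
        refine ((hS.continuous_clamp.tendsto (h - s, v' s)).comp (h4.prodMk_nhds h3)).congr ?_
        intro r
        simp [slope]
      have := h1.add h2
      have e : (fun r => S (max (h - r) 0) (v r - v s)) + (fun r => S (max (h - r) 0) (v s))
          = fun r => S (max (h - r) 0) (v r) := by
        ext r; simp
      rw [e] at this
      convert this using 1
      simp)
    ((hcomp f hf).intervalIntegrable_of_Icc hh)
  rw [key]
  simp [hS.zero_apply, max_eq_left hh]

end IsC0Semigroup

end SemigroupBasics

/-! ### Bounded perturbation of generators through a Volterra equation. -/

section BoundedPerturbation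

variable {X : Type*} [NormedAddCommGroup X] [NormedSpace ℝ X]
  {S T : ℝ → X →L[ℝ] X} {A : X →ₗ.[ℝ] X}

theorem LinearPMap.mem_graph_vadd_iff (B : X →L[ℝ] X) (A : X →ₗ.[ℝ] X) (x y : X) :
    (x, y) ∈ (B.toLinearMap +ᵥ A).graph ↔ (x, y - B x) ∈ A.graph := by
  simp only [LinearPMap.mem_graph_iff]
  constructor
  · rintro ⟨z, hz, hy⟩
    refine ⟨⟨z, z.2⟩, hz, ?_⟩
    rw [LinearPMap.vadd_apply] at hy
    have hz' : (z : X) = x := hz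
    rw [← hz']
    exact eq_sub_of_add_eq' hy
  · rintro ⟨z, hz, hy⟩
    refine ⟨⟨z, z.2⟩, hz, ?_⟩
    rw [LinearPMap.vadd_apply]
    have hz' : (z : X) = x := hz
    have : A z = y - B x := hy
    change B (z : X) + A z = y
    rw [this, hz']; abel

/-- `T` solves the Volterra equation that characterises the semigroup generated by `B + A`. -/
def IsVolterraSolution (S T : ℝ → X →L[ℝ] X) (B : X →L[ℝ] X) : Prop :=
  ∀ (x : X) (t : ℝ), 0 ≤ t →
    T t x = S t x + ∫ s in (0 : ℝ)..t, S (max (t - s) 0) (B (T (max s 0) x))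

/-- After division by `t` the integral term tends to `B x`, so the difference quotients of `T` and
`S` at `x` converge together, with limits that differ by `B x`. -/
theorem IsVolterraSolution.isGenerator [CompleteSpace X] {B : X →L[ℝ] X}
    (hV : IsVolterraSolution S T B) (hS : IsC0Semigroup S) (hT : IsC0Semigroup T)
    (hA : IsGenerator A S) : IsGenerator (B.toLinearMap +ᵥ A) T := by
  intro x y
  rw [LinearPMap.mem_graph_vadd_iff, hA]
  have hlim : Tendsto (fun t : ℝ => t⁻¹ • ∫ s in (0 : ℝ)..t, S (max (t - s) 0)
      (B (T (max s 0) x))) (𝓝[>] 0) (𝓝 (B x)) := by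
    -- The substitution `s = t θ` makes the mean value continuous down to `t = 0`, where the
    -- integrand is `B x`.
    have hc : Continuous fun t : ℝ => ∫ θ in (0 : ℝ)..1, S (max (t - t * θ) 0)
        (B (T (max (t * θ) 0) x)) := by
      apply intervalIntegral.continuous_parametric_intervalIntegral_of_continuous'
      have h1 : Continuous fun q : ℝ × ℝ => B (T (max (q.1 * q.2) 0) x) :=
        B.continuous.comp ((hT.continuous_clamp_apply x).comp (by fun_prop))
      exact hS.continuous_clamp.comp
        ((by fun_prop : Continuous fun q : ℝ × ℝ => q.1 - q.1 * q.2).prodMk h1)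
    have h0 := (hc.tendsto 0).mono_left (nhdsWithin_le_nhds (s := Ioi (0 : ℝ)))
    simp only [zero_mul, sub_zero, max_self, hS.zero_apply, hT.zero_apply,
      intervalIntegral.integral_const, one_smul] at h0
    refine h0.congr' ?_
    filter_upwards [self_mem_nhdsWithin] with t ht
    have ht' : (0 : ℝ) < t := ht
    have := intervalIntegral.smul_integral_comp_mul_left (a := (0 : ℝ)) (b := 1)
      (fun s => S (max (t - s) 0) (B (T (max s 0) x))) t
    rw [mul_zero, mul_one] at this
    rw [← this, smul_smul, inv_mul_cancel₀ ht'.ne', one_smul]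
  have e : ∀ᶠ t in 𝓝[>] (0 : ℝ), t⁻¹ • (T t x - x) = t⁻¹ • (S t x - x) +
      t⁻¹ • ∫ s in (0 : ℝ)..t, S (max (t - s) 0) (B (T (max s 0) x)) := by
    filter_upwards [self_mem_nhdsWithin] with t ht
    rw [hV x t (le_of_lt ht), ← smul_add]; congr 1; abel
  constructor
  · intro h
    have := h.add hlim
    rw [sub_add_cancel] at this
    exact this.congr' (e.mono fun t ht => ht.symm)
  · intro h
    have := h.sub hlim
    refine this.congr' (e.mono fun t ht => ?_)
    rw [ht, add_sub_cancel_right]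

theorem exp_bound_integral_le {μ t : ℝ} (hμ : 0 < μ) :
    ∫ s in (0 : ℝ)..t, Real.exp (-μ * (t - s)) ≤ 1 / μ := by
  have h : ∀ s ∈ uIcc 0 t, HasDerivAt (fun s => Real.exp (-μ * (t - s)) / μ)
      (Real.exp (-μ * (t - s))) s := by
    intro s _
    have h1 : HasDerivAt (fun s => -μ * (t - s)) μ s := by
      simpa using ((hasDerivAt_id s).const_sub t).const_mul (-μ)
    have := h1.exp.div_const μ
    rwa [mul_div_assoc, div_self hμ.ne', mul_one] at this
  rw [intervalIntegral.integral_eq_sub_of_hasDerivAt h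
    ((by fun_prop : Continuous fun s => Real.exp (-μ * (t - s))).intervalIntegrable _ _)]
  simp only [sub_self, mul_zero, Real.exp_zero, sub_zero]
  have : 0 ≤ Real.exp (-μ * t) / μ := by positivity
  linarith

open BoundedContinuousFunction in
/-- The Volterra operator `V ↦ ∫_0^t S (t - s) B V s ds` on bounded continuous functions. -/
theorem exists_volterra_operator [CompleteSpace X] (hS : IsC0Semigroup S) (B : X →L[ℝ] X)
    {M μ : ℝ} (hM : 0 ≤ M) (hμ : 0 < μ) (hb : ∀ t, 0 ≤ t → ‖S t‖ ≤ M * Real.exp (-μ * t)) :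
    ∃ K : (ℝ →ᵇ X) →L[ℝ] (ℝ →ᵇ X), ‖K‖ ≤ M * ‖B‖ / μ ∧ ∀ V t,
      K V t = ∫ s in (0 : ℝ)..max t 0, S (max (max t 0 - s) 0) (B (V s)) := by
  have hcont : ∀ (V : ℝ →ᵇ X), Continuous fun q : ℝ × ℝ =>
      S (max (max q.1 0 - q.2) 0) (B (V q.2)) := fun V =>
    hS.continuous_clamp.comp ((by fun_prop : Continuous fun q : ℝ × ℝ => max q.1 0 - q.2).prodMk
      (B.continuous.comp (V.continuous.comp continuous_snd)))
  have hII : ∀ (V : ℝ →ᵇ X) (t a b : ℝ), IntervalIntegrable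
      (fun s => S (max (max t 0 - s) 0) (B (V s))) MeasureTheory.volume a b := fun V t a b =>
    ((hcont V).comp (by fun_prop : Continuous fun s : ℝ => (t, s))).intervalIntegrable a b
  have hbound : ∀ (V : ℝ →ᵇ X) (t : ℝ),
      ‖∫ s in (0 : ℝ)..max t 0, S (max (max t 0 - s) 0) (B (V s))‖ ≤ M * ‖B‖ / μ * ‖V‖ := by
    intro V t
    have h0 : 0 ≤ max t 0 := le_max_right _ _
    have : ∀ s ∈ Ioc 0 (max t 0), ‖S (max (max t 0 - s) 0) (B (V s))‖
        ≤ M * ‖B‖ * ‖V‖ * Real.exp (-μ * (max t 0 - s)) := by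
      intro s hs
      have h1 : 0 ≤ max t 0 - s := sub_nonneg.2 hs.2
      rw [max_eq_left h1]
      calc _ ≤ M * Real.exp (-μ * (max t 0 - s)) * ‖B (V s)‖ :=
            (S _).le_of_opNorm_le (hb _ h1) _
        _ ≤ M * Real.exp (-μ * (max t 0 - s)) * (‖B‖ * ‖V‖) := by
            gcongr; exact B.le_opNorm_of_le (V.norm_coe_le_norm s)
        _ = _ := by ring
    refine (intervalIntegral.norm_integral_le_of_norm_le h0 (Eventually.of_forall this)
      ((by fun_prop : Continuous fun s => M * ‖B‖ * ‖V‖ * Real.exp (-μ * (max t 0 - s))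
        ).intervalIntegrable _ _)).trans ?_
    rw [intervalIntegral.integral_const_mul]
    calc _ ≤ M * ‖B‖ * ‖V‖ * (1 / μ) := by gcongr; exact exp_bound_integral_le hμ
      _ = _ := by ring
  refine ⟨LinearMap.mkContinuous
    { toFun := fun V => ofNormedAddCommGroup
        (fun t => ∫ s in (0 : ℝ)..max t 0, S (max (max t 0 - s) 0) (B (V s)))
        (intervalIntegral.continuous_parametric_intervalIntegral_of_continuous (hcont V)
          (by fun_prop)) _ (hbound V)
      map_add' := fun V W => by
        ext t
        simp only [coe_ofNormedAddCommGroup, BoundedContinuousFunction.coe_add, Pi.add_apply,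
          map_add]
        exact intervalIntegral.integral_add (hII V t _ _) (hII W t _ _)
      map_smul' := fun c V => by
        ext t
        simp [intervalIntegral.integral_smul] } (M * ‖B‖ / μ) ?_, ?_, ?_⟩
  · intro V
    exact (norm_le (by positivity)).2 (hbound V)
  · exact LinearMap.mkContinuous_norm_le _ (by positivity) _
  · intro V t; rfl

open BoundedContinuousFunction in
-- When the decay beats `M * ‖B‖`, the Volterra operator `K` has norm below `1` on the bounded
-- continuous functions on the whole line. The perturbed orbit of `x` is then `(1 - K)⁻¹` applied to
-- the unperturbed one, and the semigroup law follows from uniqueness of this fixed point.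
theorem exists_volterraSolution_of_decay [CompleteSpace X] (hS : IsC0Semigroup S) (B : X →L[ℝ] X)
    {M μ : ℝ} (hM : 0 ≤ M) (hμ : 0 < μ) (hb : ∀ t, 0 ≤ t → ‖S t‖ ≤ M * Real.exp (-μ * t))
    (hsmall : M * ‖B‖ < μ) :
    ∃ T : ℝ → X →L[ℝ] X, IsC0Semigroup T ∧ IsVolterraSolution S T B := by
  obtain ⟨K, hK, hKV⟩ := exists_volterra_operator hS B hM hμ hb
  have hK1 : ‖K‖ < 1 := hK.trans_lt ((div_lt_one hμ).2 hsmall)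
  have hbd : ∀ (x : X) (t : ℝ), ‖S (max t 0) x‖ ≤ M * ‖x‖ := fun x t =>
    (S _).le_of_opNorm_le ((hb _ (le_max_right _ _)).trans (by
      have : Real.exp (-μ * max t 0) ≤ 1 := Real.exp_le_one_iff.2 (by
        have := le_max_right t 0; nlinarith)
      nlinarith)) _
  let ι : X →L[ℝ] (ℝ →ᵇ X) := LinearMap.mkContinuous
    { toFun := fun x => ofNormedAddCommGroup (fun t => S (max t 0) x)
        (hS.continuous_clamp_apply x) _ (hbd x)
      map_add' := fun x y => by ext t; simp
      map_smul' := fun c x => by ext t; simp } M (fun x => (norm_le (by positivity)).2 (hbd x))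
  have hι : ∀ x t, ι x t = S (max t 0) x := fun _ _ => rfl
  let G := (Units.oneSub K hK1)⁻¹
  have hG1 : ∀ W : ℝ →ᵇ X, (G : (ℝ →ᵇ X) →L[ℝ] (ℝ →ᵇ X)) (W - K W) = W := by
    intro W
    have : (G : (ℝ →ᵇ X) →L[ℝ] (ℝ →ᵇ X)) * (1 - K) = 1 := by
      have := (Units.oneSub K hK1).inv_mul
      rwa [Units.val_oneSub] at this
    simpa using congrArg (fun F => F W) this
  have hG2 : ∀ W : ℝ →ᵇ X, (G : (ℝ →ᵇ X) →L[ℝ] (ℝ →ᵇ X)) W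
      = W + K ((G : (ℝ →ᵇ X) →L[ℝ] (ℝ →ᵇ X)) W) := by
    intro W
    have : (1 - K) * (G : (ℝ →ᵇ X) →L[ℝ] (ℝ →ᵇ X)) = 1 := by
      have := (Units.oneSub K hK1).mul_inv
      rwa [Units.val_oneSub] at this
    have := congrArg (fun F => F W) this
    simp only [mul_apply_eq_comp, _root_.sub_apply,
      one_apply_eq_self] at this
    exact sub_eq_iff_eq_add.1 this
  let V : X → (ℝ →ᵇ X) := fun x => (G : (ℝ →ᵇ X) →L[ℝ] (ℝ →ᵇ X)) (ι x)
  have hVeq : ∀ x t, 0 ≤ t → V x t = S t x + ∫ s in (0 : ℝ)..t, S (max (t - s) 0) (B (V x s)) := by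
    intro x t ht
    have := congrArg (fun F : ℝ →ᵇ X => F t) (hG2 (ι x))
    simp only [BoundedContinuousFunction.coe_add, Pi.add_apply, hι, hKV, max_eq_left ht] at this
    exact this
  have hV0 : ∀ x, V x 0 = x := fun x => by simpa [hS.zero_apply] using hVeq x 0 le_rfl
  have hVII : ∀ (x : X) (t a b : ℝ), IntervalIntegrable
      (fun s => S (max (t - s) 0) (B (V x s))) MeasureTheory.volume a b := fun x t a b =>
    (hS.continuous_clamp.comp ((by fun_prop : Continuous fun s : ℝ => t - s).prodMk
      (B.continuous.comp (V x).continuous))).intervalIntegrable a b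
  -- The orbit shifted by `s` and frozen for negative times satisfies the fixed point equation with
  -- starting value `V x s`, so it is the orbit of `V x s`.
  have hshift : ∀ x s t, 0 ≤ s → 0 ≤ t → V x (t + s) = V (V x s) t := by
    intro x s t hs ht
    let W : ℝ →ᵇ X := (V x).compContinuous ⟨fun t => max t 0 + s, by fun_prop⟩
    have hW : ∀ t, W t = V x (max t 0 + s) := fun _ => rfl
    have hWK : W - K W = ι (V x s) := by
      ext r
      rw [BoundedContinuousFunction.sub_apply, hKV, hι, hW]
      set τ := max r 0
      have hτ : 0 ≤ τ := le_max_right _ _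
      rw [hVeq x (τ + s) (by positivity), sub_eq_iff_eq_add]
      rw [hVeq x s hs]
      rw [map_add, ← hS.add_apply hτ hs, add_assoc]
      congr 1
      rw [← intervalIntegral.integral_add_adjacent_intervals (hVII x (τ + s) 0 s)
        (hVII x (τ + s) s (τ + s))]
      congr 1
      · rw [← ContinuousLinearMap.intervalIntegral_comp_comm _ (hVII x s 0 s)]
        refine intervalIntegral.integral_congr fun q hq => ?_
        rw [uIcc_of_le hs] at hq
        have h1 : 0 ≤ s - q := sub_nonneg.2 hq.2
        rw [max_eq_left h1, max_eq_left (by linarith), ← hS.add_apply hτ h1]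
        congr 2; ring
      · have := intervalIntegral.integral_comp_add_right (a := (0 : ℝ)) (b := τ)
          (fun q => S (max (τ + s - q) 0) (B (V x q))) s
        rw [zero_add] at this
        rw [← this]
        refine intervalIntegral.integral_congr fun q hq => ?_
        rw [uIcc_of_le hτ] at hq
        simp only [hW]
        rw [max_eq_left hq.1]
        congr 2; ring_nf
    have h1 := hG1 W
    rw [hWK] at h1
    have h2 := congrArg (fun F : ℝ →ᵇ X => F t) h1
    simp only [hW, max_eq_left ht] at h2
    exact h2.symm
  refine ⟨fun t => (evalCLM ℝ t).comp ((G : (ℝ →ᵇ X) →L[ℝ] (ℝ →ᵇ X)).comp ι), ⟨?_, ?_, ?_⟩, ?_⟩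
  · ext x; exact hV0 x
  · intro s t hs ht
    ext x
    exact hshift x t s ht hs
  · intro x
    have := ((V x).continuous.tendsto 0).mono_left (nhdsWithin_le_nhds (s := Ioi (0 : ℝ)))
    rw [hV0] at this
    exact this
  · intro x t ht
    refine (hVeq x t ht).trans ?_
    congr 1
    refine intervalIntegral.integral_congr fun s hs => ?_
    rw [uIcc_of_le ht] at hs
    simp only [max_eq_left hs.1]
    rfl

theorem IsC0Semigroup.rescale (hS : IsC0Semigroup S) (c : ℝ) :
    IsC0Semigroup fun t => Real.exp (c * t) • S t where
  zero := by simp [hS.zero]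
  add s t hs ht := by
    rw [hS.add s t hs ht, smul_mul_smul_comm, ← Real.exp_add, mul_add]
  strongly_continuous x := by
    have h1 : Tendsto (fun t : ℝ => Real.exp (c * t)) (𝓝[>] 0) (𝓝 1) := by
      have : Continuous fun t : ℝ => Real.exp (c * t) := by fun_prop
      simpa using (this.tendsto 0).mono_left (nhdsWithin_le_nhds (s := Ioi (0 : ℝ)))
    simpa using h1.smul (hS.strongly_continuous x)

/-- Bounded perturbation theorem. -/
theorem IsC0Semigroup.exists_perturbation [CompleteSpace X] (hS : IsC0Semigroup S)
    (hA : IsGenerator A S) (B : X →L[ℝ] X) :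
    ∃ T : ℝ → X →L[ℝ] X, IsC0Semigroup T ∧ IsGenerator (B.toLinearMap +ᵥ A) T := by
  obtain ⟨M, ω, hM, hω, hb⟩ := hS.exists_exp_bound
  -- Multiplying the semigroup by `exp (-(ω + μ) t)` leaves decay at rate `μ`, just above the
  -- threshold `M * ‖B‖`. The Volterra equation is homogeneous in these exponentials, so scaling
  -- back preserves it.
  set μ := M * ‖B‖ + 1 with hμ
  have hμ0 : 0 < μ := by positivity
  have hS' := hS.rescale (-(ω + μ))
  obtain ⟨T, hT, hV⟩ := exists_volterraSolution_of_decay hS' B (M := M) (μ := μ) (by linarith) hμ0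
    (fun t ht => by
      rw [norm_smul, Real.norm_eq_abs, abs_of_pos (Real.exp_pos _)]
      calc _ ≤ Real.exp (-(ω + μ) * t) * (M * Real.exp (ω * t)) := by gcongr; exact hb t ht
        _ = M * (Real.exp (-(ω + μ) * t) * Real.exp (ω * t)) := by ring
        _ = _ := by rw [← Real.exp_add]; congr 2; ring) (by linarith)
  have hT' := hT.rescale (ω + μ)
  refine ⟨_, hT', IsVolterraSolution.isGenerator (S := S) (fun x t ht => ?_) hS hT' hA⟩
  have h1 := hV x t ht
  simp only [_root_.smul_apply] at h1 ⊢
  rw [h1, smul_add, smul_smul, ← Real.exp_add, ← intervalIntegral.integral_smul]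
  congr 1
  · rw [show (ω + μ) * t + -(ω + μ) * t = 0 by ring, Real.exp_zero, one_smul]
  · refine intervalIntegral.integral_congr fun s hs => ?_
    rw [uIcc_of_le ht] at hs
    rw [max_eq_left hs.1, max_eq_left (sub_nonneg.2 hs.2), map_smul, map_smul, smul_smul,
      ← Real.exp_add]
    congr 2; ring

theorem GeneratesC0Semigroup.vadd [CompleteSpace X] (hA : GeneratesC0Semigroup A)
    (B : X →L[ℝ] X) : GeneratesC0Semigroup (B.toLinearMap +ᵥ A) := by
  obtain ⟨S, hS, hg⟩ := hA
  exact hS.exists_perturbation hg B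

theorem expSemigroup_isC0Semigroup (hA : GeneratesC0Semigroup A) :
    IsC0Semigroup (expSemigroup A) := by
  rw [expSemigroup, dif_pos hA]; exact hA.choose_spec.1

theorem expSemigroup_isGenerator (hA : GeneratesC0Semigroup A) :
    IsGenerator A (expSemigroup A) := by
  rw [expSemigroup, dif_pos hA]; exact hA.choose_spec.2

/-- On the domain this is variation of constants with forcing `B (T s x)`; density and continuity in
`x` do the rest. It holds for any semigroups with the two generators, so the choice made in
`expSemigroup` is harmless. -/
theorem isVolterraSolution_of_isGenerator [CompleteSpace X] {B : X →L[ℝ] X}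
    (hS : IsC0Semigroup S) (hA : IsGenerator A S) (hT : IsC0Semigroup T)
    (hB : IsGenerator (B.toLinearMap +ᵥ A) T) : IsVolterraSolution S T B := by
  intro x t ht
  have hc2 : Continuous fun q : X × ℝ => S (max (t - q.2) 0) (B (T (max q.2 0) q.1)) := by
    have h1 : Continuous fun q : X × ℝ => B (T (max q.2 0) q.1) :=
      B.continuous.comp (hT.continuous_clamp.comp
        (by fun_prop : Continuous fun q : X × ℝ => (q.2, q.1)))
    exact hS.continuous_clamp.comp
      ((by fun_prop : Continuous fun q : X × ℝ => t - q.2).prodMk h1)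
  have hclosed : IsClosed {x : X | T t x = S t x +
      ∫ s in (0 : ℝ)..t, S (max (t - s) 0) (B (T (max s 0) x))} := by
    refine isClosed_eq (T t).continuous ((S t).continuous.add ?_)
    exact intervalIntegral.continuous_parametric_intervalIntegral_of_continuous' hc2 _ _
  refine hclosed.closure_subset_iff.2 ?_ (hS.dense_domain hA x)
  intro z hz
  obtain ⟨y, hy⟩ : ∃ y, (z, y) ∈ (B.toLinearMap +ᵥ A).graph :=
    ⟨_, LinearPMap.mem_graph (B.toLinearMap +ᵥ A) ⟨z, hz⟩⟩
  have hTz := hT.continuous_clamp_apply z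
  have := hS.duhamel hA ht (v := fun s => T (max s 0) z) (v' := fun s => T (max s 0) y)
    (f := fun s => B (T (max s 0) z)) hTz.continuousOn (B.continuous.comp hTz).continuousOn
    (fun s hs => hT.hasDerivAt_clamp hB hy hs.1)
    (fun s hs => by
      rw [max_eq_left hs.1.le]
      exact (LinearPMap.mem_graph_vadd_iff B A _ _).1 (hT.apply_mem_graph hB hy hs.1.le))
  simpa [max_eq_left ht, hT.zero_apply] using this

/-- Gronwall's inequality is applied to the differentiable majorant `F`, because the norm of the
orbit itself need not be differentiable. -/
theorem IsVolterraSolution.norm_le [CompleteSpace X] {B : X →L[ℝ] X}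
    (hV : IsVolterraSolution S T B) (hT : IsC0Semigroup T)
    {M K τ : ℝ} (hM : 0 ≤ M) (hSM : ∀ t ∈ Icc (0 : ℝ) τ, ‖S t‖ ≤ M) (hK : ‖B‖ ≤ K)
    {t : ℝ} (ht : t ∈ Icc 0 τ) : ‖T t‖ ≤ M * Real.exp (M * K * τ) := by
  have hK0 : 0 ≤ K := (norm_nonneg _).trans hK
  have hτ : 0 ≤ τ := ht.1.trans ht.2
  refine ContinuousLinearMap.opNorm_le_bound _ (by positivity) fun x => ?_
  have hc : Continuous fun s => ‖T (max s 0) x‖ := (hT.continuous_clamp_apply x).norm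
  set F : ℝ → ℝ := fun r => M * ‖x‖ + M * K * ∫ s in (0 : ℝ)..r, ‖T (max s 0) x‖ with hF
  have hF' : ∀ r, HasDerivAt F (M * K * ‖T (max r 0) x‖) r := fun r =>
    ((intervalIntegral.integral_hasDerivAt_right (hc.intervalIntegrable _ _)
      hc.stronglyMeasurable.stronglyMeasurableAtFilter hc.continuousAt).const_mul _).const_add _
  have hle : ∀ r ∈ Icc 0 τ, ‖T (max r 0) x‖ ≤ F r := by
    intro r hr
    rw [max_eq_left hr.1, hV x r hr.1]
    refine (norm_add_le _ _).trans (add_le_add ((S r).le_of_opNorm_le (hSM r hr) x) ?_)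
    rw [← intervalIntegral.integral_const_mul]
    refine intervalIntegral.norm_integral_le_of_norm_le hr.1 (Eventually.of_forall fun s hs => ?_)
      ((continuous_const.mul hc).intervalIntegrable _ _)
    have h1 : 0 ≤ r - s := sub_nonneg.2 hs.2
    have h2 : r - s ≤ τ := by linarith [hs.1, hr.2]
    rw [max_eq_left h1, mul_assoc]
    refine ((S _).le_of_opNorm_le (hSM _ ⟨h1, h2⟩) _).trans ?_
    gcongr
    exact B.le_of_opNorm_le hK _
  have hgr := norm_le_gronwallBound_of_norm_deriv_right_le (f := F) (a := 0) (b := τ)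
    (f' := fun r => M * K * ‖T (max r 0) x‖) (δ := M * ‖x‖) (K := M * K) (ε := 0)
    (continuous_iff_continuousAt.2 fun r => (hF' r).continuousAt).continuousOn
    (fun r _ => (hF' r).hasDerivWithinAt) (by simp [hF, abs_of_nonneg hM])
    (fun r hr => by
      have h1 := hle r ⟨hr.1, hr.2.le⟩
      rw [add_zero, Real.norm_eq_abs, abs_of_nonneg (by positivity), Real.norm_eq_abs]
      exact mul_le_mul_of_nonneg_left (h1.trans (le_abs_self _)) (by positivity)) t ht
  rw [gronwallBound_ε0, sub_zero] at hgr
  have h1 := hle t ht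
  rw [max_eq_left ht.1] at h1
  calc ‖T t x‖ ≤ F t := h1
    _ ≤ ‖F t‖ := le_abs_self _
    _ ≤ M * ‖x‖ * Real.exp (M * K * t) := hgr
    _ ≤ M * ‖x‖ * Real.exp (M * K * τ) := by have := ht.2; gcongr
    _ = _ := by ring

/-- The factor `t` is essential: it becomes the factor `h` that makes a change of base point
harmless over many steps. -/
theorem IsVolterraSolution.norm_sub_le {B : X →L[ℝ] X}
    (hV : IsVolterraSolution S T B) {M M' τ : ℝ} (hM : 0 ≤ M) (hM' : 0 ≤ M')
    (hSM : ∀ t ∈ Icc (0 : ℝ) τ, ‖S t‖ ≤ M) (hTM : ∀ t ∈ Icc (0 : ℝ) τ, ‖T t‖ ≤ M')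
    {t : ℝ} (ht : t ∈ Icc 0 τ) : ‖T t - S t‖ ≤ M * M' * ‖B‖ * t := by
  have ht0 := ht.1
  refine ContinuousLinearMap.opNorm_le_bound _ (by positivity) fun x => ?_
  rw [_root_.sub_apply, hV x t ht.1, add_sub_cancel_left]
  refine (intervalIntegral.norm_integral_le_of_norm_le_const
    (C := M * (‖B‖ * (M' * ‖x‖))) fun s hs => ?_).trans (le_of_eq ?_)
  · rw [uIoc_of_le ht0] at hs
    have h1 : 0 ≤ t - s := sub_nonneg.2 hs.2
    rw [max_eq_left h1, max_eq_left hs.1.le]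
    refine ((S _).le_of_opNorm_le (hSM _ ⟨h1, by linarith [hs.1, ht.2]⟩) _).trans ?_
    gcongr
    refine B.le_opNorm_of_le ((T s).le_of_opNorm_le (hTM _ ⟨hs.1.le, hs.2.trans ht.2⟩) _)
  · rw [sub_zero, abs_of_nonneg ht0]; ring

end BoundedPerturbation

/-! ### The `φ`-functions of a semigroup: bounds, recurrence, smoothing. -/

section PhiFunctions

variable {X : Type*} [NormedAddCommGroup X] [NormedSpace ℝ X]
  {S S' : ℝ → X →L[ℝ] X} {A : X →ₗ.[ℝ] X}

theorem phi_succ_eq_clamp {t : ℝ} (ht : 0 ≤ t) (k : ℕ) (x : X) :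
    phi (fun t x => S t x) (k + 1) t x
      = ∫ θ in (0 : ℝ)..1, (θ ^ k / (k ! : ℝ)) • S (max ((1 - θ) * t) 0) x := by
  refine intervalIntegral.integral_congr fun θ hθ => ?_
  rw [uIcc_of_le zero_le_one] at hθ
  simp only
  rw [max_eq_left (mul_nonneg (sub_nonneg.2 hθ.2) ht)]

theorem IsC0Semigroup.continuous_phi_integrand [CompleteSpace X] (hS : IsC0Semigroup S)
    (k : ℕ) (t : ℝ) (x : X) :
    Continuous fun θ : ℝ => (θ ^ k / (k ! : ℝ)) • S (max ((1 - θ) * t) 0) x :=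
  (by fun_prop : Continuous fun θ : ℝ => θ ^ k / (k ! : ℝ)).smul
    ((hS.continuous_clamp_apply x).comp (by fun_prop))

theorem abs_pow_div_factorial_le_one {θ : ℝ} (hθ : θ ∈ Icc (0 : ℝ) 1) (k : ℕ) :
    |θ ^ k / (k ! : ℝ)| ≤ 1 := by
  have h0 := hθ.1
  rw [abs_of_nonneg (by positivity)]
  have h1 : (1 : ℝ) ≤ k ! := by exact_mod_cast Nat.one_le_iff_ne_zero.2 (Nat.factorial_ne_zero k)
  exact div_le_one_of_le₀ ((pow_le_one₀ h0 hθ.2).trans h1) (by positivity)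

/-- The weights `θ ^ k / k!` are at most `1` on an interval of length one, so every `φ_k` inherits
the bounds of the semigroup with the same constants. -/
theorem IsC0Semigroup.norm_phi_sub_phi_le [CompleteSpace X] (hS : IsC0Semigroup S)
    (hS' : IsC0Semigroup S') {t M d : ℝ} (ht : 0 ≤ t) (hM : ∀ s ∈ Icc 0 t, ‖S s‖ ≤ M)
    (hd : ∀ s ∈ Icc 0 t, ‖S s - S' s‖ ≤ d) (k : ℕ) (x y : X) :
    ‖phi (fun t x => S t x) k t x - phi (fun t x => S' t x) k t y‖ ≤ M * ‖x - y‖ + d * ‖y‖ := by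
  have key : ∀ s ∈ Icc 0 t, ‖S s x - S' s y‖ ≤ M * ‖x - y‖ + d * ‖y‖ := by
    intro s hs
    have e : S s x - S' s y = S s (x - y) + (S s - S' s) y := by
      simp
    rw [e]
    exact (norm_add_le _ _).trans (add_le_add ((S s).le_of_opNorm_le (hM s hs) _)
      ((S s - S' s).le_of_opNorm_le (hd s hs) _))
  cases k with
  | zero => exact key t ⟨ht, le_rfl⟩
  | succ k =>
    rw [phi_succ_eq_clamp ht, phi_succ_eq_clamp ht, ← intervalIntegral.integral_sub
      ((hS.continuous_phi_integrand k t x).intervalIntegrable _ _)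
      ((hS'.continuous_phi_integrand k t y).intervalIntegrable _ _)]
    refine (intervalIntegral.norm_integral_le_of_norm_le_const
      (C := M * ‖x - y‖ + d * ‖y‖) fun θ hθ => ?_).trans (by simp)
    rw [uIoc_of_le zero_le_one] at hθ
    have h1 : 0 ≤ (1 - θ) * t := mul_nonneg (sub_nonneg.2 hθ.2) ht
    have h2 : (1 - θ) * t ≤ t := mul_le_of_le_one_left ht (by linarith [hθ.1])
    rw [← smul_sub, norm_smul, max_eq_left h1, Real.norm_eq_abs]
    exact (mul_le_of_le_one_left (norm_nonneg _)
      (abs_pow_div_factorial_le_one ⟨hθ.1.le, hθ.2⟩ k)).trans (key _ ⟨h1, h2⟩)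

theorem IsC0Semigroup.norm_phi_le [CompleteSpace X] (hS : IsC0Semigroup S)
    {t M : ℝ} (ht : 0 ≤ t) (hM : ∀ s ∈ Icc 0 t, ‖S s‖ ≤ M) (k : ℕ) (x : X) :
    ‖phi (fun t x => S t x) k t x‖ ≤ M * ‖x‖ := by
  have h0 : phi (fun t x => S t x) k t (0 : X) = 0 := by cases k <;> simp [phi]
  simpa [h0] using hS.norm_phi_sub_phi_le hS ht hM (d := 0) (by simp) k x 0

/-- `φ_k(tA)` as a bounded operator. -/
theorem IsC0Semigroup.exists_phi_clm [CompleteSpace X] (hS : IsC0Semigroup S)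
    {t : ℝ} (ht : 0 ≤ t) (k : ℕ) :
    ∃ Φ : X →L[ℝ] X, ∀ x, Φ x = phi (fun t x => S t x) k t x := by
  cases k with
  | zero => exact ⟨S t, fun x => rfl⟩
  | succ k =>
    obtain ⟨M, -, hM⟩ := hS.exists_bound t
    refine ⟨LinearMap.mkContinuous
      { toFun := fun x => phi (fun t x => S t x) (k + 1) t x
        map_add' := fun x y => ?_
        map_smul' := fun c x => ?_ } M (hS.norm_phi_le ht hM (k + 1)), fun x => rfl⟩
    · simp only [phi_succ_eq_clamp ht, map_add, smul_add]
      exact intervalIntegral.integral_add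
        ((hS.continuous_phi_integrand k t x).intervalIntegrable _ _)
        ((hS.continuous_phi_integrand k t y).intervalIntegrable _ _)
    · simp only [phi_succ_eq_clamp ht, map_smul, RingHom.id_apply]
      rw [← intervalIntegral.integral_smul]
      congr 1; ext θ; rw [smul_comm]

/-- `φ_k(tA) x = x / k! + t φ_{k+1}(tA) A x`. -/
theorem IsC0Semigroup.phi_eq_add [CompleteSpace X] (hS : IsC0Semigroup S) (hA : IsGenerator A S)
    {x y : X} (hxy : (x, y) ∈ A.graph) {t : ℝ} (ht : 0 ≤ t) (k : ℕ) :
    phi (fun t x => S t x) k t x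
      = (1 / (k ! : ℝ)) • x + t • phi (fun t x => S t x) (k + 1) t y := by
  -- At `t = 0` the recurrence is just the integral of the weight. For `t > 0` it is the fundamental
  -- theorem of calculus along the orbit (`k = 0`), or integration by parts with the primitive `θ ^
  -- (k + 1) / (k + 1)!`.
  rcases ht.eq_or_lt with rfl | htpos
  · cases k with
    | zero => simp [phi, hS.zero_apply]
    | succ k =>
      have : (k + 1 : ℝ) * (k ! : ℝ) = ((k + 1)! : ℝ) := by
        rw [Nat.factorial_succ]; push_cast; ring
      simp only [phi, mul_zero, hS.zero_apply, zero_smul, add_zero,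
        intervalIntegral.integral_smul_const, intervalIntegral.integral_div, integral_pow]
      congr 1
      rw [← this]; field_simp; simp
  have hcx := hS.continuous_clamp_apply x
  have hcy := hS.continuous_clamp_apply y
  have hS' : ∀ θ ∈ Ioo (0 : ℝ) 1, HasDerivAt (fun θ => S (max ((1 - θ) * t) 0) x)
      (-(t • S (max ((1 - θ) * t) 0) y)) θ := by
    intro θ hθ
    have h1 : HasDerivAt (fun θ : ℝ => (1 - θ) * t) (-t) θ := by
      simpa using ((hasDerivAt_id θ).const_sub 1).mul_const t
    have := (hS.hasDerivAt_clamp hA hxy (mul_pos (sub_pos.2 hθ.2) htpos)).scomp θ h1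
    simpa [Function.comp_def] using this
  have hcomp : Continuous fun θ : ℝ => (1 - θ) * t := by fun_prop
  cases k with
  | zero =>
    rw [phi_succ_eq_clamp ht]
    have := intervalIntegral.integral_eq_sub_of_hasDerivAt_of_le zero_le_one
      (f := fun θ => S (max ((1 - θ) * t) 0) x) (hcx.comp hcomp).continuousOn hS'
      ((((hcy.comp hcomp).const_smul t).neg).intervalIntegrable _ _)
    rw [intervalIntegral.integral_neg, intervalIntegral.integral_smul] at this
    simp only [sub_self, zero_mul, max_self, sub_zero, one_mul, max_eq_left ht,
      hS.zero_apply] at this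
    simp only [phi, pow_zero, Nat.factorial_zero, Nat.cast_one, div_one, one_smul]
    rw [← sub_eq_iff_eq_add', ← neg_inj, this, neg_sub]
  | succ k =>
    have hwt : ∀ θ : ℝ, HasDerivAt (fun θ : ℝ => θ ^ (k + 1) / ((k + 1)! : ℝ))
        (θ ^ k / (k ! : ℝ)) θ := by
      intro θ
      have := (hasDerivAt_pow (k + 1) θ).div_const ((k + 1)! : ℝ)
      refine this.congr_deriv ?_
      rw [Nat.factorial_succ]; push_cast
      have : (k ! : ℝ) ≠ 0 := by positivity
      field_simp
    have hi1 := (hS.continuous_phi_integrand k t x).intervalIntegrable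
      (μ := MeasureTheory.volume) 0 1
    have hi2 : IntervalIntegrable (fun θ : ℝ => t • (θ ^ (k + 1) / ((k + 1)! : ℝ)) •
        S (max ((1 - θ) * t) 0) y) MeasureTheory.volume 0 1 :=
      ((hS.continuous_phi_integrand (k + 1) t y).const_smul t).intervalIntegrable 0 1
    have := intervalIntegral.integral_eq_sub_of_hasDerivAt_of_le zero_le_one
      (f := fun θ => (θ ^ (k + 1) / ((k + 1)! : ℝ)) • S (max ((1 - θ) * t) 0) x)
      (f' := fun θ => (θ ^ k / (k ! : ℝ)) • S (max ((1 - θ) * t) 0) x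
        - t • (θ ^ (k + 1) / ((k + 1)! : ℝ)) • S (max ((1 - θ) * t) 0) y)
      (hS.continuous_phi_integrand (k + 1) t x).continuousOn
      (fun θ hθ => by
        have := (hwt θ).smul (hS' θ hθ)
        refine HasDerivAt.congr_deriv this ?_
        rw [smul_neg, smul_comm t, neg_add_eq_sub])
      (hi1.sub hi2)
    rw [intervalIntegral.integral_sub hi1 hi2, intervalIntegral.integral_smul,
      ← phi_succ_eq_clamp ht, ← phi_succ_eq_clamp ht] at this
    simp only [sub_self, zero_mul, max_self, hS.zero_apply, one_pow, ne_eq, Nat.succ_ne_zero,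
      not_false_eq_true, zero_pow, zero_div, zero_smul, sub_zero] at this
    rw [← this, sub_add_cancel]

/-- `φ_k(tA)` maps the domain of `A` into itself and commutes with `A`. -/
theorem IsC0Semigroup.phi_mem_graph_of_mem_graph [CompleteSpace X] (hS : IsC0Semigroup S)
    (hA : IsGenerator A S) {x y : X} (hxy : (x, y) ∈ A.graph) {t : ℝ} (ht : 0 ≤ t) (k : ℕ) :
    (phi (fun t x => S t x) k t x, phi (fun t x => S t x) k t y) ∈ A.graph := by
  obtain ⟨Φ, hΦ⟩ := hS.exists_phi_clm ht k
  have hcomm : ∀ s, 0 ≤ s → ∀ z, S s (Φ z) = Φ (S s z) := by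
    intro s hs z
    rw [hΦ, hΦ]
    cases k with
    | zero => exact hS.apply_comm hs ht z
    | succ k =>
      rw [phi_succ_eq_clamp ht, phi_succ_eq_clamp ht, ← ContinuousLinearMap.intervalIntegral_comp_comm
        _ ((hS.continuous_phi_integrand k t z).intervalIntegrable _ _)]
      refine intervalIntegral.integral_congr fun θ _ => ?_
      simp only [map_smul]
      rw [hS.apply_comm hs (le_max_right _ _)]
  rw [← hΦ, ← hΦ, hA]
  refine ((Φ.continuous.tendsto y).comp ((hA x y).1 hxy)).congr' ?_
  filter_upwards [self_mem_nhdsWithin] with r hr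
  simp only [Function.comp, map_smul, map_sub]
  rw [hcomm r (le_of_lt hr)]

/-- For `t > 0` the operator `φ_{k+1}(tA)` maps into the domain of `A`. -/
theorem IsC0Semigroup.phi_succ_mem_graph [CompleteSpace X] (hS : IsC0Semigroup S)
    (hA : IsGenerator A S) (x : X) {t : ℝ} (ht : 0 < t) (k : ℕ) :
    (phi (fun t x => S t x) (k + 1) t x,
      t⁻¹ • (phi (fun t x => S t x) k t x - (1 / (k ! : ℝ)) • x)) ∈ A.graph := by
  obtain ⟨Φ, hΦ⟩ := hS.exists_phi_clm ht.le k
  obtain ⟨Φ', hΦ'⟩ := hS.exists_phi_clm ht.le (k + 1)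
  obtain ⟨z, hz, hlim⟩ := mem_closure_iff_seq_limit.1 (hS.dense_domain hA x)
  have hlim2 : Tendsto (fun n => t⁻¹ • (Φ (z n) - (1 / (k ! : ℝ)) • z n)) atTop
      (𝓝 (t⁻¹ • (Φ x - (1 / (k ! : ℝ)) • x))) :=
    (((Φ.continuous.tendsto x).comp hlim).sub (hlim.const_smul _)).const_smul _
  rw [← hΦ, ← hΦ']
  -- On the dense domain the claim is the recurrence solved for `A φ_{k+1}`; both components are
  -- bounded in `x`, so closedness of the generator extends it.
  refine hS.mem_graph_of_tendsto hA ((Φ'.continuous.tendsto x).comp hlim) hlim2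
    (Eventually.of_forall fun n => ?_)
  have hg : (z n, A ⟨z n, hz n⟩) ∈ A.graph := A.mem_graph ⟨z n, hz n⟩
  have h1 := hS.phi_mem_graph_of_mem_graph hA hg ht.le (k + 1)
  have h2 := hS.phi_eq_add hA hg ht.le k
  rw [hΦ, h2, add_sub_cancel_left, smul_smul, inv_mul_cancel₀ ht.ne', one_smul]
  simpa [hΦ'] using h1

/-- The substitution `s = h θ`. This is how each power of `s` in the exact remainder becomes a
`φ`-function, and where the factor `k!` in the matching of the order conditions comes from. -/
theorem integral_clamp_pow_smul (S : ℝ → X →L[ℝ] X) {h : ℝ} (hh : 0 ≤ h) (k : ℕ) (y : X) :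
    ∫ s in (0 : ℝ)..h, S (max (h - s) 0) (s ^ k • y)
      = (k ! * h ^ (k + 1)) • phi (fun t x => S t x) (k + 1) h y := by
  rw [phi_succ_eq_clamp (S := S) hh]
  have := intervalIntegral.smul_integral_comp_mul_left (a := (0 : ℝ)) (b := 1)
      (fun s => S (max (h - s) 0) (s ^ k • y)) h
  rw [mul_zero, mul_one] at this
  rw [← this, pow_succ', mul_left_comm, mul_smul]
  congr 1
  rw [← intervalIntegral.integral_smul]
  refine intervalIntegral.integral_congr fun θ _ => ?_
  have : (k ! : ℝ) ≠ 0 := by positivity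
  simp only [map_smul, smul_smul]
  rw [show h - h * θ = (1 - θ) * h by ring]
  congr 1
  rw [mul_pow]; field_simp

/-- The sum of the absolute values of the coefficients. -/
noncomputable def PhiComb.size (c : PhiComb) : ℝ := c.sum fun _ r => |r|

theorem PhiComb.size_nonneg (c : PhiComb) : 0 ≤ c.size :=
  Finset.sum_nonneg fun _ _ => abs_nonneg _

theorem PhiComb.norm_eval_sub_eval_le [CompleteSpace X] {c : PhiComb}
    (hc : ∀ q ∈ c.support, 0 ≤ q.2) (hS : IsC0Semigroup S) (hS' : IsC0Semigroup S')
    {t τ M d : ℝ} (ht : 0 ≤ t) (hτ : ∀ q ∈ c.support, q.2 * t ≤ τ)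
    (hM : ∀ s ∈ Icc 0 τ, ‖S s‖ ≤ M) (hd : ∀ s ∈ Icc 0 τ, ‖S s - S' s‖ ≤ d) (x y : X) :
    ‖c.eval (fun t x => S t x) t x - c.eval (fun t x => S' t x) t y‖
      ≤ c.size * (M * ‖x - y‖ + d * ‖y‖) := by
  rw [PhiComb.eval, PhiComb.eval, PhiComb.size, Finsupp.sum, Finsupp.sum, Finsupp.sum,
    ← Finset.sum_sub_distrib, Finset.sum_mul]
  refine norm_sum_le_of_le _ fun q hq => ?_
  rw [← smul_sub, norm_smul, Real.norm_eq_abs]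
  gcongr
  exact hS.norm_phi_sub_phi_le hS' (mul_nonneg (hc q hq) ht)
    (fun s hs => hM s ⟨hs.1, hs.2.trans (hτ q hq)⟩)
    (fun s hs => hd s ⟨hs.1, hs.2.trans (hτ q hq)⟩) _ _ _

/-- `c(tA)` as a bounded operator. -/
theorem PhiComb.exists_eval_clm [CompleteSpace X] {c : PhiComb}
    (hc : ∀ q ∈ c.support, 0 ≤ q.2) (hS : IsC0Semigroup S) {t : ℝ} (ht : 0 ≤ t) :
    ∃ Φ : X →L[ℝ] X, ∀ x, Φ x = c.eval (fun t x => S t x) t x := by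
  have h : ∀ q : ℕ × ℝ, ∃ Φ : X →L[ℝ] X, q ∈ c.support →
      ∀ x, Φ x = phi (fun t x => S t x) q.1 (q.2 * t) x := fun q => by
    by_cases hq : q ∈ c.support
    · obtain ⟨Φ, hΦ⟩ := hS.exists_phi_clm (mul_nonneg (hc q hq) ht) q.1
      exact ⟨Φ, fun _ => hΦ⟩
    · exact ⟨0, fun h => absurd h hq⟩
  choose Φ hΦ using h
  refine ⟨∑ q ∈ c.support, c q • Φ q, fun x => ?_⟩
  simp only [PhiComb.eval, Finsupp.sum, sum_apply, smul_apply]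
  exact Finset.sum_congr rfl fun q hq => by rw [hΦ q hq]

theorem PhiComb.norm_eval_le [CompleteSpace X] {c : PhiComb}
    (hc : ∀ q ∈ c.support, 0 ≤ q.2) (hS : IsC0Semigroup S)
    {t τ M : ℝ} (ht : 0 ≤ t) (hτ : ∀ q ∈ c.support, q.2 * t ≤ τ)
    (hM : ∀ s ∈ Icc 0 τ, ‖S s‖ ≤ M) (x : X) :
    ‖c.eval (fun t x => S t x) t x‖ ≤ c.size * (M * ‖x‖) := by
  obtain ⟨Φ, hΦ⟩ := PhiComb.exists_eval_clm hc hS ht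
  have := PhiComb.norm_eval_sub_eval_le hc hS hS ht hτ hM (d := 0) (by simp) x 0
  simpa [← hΦ] using this

end PhiFunctions

/-! ### From order conditions for matrices to identities for semigroups. -/

section OrderConditionTransfer

variable {X : Type*} [NormedAddCommGroup X] [NormedSpace ℝ X] {S : ℝ → X →L[ℝ] X}

namespace PhiComb

/-- The functional `F ↦ c(F)` obtained from `c` by replacing `e^{sz}` by `F s`. -/
noncomputable def functional (c : PhiComb) (F : ℝ → X) : X := c.eval (fun s _ => F s) 1 0

theorem eval_eq_linearCombination (c : PhiComb) (E : ℝ → X → X) (t : ℝ) (x : X) :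
    c.eval E t x = Finsupp.linearCombination ℝ (fun q : ℕ × ℝ => phi E q.1 (q.2 * t) x) c := rfl

theorem eval_sub (c d : PhiComb) (E : ℝ → X → X) (t : ℝ) (x : X) :
    (c - d).eval E t x = c.eval E t x - d.eval E t x := by
  simp only [eval_eq_linearCombination, map_sub]

theorem eval_smul (r : ℝ) (c : PhiComb) (E : ℝ → X → X) (t : ℝ) (x : X) :
    (r • c).eval E t x = r • c.eval E t x := by
  simp only [eval_eq_linearCombination, map_smul]

theorem eval_sum {ι : Type*} (s : Finset ι) (c : ι → PhiComb) (E : ℝ → X → X) (t : ℝ) (x : X) :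
    (∑ i ∈ s, c i : PhiComb).eval E t x = ∑ i ∈ s, (c i).eval E t x := by
  simp only [eval_eq_linearCombination, map_sum]

theorem eval_single (k : ℕ) (γ : ℝ) (E : ℝ → X → X) (t : ℝ) (x : X) :
    PhiComb.eval (Finsupp.single (k, γ) 1) E t x = phi E k (γ * t) x := by
  simp only [eval_eq_linearCombination, Finsupp.linearCombination_single, one_smul]

theorem eval_eq_functional (c : PhiComb) (E : ℝ → X → X) (t : ℝ) (x : X) :
    c.eval E t x = c.functional fun s => E (s * t) x := by
  refine Finset.sum_congr rfl fun q _ => ?_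
  rcases q with ⟨_ | k, γ⟩ <;> simp [phi, mul_assoc]

/-- The combinations in which only `φ_k(γ ·)` with `γ ≥ 0` occur. -/
def nonneg : Submodule ℝ PhiComb := Finsupp.supported ℝ ℝ {q : ℕ × ℝ | 0 ≤ q.2}

theorem mem_nonneg_iff {c : PhiComb} : c ∈ nonneg ↔ ∀ q ∈ c.support, 0 ≤ q.2 :=
  Finsupp.mem_supported ℝ c

theorem IsAdmissible.mem_nonneg {c : PhiComb} (hc : c.IsAdmissible) : c ∈ nonneg :=
  mem_nonneg_iff.2 fun q hq => (hc q hq).2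

theorem single_mem_nonneg (k : ℕ) {γ : ℝ} (hγ : 0 ≤ γ) :
    (Finsupp.single (k, γ) 1 : PhiComb) ∈ nonneg :=
  Finsupp.single_mem_supported ℝ (1 : ℝ) (show (k, γ) ∈ {q : ℕ × ℝ | 0 ≤ q.2} from hγ)

theorem exists_gamma_bound (c : PhiComb) : ∃ Γ : ℝ, 0 ≤ Γ ∧ ∀ q ∈ c.support, q.2 ≤ Γ :=
  ⟨∑ q ∈ c.support, |q.2|, Finset.sum_nonneg fun _ _ => abs_nonneg _, fun _ hq =>
    (le_abs_self _).trans (Finset.single_le_sum (f := fun q : ℕ × ℝ => |q.2|)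
      (fun _ _ => abs_nonneg _) hq)⟩

theorem phi_const_continuous_integrand {F : ℝ → ℝ} (hF : Continuous F) (k : ℕ) (γ : ℝ) :
    Continuous fun θ : ℝ => (θ ^ k / (k ! : ℝ)) • F ((1 - θ) * γ) :=
  (by fun_prop : Continuous fun θ : ℝ => θ ^ k / (k ! : ℝ)).smul (hF.comp (by fun_prop))

/-- `c` as a bounded functional on `C([0, Γ])`. -/
theorem exists_functional_clm (c : PhiComb) {Γ : ℝ} (hΓ : 0 ≤ Γ) :
    ∃ Λ : C(Icc (0 : ℝ) Γ, ℝ) →L[ℝ] ℝ, ∀ f, Λ f = c.functional (IccExtend hΓ f) := by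
  have hphi : ∀ q : ℕ × ℝ, ∃ Λ : C(Icc (0 : ℝ) Γ, ℝ) →L[ℝ] ℝ, ∀ f : C(Icc (0 : ℝ) Γ, ℝ),
      Λ f = phi (fun s (_ : ℝ) => IccExtend hΓ f s) q.1 (q.2 * 1) 0 := by
    rintro ⟨k, γ⟩
    have hb : ∀ (f : C(Icc (0 : ℝ) Γ, ℝ)) s, ‖IccExtend hΓ f s‖ ≤ ‖f‖ :=
      fun f s => f.norm_coe_le_norm _
    have hc : ∀ f : C(Icc (0 : ℝ) Γ, ℝ), Continuous (IccExtend hΓ f) :=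
      fun f => f.continuous.Icc_extend'
    cases k with
    | zero =>
      refine ⟨LinearMap.mkContinuous
        { toFun := fun f => IccExtend hΓ f (γ * 1)
          map_add' := fun f g => rfl
          map_smul' := fun a f => rfl } 1 (fun f => by simpa using hb f (γ * 1)), fun f => rfl⟩
    | succ k =>
      refine ⟨LinearMap.mkContinuous
        { toFun := fun f => phi (fun s (_ : ℝ) => IccExtend hΓ f s) (k + 1) (γ * 1) 0
          map_add' := fun f g => ?_
          map_smul' := fun a f => ?_ } 1 (fun f => ?_), fun f => rfl⟩
      · simp only [phi]
        rw [← intervalIntegral.integral_add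
          ((phi_const_continuous_integrand (hc f) k (γ * 1)).intervalIntegrable _ _)
          ((phi_const_continuous_integrand (hc g) k (γ * 1)).intervalIntegrable _ _)]
        refine intervalIntegral.integral_congr fun θ _ => ?_
        simp only [← smul_add]
        rfl
      · simp only [phi, RingHom.id_apply]
        rw [← intervalIntegral.integral_smul]
        refine intervalIntegral.integral_congr fun θ _ => ?_
        simp only [smul_comm a]
        rfl
      · simp only [LinearMap.coe_mk, AddHom.coe_mk, phi]
        refine (intervalIntegral.norm_integral_le_of_norm_le_const (C := ‖f‖) fun θ hθ => ?_).trans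
          (by simp)
        rw [uIoc_of_le zero_le_one] at hθ
        rw [norm_smul]
        exact (mul_le_of_le_one_left (norm_nonneg _)
          (abs_pow_div_factorial_le_one ⟨hθ.1.le, hθ.2⟩ k)).trans (hb f _)
  choose Λ hΛ using hphi
  refine ⟨∑ q ∈ c.support, c q • Λ q, fun f => ?_⟩
  simp only [sum_apply, _root_.smul_apply, hΛ]
  rfl

/-- All arguments `(1 - θ) γ` lie between `0` and `γ ≤ Γ`, so only the values on `[0, Γ]` count. -/
theorem functional_congr {c : PhiComb} (hc : c ∈ nonneg) {Γ : ℝ}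
    (hcΓ : ∀ q ∈ c.support, q.2 ≤ Γ) {F G : ℝ → X} (h : EqOn F G (Icc 0 Γ)) :
    c.functional F = c.functional G := by
  refine Finset.sum_congr rfl fun q hq => ?_
  have h0 := mem_nonneg_iff.1 hc q hq
  have h1 := hcΓ q hq
  rcases q with ⟨_ | k, γ⟩
  · simp only [phi]
    rw [h ⟨by simpa using h0, by simpa using h1⟩]
  · simp only [phi]
    congr 1
    refine intervalIntegral.integral_congr fun θ hθ => ?_
    rw [uIcc_of_le zero_le_one] at hθ
    simp only at h0 h1
    simp only [mul_one]
    rw [h ⟨mul_nonneg (sub_nonneg.2 hθ.2) h0,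
      (mul_le_of_le_one_left h0 (by linarith [hθ.1])).trans h1⟩]

/-- A combination that vanishes on all exponentials vanishes on all continuous functions. -/
theorem functional_eq_zero_of_exp {c : PhiComb} (hc : c ∈ nonneg)
    (hexp : ∀ z : ℝ, c.functional (fun s => Real.exp (s * z)) = 0) {F : ℝ → ℝ}
    (hF : Continuous F) : c.functional F = 0 := by
  obtain ⟨Γ, hΓ, hcΓ⟩ := c.exists_gamma_bound
  obtain ⟨Λ, hΛ⟩ := c.exists_functional_clm hΓ
  -- The exponentials are closed under products, so their linear span is a subalgebra. It separates
  -- points, hence is dense by Stone–Weierstrass, and the continuous functional `Λ` vanishes on it.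
  let e : Multiplicative ℝ →* C(Icc (0 : ℝ) Γ, ℝ) :=
    { toFun := fun z => ⟨fun s => Real.exp (s * z.toAdd), by fun_prop⟩
      map_one' := by ext s; simp
      map_mul' := fun z w => by ext s; simp [mul_add, Real.exp_add] }
  have hΛe : ∀ z, Λ (e z) = 0 := by
    intro z
    rw [hΛ]
    refine Eq.trans (functional_congr hc hcΓ fun s hs => ?_) (hexp z.toAdd)
    rw [IccExtend_of_mem _ _ hs]
    rfl
  let P : Submodule ℝ C(Icc (0 : ℝ) Γ, ℝ) := LinearMap.ker Λ.toLinearMap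
  let 𝒜 : Subalgebra ℝ C(Icc (0 : ℝ) Γ, ℝ) := Algebra.adjoin ℝ (MonoidHom.mrange e : Set _)
  have h𝒜 : (𝒜 : Set C(Icc (0 : ℝ) Γ, ℝ)) ⊆ P := by
    have : Subalgebra.toSubmodule 𝒜 ≤ P := by
      rw [Algebra.adjoin_eq_span, Submonoid.closure_eq, Submodule.span_le]
      rintro _ ⟨z, rfl⟩
      exact hΛe z
    exact this
  have hsep : 𝒜.SeparatesPoints := by
    intro s t hst
    refine ⟨e (Multiplicative.ofAdd 1), ⟨e (Multiplicative.ofAdd 1),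
      Algebra.subset_adjoin ⟨_, rfl⟩, rfl⟩, ?_⟩
    simpa [e, Subtype.ext_iff] using hst
  have htop := ContinuousMap.subalgebra_topologicalClosure_eq_top_of_separatesPoints 𝒜 hsep
  have hall : ∀ f, Λ f = 0 := by
    intro f
    have hf : f ∈ 𝒜.topologicalClosure := by rw [htop]; trivial
    have hclosed : IsClosed (P : Set C(Icc (0 : ℝ) Γ, ℝ)) :=
      isClosed_eq Λ.continuous continuous_const
    exact hclosed.closure_subset_iff.2 h𝒜 hf
  have := hall ⟨fun s => F s, by fun_prop⟩
  rw [hΛ] at this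
  refine Eq.trans (functional_congr hc hcΓ fun s hs => ?_) this
  rw [IccExtend_of_mem _ _ hs]
  rfl

/-- A combination that vanishes on all exponentials vanishes on all strongly continuous
semigroups. -/
theorem eval_eq_zero_of_exp [CompleteSpace X] {c : PhiComb} (hc : c ∈ nonneg)
    (hexp : ∀ z : ℝ, c.functional (fun s => Real.exp (s * z)) = 0) (hS : IsC0Semigroup S)
    {t : ℝ} (ht : 0 ≤ t) (x : X) : c.eval (fun t x => S t x) t x = 0 := by
  obtain ⟨Γ, hΓ, hcΓ⟩ := c.exists_gamma_bound
  -- Testing with a dual vector reduces the claim to the continuous scalar function `s ↦ ℓ (S (s t)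
  -- x)`.
  refine (SeparatingDual.eq_zero_iff_forall_dual_eq_zero (R := ℝ)
    (c.eval (fun t x => S t x) t x)).2 fun ℓ => ?_
  have hcont : Continuous fun s : ℝ => S (max (s * t) 0) x :=
    (hS.continuous_clamp_apply x).comp (by fun_prop)
  rw [← functional_eq_zero_of_exp hc hexp (ℓ.continuous.comp hcont), eval_eq_functional,
    functional_congr hc hcΓ (G := fun s => S (max (s * t) 0) x)
      (fun s hs => by simp only [max_eq_left (mul_nonneg hs.1 ht)])]
  simp only [functional, PhiComb.eval, Finsupp.sum, map_sum, map_smul]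
  refine Finset.sum_congr rfl fun q _ => ?_
  congr 1
  rcases q with ⟨_ | k, γ⟩
  · rfl
  · simp only [phi, Function.comp]
    rw [← ContinuousLinearMap.intervalIntegral_comp_comm]
    · simp only [map_smul]
    · exact ((by fun_prop : Continuous fun θ : ℝ => θ ^ k / (k ! : ℝ)).smul
        (hcont.comp (by fun_prop : Continuous fun θ : ℝ => (1 - θ) * (γ * 1)))
        ).intervalIntegrable _ _

/-- Serves the condition with `K`, where an arbitrary operator `B` stands between `b_i` and the
vectors. In a basis of the span of the `y i`, each coordinate of the hypothesis is a scalar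
combination that vanishes on exponentials; it may then be evaluated at the image under `B` of that
basis vector. -/
theorem sum_eval_clm_eq_zero [CompleteSpace X] {ι : Type*} (s : Finset ι) (b : ι → PhiComb)
    (hb : ∀ i ∈ s, b i ∈ nonneg) (y : ι → X)
    (hy : ∀ z : ℝ, ∑ i ∈ s, (b i).functional (fun s => Real.exp (s * z)) • y i = 0)
    (hS : IsC0Semigroup S) {t : ℝ} (ht : 0 ≤ t) (B : X →L[ℝ] X) :
    ∑ i ∈ s, (b i).eval (fun t x => S t x) t (B (y i)) = 0 := by
  classical
  have hΦ' : ∀ i, ∃ Φ : X →L[ℝ] X, i ∈ s → ∀ x, Φ x = (b i).eval (fun t x => S t x) t x := by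
    intro i
    by_cases hi : i ∈ s
    · obtain ⟨Φ, hΦ⟩ := exists_eval_clm (mem_nonneg_iff.1 (hb i hi)) hS ht
      exact ⟨Φ, fun _ => hΦ⟩
    · exact ⟨0, fun h => absurd h hi⟩
  choose Φ hΦ using hΦ'
  let W : Submodule ℝ X := Submodule.span ℝ (s.image y : Set X)
  have : FiniteDimensional ℝ W := FiniteDimensional.span_finset ℝ (s.image y)
  let e := Module.finBasis ℝ W
  have hyW : ∀ i, ∃ w : W, i ∈ s → (w : X) = y i := by
    intro i
    by_cases hi : i ∈ s
    · exact ⟨⟨y i, Submodule.subset_span (by simpa using ⟨i, hi, rfl⟩)⟩, fun _ => rfl⟩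
    · exact ⟨0, fun h => absurd h hi⟩
  choose w hw using hyW
  have hrepr : ∀ i ∈ s, y i = ∑ k, e.repr (w i) k • (e k : X) := by
    intro i hi
    have := congrArg (Subtype.val) (e.sum_repr (w i))
    rw [hw i hi, Submodule.coe_sum] at this
    exact this.symm
  have hz : ∀ k, (∑ i ∈ s, e.repr (w i) k • b i : PhiComb).eval (fun t x => S t x) t
      (B (e k : X)) = 0 := by
    intro k
    refine eval_eq_zero_of_exp (Submodule.sum_mem _ fun i hi =>
      Submodule.smul_mem _ _ (hb i hi)) (fun z => ?_) hS ht _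
    have h1 : ∑ i ∈ s, (b i).functional (fun s => Real.exp (s * z)) • w i = 0 := by
      apply Subtype.ext
      rw [Submodule.coe_sum]
      refine Eq.trans (Finset.sum_congr rfl fun i hi => ?_) (hy z)
      rw [Submodule.coe_smul, hw i hi]
    have h2 := congrArg (fun v => e.repr v k) h1
    simp only [map_sum, map_smul, map_zero, Finsupp.coe_zero, Pi.zero_apply,
      Finsupp.finsetSum_apply, Finsupp.smul_apply, smul_eq_mul] at h2
    rw [functional, eval_sum]
    refine Eq.trans (Finset.sum_congr rfl fun i _ => ?_) h2
    rw [eval_smul, smul_eq_mul, mul_comm]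
    rfl
  calc ∑ i ∈ s, (b i).eval (fun t x => S t x) t (B (y i))
      = ∑ i ∈ s, ∑ k, e.repr (w i) k • (b i).eval (fun t x => S t x) t (B (e k : X)) := by
        refine Finset.sum_congr rfl fun i hi => ?_
        rw [← hΦ i hi, hrepr i hi]
        simp only [map_sum, map_smul]
        simp only [hΦ i hi]
    _ = ∑ k, (∑ i ∈ s, e.repr (w i) k • b i : PhiComb).eval (fun t x => S t x) t
          (B (e k : X)) := by
        rw [Finset.sum_comm]
        simp only [eval_sum, eval_smul]
    _ = 0 := Finset.sum_eq_zero fun k _ => hz k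

end PhiComb

theorem matrixExp_diagonal {n : ℕ} (z : Fin n → ℝ) (t : ℝ) (v : Fin n → ℝ) :
    matrixExp (Matrix.diagonal z) t v = fun i => Real.exp (t * z i) * v i := by
  rw [matrixExp, ← Matrix.diagonal_smul, Matrix.exp_diagonal]
  ext i
  rw [Matrix.mulVec_diagonal, Pi.coe_exp, Real.exp_eq_exp_ℝ]
  rfl

theorem PhiComb.eval_matrixExp_diagonal (c : PhiComb) {n : ℕ} (z v : Fin n → ℝ) (i : Fin n) :
    c.eval (matrixExp (Matrix.diagonal z)) 1 v i
      = c.functional (fun s => Real.exp (s * z i)) * v i := by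
  simp only [PhiComb.eval, PhiComb.functional, Finsupp.sum, Finset.sum_apply, Finset.sum_mul,
    Pi.smul_apply, smul_eq_mul, mul_assoc]
  refine Finset.sum_congr rfl fun q _ => ?_
  congr 1
  rcases q with ⟨_ | k, γ⟩
  · simp [phi, matrixExp_diagonal]
  · simp only [phi, matrixExp_diagonal]
    have hcont : Continuous fun θ : ℝ => (θ ^ k / (k ! : ℝ)) •
        (fun i => Real.exp ((1 - θ) * (γ * 1) * z i) * v i : Fin n → ℝ) := by
      fun_prop
    have := ContinuousLinearMap.intervalIntegral_comp_comm
      (ContinuousLinearMap.proj i : (Fin n → ℝ) →L[ℝ] ℝ)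
      (hcont.intervalIntegrable (μ := MeasureTheory.volume) 0 1)
    simp only [ContinuousLinearMap.proj_apply] at this
    rw [← this, ← intervalIntegral.integral_mul_const]
    refine intervalIntegral.integral_congr fun θ _ => ?_
    simp [mul_assoc]

namespace EPIRK

variable (M : EPIRK)

/-- The `1 × 1` matrices already supply all real exponentials. -/
theorem WeightCondition.semigroup [CompleteSpace X] {M : EPIRK} {c : ℕ → ℝ} {d : ℝ} {k : ℕ}
    (h : M.WeightCondition c d k) (hS : IsC0Semigroup S) {t : ℝ} (ht : 0 ≤ t) (x : X) :
    ∑ i ∈ Finset.Icc 2 M.s, c i • (M.b i).eval (fun t x => S t x) t x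
      = d • phi (fun t x => S t x) k t x := by
  have hmem : (∑ i ∈ Finset.Icc 2 M.s, c i • M.b i - d • Finsupp.single (k, 1) 1 : PhiComb)
      ∈ PhiComb.nonneg :=
    Submodule.sub_mem _ (Submodule.sum_mem _ fun i hi => Submodule.smul_mem _ _
      (M.b_admissible i hi).mem_nonneg)
      (Submodule.smul_mem _ _ (PhiComb.single_mem_nonneg k zero_le_one))
  have hexp : ∀ (E : ℝ → X → X), (∑ i ∈ Finset.Icc 2 M.s, c i • M.b i
      - d • Finsupp.single (k, 1) 1 : PhiComb).eval E t x =
      ∑ i ∈ Finset.Icc 2 M.s, c i • (M.b i).eval E t x - d • phi E k t x := by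
    intro E
    rw [PhiComb.eval_sub, PhiComb.eval_sum, PhiComb.eval_smul, PhiComb.eval_single, one_mul]
    simp only [PhiComb.eval_smul]
  rw [← sub_eq_zero, ← hexp]
  refine PhiComb.eval_eq_zero_of_exp hmem (fun z => ?_) hS ht x
  have h1 := congrFun (h 1 (Matrix.diagonal fun _ => z) (fun _ => 1)) 0
  have h2 := PhiComb.eval_matrixExp_diagonal
    (∑ i ∈ Finset.Icc 2 M.s, c i • M.b i - d • Finsupp.single (k, 1) 1 : PhiComb)
    (n := 1) (fun _ => z) (fun _ => 1) 0
  rw [mul_one] at h2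
  rw [← h2, PhiComb.eval_sub, PhiComb.eval_sum, PhiComb.eval_smul, PhiComb.eval_single, one_mul]
  simp only [PhiComb.eval_smul, Pi.sub_apply]
  rw [h1, sub_self]

/-- `Ψ_i` as a combination of `φ`-functions. -/
noncomputable def bigPsiComb (i : ℕ) : PhiComb :=
  (1 / 2 : ℝ) • ∑ j ∈ Finset.Ico 2 i, (M.α j ^ 2 * M.P j 1 ^ 2) • M.a i j
    - (M.α i * M.g i ^ 2) • ∑ k ∈ Finset.Icc 1 M.q, M.p i k • Finsupp.single (k + 2, M.g i) 1

theorem bigPsi_eq_eval (i : ℕ) (E : ℝ → X → X) (t : ℝ) (x : X) :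
    M.bigPsi i E t x = (M.bigPsiComb i).eval E t x := by
  rw [bigPsiComb, PhiComb.eval_sub, PhiComb.eval_smul, PhiComb.eval_smul, PhiComb.eval_sum,
    PhiComb.eval_sum]
  simp only [PhiComb.eval_smul, PhiComb.eval_single]
  rfl

theorem bigPsiComb_mem_nonneg {i : ℕ} (hi : i ∈ Finset.Icc 2 M.s) :
    M.bigPsiComb i ∈ PhiComb.nonneg :=
  Submodule.sub_mem _
    (Submodule.smul_mem _ _ (Submodule.sum_mem _ fun j hj => Submodule.smul_mem _ _
      (M.a_admissible i hi j hj).mem_nonneg))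
    (Submodule.smul_mem _ _ (Submodule.sum_mem _ fun _ _ => Submodule.smul_mem _ _
      (PhiComb.single_mem_nonneg _ (M.g_nonneg i hi))))

/-- The two occurrences of `Z` are separated by `K` and can be made independent, which yields `∑ α_i
ℙ_i1 b_i(z₁) Ψ_i(z₂) = 0` for all real `z₁, z₂`. The semigroup is substituted for `z₂` with `z₁`
fixed, and afterwards for `z₁`. -/
theorem sum_eval_bigPsi_eq_zero [CompleteSpace X] {M : EPIRK}
    (h : ∀ (n : ℕ) (Z K : Matrix (Fin n) (Fin n) ℝ) (v : Fin n → ℝ),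
      ∑ i ∈ Finset.Icc 2 M.s, (M.α i * M.P i 1) •
        (M.b i).eval (matrixExp Z) 1 (K *ᵥ M.bigPsi i (matrixExp Z) 1 v) = 0)
    (hS : IsC0Semigroup S) {t : ℝ} (ht : 0 ≤ t) (B : X →L[ℝ] X) (x : X) :
    ∑ i ∈ Finset.Icc 2 M.s, (M.b i).eval (fun t x => S t x) t
      (B ((M.α i * M.P i 1) • M.bigPsi i (fun t x => S t x) t x)) = 0 := by
  refine PhiComb.sum_eval_clm_eq_zero _ M.b (fun i hi => (M.b_admissible i hi).mem_nonneg) _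
    (fun z₁ => ?_) hS ht B
  have hscal : ∀ z₂, ∑ i ∈ Finset.Icc 2 M.s, (M.α i * M.P i 1) *
      ((M.b i).functional (fun s => Real.exp (s * z₁)) *
        (M.bigPsiComb i).functional (fun s => Real.exp (s * z₂))) = 0 := by
    intro z₂
    -- The matrix unit `K` carries the second coordinate, where `Ψ_i` sees `z₂`, to the first, where
    -- `b_i` sees `z₁`.
    have h1 := congrFun (h 2 (Matrix.diagonal ![z₁, z₂]) !![0, 1; 0, 0] ![0, 1]) 0
    simpa [bigPsi_eq_eval, PhiComb.eval_matrixExp_diagonal, Matrix.mulVec, dotProduct,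
      Fin.sum_univ_two] using h1
  have := PhiComb.eval_eq_zero_of_exp
    (c := ∑ i ∈ Finset.Icc 2 M.s, (M.α i * M.P i 1 *
      (M.b i).functional (fun s => Real.exp (s * z₁))) • M.bigPsiComb i)
    (Submodule.sum_mem _ fun i hi => Submodule.smul_mem _ _ (M.bigPsiComb_mem_nonneg hi))
    (fun z₂ => by
      rw [PhiComb.functional, PhiComb.eval_sum]
      refine Eq.trans (Finset.sum_congr rfl fun i _ => ?_) (hscal z₂)
      rw [PhiComb.eval_smul, smul_eq_mul, mul_assoc]
      rfl) hS ht x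
  rw [PhiComb.eval_sum] at this
  rw [← this]
  refine Finset.sum_congr rfl fun i _ => ?_
  rw [PhiComb.eval_smul, bigPsi_eq_eval, smul_smul, mul_comm]

end EPIRK

end OrderConditionTransfer

/-! ### Dependence of one step on its starting value. -/

section StepStability

variable {X : Type*} [NormedAddCommGroup X] [NormedSpace ℝ X]

theorem EPIRK.stage_eq (M : EPIRK) (E : ℝ → X → X) (h : ℝ) (u y : X) (r : X → X) (i : ℕ) :
    M.stage E h u y r i = u + (M.α i * h) • M.psi i E h y
      + h • ∑ j ∈ Finset.Ico 2 i, (M.a i j).eval E h (r (M.stage E h u y r j)) := by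
  rw [EPIRK.stage]
  congr 2
  rw [Fin.sum_univ_eq_sum_range
    (fun j => if 2 ≤ j then (M.a i j).eval E h (r (M.stage E h u y r j)) else 0) i,
    ← Finset.sum_filter]
  refine Finset.sum_congr ?_ fun _ _ => rfl
  ext j; simp only [Finset.mem_filter, Finset.mem_range, Finset.mem_Ico]; tauto

/-- The semigroup `e^{tJ(w)}`. -/
noncomputable def jacFlow (L : X →ₗ.[ℝ] X) (N : X → X) (w : X) : ℝ → X →L[ℝ] X :=
  expSemigroup (jacobian L N w)

/-- The remainder `N(v) - N(w) - N'(w)(v - w)`. -/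
noncomputable def linRem (N : X → X) (w v : X) : X := N v - N w - fderiv ℝ N w (v - w)

/-- The stages of a step from `w`. -/
noncomputable def EPIRK.stageAt (M : EPIRK) (L : X →ₗ.[ℝ] X) (N : X → X) (h : ℝ) (w : L.domain)
    (i : ℕ) : X :=
  M.stage (fun t x => jacFlow L N w t x) h w (L w + N w) (linRem N w) i

theorem EPIRK.stageAt_eq (M : EPIRK) (L : X →ₗ.[ℝ] X) (N : X → X) (h : ℝ) (w : L.domain)
    (i : ℕ) : M.stageAt L N h w i
      = w + (M.α i * h) • M.psi i (fun t x => jacFlow L N w t x) h (L w + N w)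
        + h • ∑ j ∈ Finset.Ico 2 i, (M.a i j).eval (fun t x => jacFlow L N w t x) h
            (linRem N w (M.stageAt L N h w j)) :=
  M.stage_eq _ _ _ _ _ _

theorem EPIRK.step_eq (M : EPIRK) (L : X →ₗ.[ℝ] X) (N : X → X) (h : ℝ) (w : L.domain) :
    M.step L N h w = w + h • phi (fun t x => jacFlow L N w t x) 1 h (L w + N w)
      + h • ∑ j ∈ Finset.Icc 2 M.s, (M.b j).eval (fun t x => jacFlow L N w t x) h
            (linRem N w (M.stageAt L N h w j)) := rfl

theorem GeneratesC0Semigroup.jacFlow_isC0Semigroup [CompleteSpace X]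
    {L : X →ₗ.[ℝ] X}
    (hL : GeneratesC0Semigroup L) (N : X → X) (w : X) : IsC0Semigroup (jacFlow L N w) :=
  expSemigroup_isC0Semigroup (hL.vadd _)

theorem GeneratesC0Semigroup.jacFlow_isGenerator [CompleteSpace X]
    {L : X →ₗ.[ℝ] X}
    (hL : GeneratesC0Semigroup L) (N : X → X) (w : X) :
    IsGenerator (jacobian L N w) (jacFlow L N w) :=
  expSemigroup_isGenerator (hL.vadd _)

theorem mem_graph_jacobian_iff {L : X →ₗ.[ℝ] X} {N : X → X} {w x y : X} :
    (x, y) ∈ (jacobian L N w).graph ↔ (x, y - fderiv ℝ N w x) ∈ L.graph :=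
  LinearPMap.mem_graph_vadd_iff _ _ _ _

/-- Uniform bounds on a neighbourhood of the point `c`. -/
structure PointBounds (L : X →ₗ.[ℝ] X) (N : X → X) (ρ K Γ κ : ℝ) (c : L.domain) : Prop where
  norm_center : ‖(c : X)‖ ≤ K
  norm_f : ‖L c + N c‖ ≤ K
  norm_N : ∀ v ∈ Metric.ball (c : X) ρ, ‖N v‖ ≤ K
  norm_D : ∀ v ∈ Metric.ball (c : X) ρ, ‖fderiv ℝ N v‖ ≤ K
  lip_N : ∀ v ∈ Metric.ball (c : X) ρ, ∀ w ∈ Metric.ball (c : X) ρ, ‖N v - N w‖ ≤ K * ‖v - w‖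
  lip_D : ∀ v ∈ Metric.ball (c : X) ρ, ∀ w ∈ Metric.ball (c : X) ρ,
    ‖fderiv ℝ N v - fderiv ℝ N w‖ ≤ K * ‖v - w‖
  flow : ∀ v ∈ Metric.ball (c : X) ρ, ∀ s ∈ Icc 0 Γ, ‖jacFlow L N v s‖ ≤ κ
  flow_lip : ∀ v ∈ Metric.ball (c : X) ρ, ∀ w ∈ Metric.ball (c : X) ρ, ∀ s ∈ Icc 0 Γ,
    ‖jacFlow L N v s - jacFlow L N w s‖ ≤ κ * ‖v - w‖ * s

/-- `Γ` bounds all `γ` and `g` of the method, and `Q` all coefficient sums. -/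
structure EPIRK.Bounds (M : EPIRK) (Γ Q : ℝ) : Prop where
  one_le : 1 ≤ Γ
  Q_nonneg : 0 ≤ Q
  g_le : ∀ i ∈ Finset.Icc 2 M.s, M.g i ≤ Γ
  a_le : ∀ i ∈ Finset.Icc 2 M.s, ∀ j ∈ Finset.Ico 2 i, ∀ q ∈ (M.a i j).support, q.2 ≤ Γ
  b_le : ∀ j ∈ Finset.Icc 2 M.s, ∀ q ∈ (M.b j).support, q.2 ≤ Γ
  a_size : ∀ i ∈ Finset.Icc 2 M.s, ∀ j ∈ Finset.Ico 2 i, (M.a i j).size ≤ Q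
  b_size : ∀ j ∈ Finset.Icc 2 M.s, (M.b j).size ≤ Q

theorem EPIRK.exists_bounds (M : EPIRK) : ∃ Γ Q : ℝ, M.Bounds Γ Q := by
  classical
  let I := Finset.Icc 2 M.s
  obtain ⟨Γ, hΓ⟩ := (({1} : Finset ℝ) ∪ I.image M.g
    ∪ I.biUnion (fun i => (Finset.Ico 2 i).biUnion fun j => (M.a i j).support.image Prod.snd)
    ∪ I.biUnion (fun j => (M.b j).support.image Prod.snd)).exists_le
  obtain ⟨Q, hQ⟩ := (({0} : Finset ℝ)
    ∪ I.biUnion (fun i => (Finset.Ico 2 i).image fun j => (M.a i j).size)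
    ∪ I.image (fun j => (M.b j).size)).exists_le
  refine ⟨Γ, Q, ?_, ?_, ?_, ?_, ?_, ?_, ?_⟩
  · exact hΓ _ (by simp)
  · exact hQ _ (by simp)
  · exact fun i hi => hΓ _ (by
      simp only [Finset.mem_union, Finset.mem_image]; exact Or.inl (Or.inl (Or.inr ⟨i, hi, rfl⟩)))
  · exact fun i hi j hj q hq => hΓ _ (by
      simp only [Finset.mem_union, Finset.mem_image, Finset.mem_biUnion]
      exact Or.inl (Or.inr ⟨i, hi, j, hj, q, hq, rfl⟩))
  · exact fun j hj q hq => hΓ _ (by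
      simp only [Finset.mem_union, Finset.mem_image, Finset.mem_biUnion]
      exact Or.inr ⟨j, hj, q, hq, rfl⟩)
  · exact fun i hi j hj => hQ _ (by
      simp only [Finset.mem_union, Finset.mem_image, Finset.mem_biUnion]
      exact Or.inl (Or.inr ⟨i, hi, j, hj, rfl⟩))
  · exact fun j hj => hQ _ (by
      simp only [Finset.mem_union, Finset.mem_image]
      exact Or.inr ⟨j, hj, rfl⟩)

variable {L : X →ₗ.[ℝ] X} {N : X → X} {ρ K Γ κ Q : ℝ} {c w : L.domain} {h : ℝ}

namespace PointBounds

theorem norm_le (hc : PointBounds L N ρ K Γ κ c) (hρ : ρ ≤ 1)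
    (hw : (w : X) ∈ Metric.ball (c : X) ρ) : ‖(w : X)‖ ≤ K + 1 := by
  have h1 := hc.norm_center
  have h2 := mem_ball_iff_norm.1 hw
  have : (w : X) = c + (w - c) := by abel
  rw [this]
  linarith [norm_add_le (c : X) (w - c)]

theorem K_nonneg (hc : PointBounds L N ρ K Γ κ c) : 0 ≤ K := (norm_nonneg _).trans hc.norm_center

theorem κ_nonneg (hc : PointBounds L N ρ K Γ κ c) (hρ : 0 < ρ) (hΓ : 0 ≤ Γ) : 0 ≤ κ :=
  (norm_nonneg _).trans (hc.flow c (Metric.mem_ball_self hρ) 0 ⟨le_rfl, hΓ⟩)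

/-- Dependence of `φ_k(γ h J(w)) x` on `w` and `x`. -/
theorem norm_phi_sub_le [CompleteSpace X]
    (hc : PointBounds L N ρ K Γ κ c) (hL : GeneratesC0Semigroup L)
    (hρ : 0 < ρ) (hΓ : 1 ≤ Γ) (hw : (w : X) ∈ Metric.ball (c : X) ρ) (hh : 0 ≤ h) (hh1 : h ≤ 1)
    {γ : ℝ} (hγ0 : 0 ≤ γ) (hγ : γ ≤ Γ) (k : ℕ) (x y : X) :
    ‖phi (fun t x => jacFlow L N w t x) k (γ * h) x
      - phi (fun t x => jacFlow L N c t x) k (γ * h) y‖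
      ≤ κ * ‖x - y‖ + κ * ‖(w : X) - c‖ * (Γ * h) * ‖y‖ := by
  have hκ := hc.κ_nonneg hρ (by linarith)
  have hle : γ * h ≤ Γ * h := mul_le_mul_of_nonneg_right hγ hh
  have hle' : Γ * h ≤ Γ := mul_le_of_le_one_right (by linarith) hh1
  refine (hL.jacFlow_isC0Semigroup N w).norm_phi_sub_phi_le (hL.jacFlow_isC0Semigroup N c)
    (mul_nonneg hγ0 hh) (fun s hs => hc.flow _ hw s ⟨hs.1, by linarith [hs.2]⟩)
    (fun s hs => (hc.flow_lip _ hw _ (Metric.mem_ball_self hρ) s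
      ⟨hs.1, by linarith [hs.2]⟩).trans ?_) k x y
  have := hs.2
  gcongr
  linarith

/-- Dependence of `c(h J(w)) x` on `w` and `x`. -/
theorem norm_eval_sub_le [CompleteSpace X]
    (hc : PointBounds L N ρ K Γ κ c) (hL : GeneratesC0Semigroup L)
    (hρ : 0 < ρ) (hΓ : 1 ≤ Γ) (hw : (w : X) ∈ Metric.ball (c : X) ρ) (hh : 0 ≤ h) (hh1 : h ≤ 1)
    {a : PhiComb} (ha : a.IsAdmissible) (haΓ : ∀ q ∈ a.support, q.2 ≤ Γ) (hQ : a.size ≤ Q)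
    (x y : X) :
    ‖a.eval (fun t x => jacFlow L N w t x) h x - a.eval (fun t x => jacFlow L N c t x) h y‖
      ≤ Q * (κ * ‖x - y‖ + κ * ‖(w : X) - c‖ * (Γ * h) * ‖y‖) := by
  have hκ := hc.κ_nonneg hρ (by linarith)
  have hle' : Γ * h ≤ Γ := mul_le_of_le_one_right (by linarith) hh1
  have hs0 := a.size_nonneg
  refine (PhiComb.norm_eval_sub_eval_le (τ := Γ * h) (fun q hq => (ha q hq).2)
    (hL.jacFlow_isC0Semigroup N w) (hL.jacFlow_isC0Semigroup N c) hh
    (fun q hq => mul_le_mul_of_nonneg_right (haΓ q hq) hh)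
    (fun s hs => hc.flow _ hw s ⟨hs.1, by linarith [hs.2]⟩)
    (fun s hs => (hc.flow_lip _ hw _ (Metric.mem_ball_self hρ) s
      ⟨hs.1, by linarith [hs.2]⟩).trans
      (mul_le_mul_of_nonneg_left hs.2 (by positivity))) x y).trans ?_
  gcongr

theorem norm_eval_le [CompleteSpace X]
    (hc : PointBounds L N ρ K Γ κ c) (hL : GeneratesC0Semigroup L)
    (hρ : 0 < ρ) (hΓ : 1 ≤ Γ) (hh : 0 ≤ h) (hh1 : h ≤ 1)
    {a : PhiComb} (ha : a.IsAdmissible) (haΓ : ∀ q ∈ a.support, q.2 ≤ Γ) (hQ : a.size ≤ Q)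
    (x : X) : ‖a.eval (fun t x => jacFlow L N c t x) h x‖ ≤ Q * (κ * ‖x‖) := by
  have hκ := hc.κ_nonneg hρ (by linarith)
  have hle' : Γ * h ≤ Γ := mul_le_of_le_one_right (by linarith) hh1
  refine (PhiComb.norm_eval_le (τ := Γ * h) (fun q hq => (ha q hq).2)
    (hL.jacFlow_isC0Semigroup N c) hh
    (fun q hq => mul_le_mul_of_nonneg_right (haΓ q hq) hh)
    (fun s hs => hc.flow _ (Metric.mem_ball_self hρ) s ⟨hs.1, by linarith [hs.2]⟩) x).trans ?_
  gcongr

theorem norm_phi_le [CompleteSpace X]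
    (hc : PointBounds L N ρ K Γ κ c) (hL : GeneratesC0Semigroup L)
    (hρ : 0 < ρ) (hΓ : 1 ≤ Γ) (hh : 0 ≤ h) (hh1 : h ≤ 1)
    {γ : ℝ} (hγ0 : 0 ≤ γ) (hγ : γ ≤ Γ) (k : ℕ) (x : X) :
    ‖phi (fun t x => jacFlow L N c t x) k (γ * h) x‖ ≤ κ * ‖x‖ := by
  have hle : γ * h ≤ Γ * h := mul_le_mul_of_nonneg_right hγ hh
  have hle' : Γ * h ≤ Γ := mul_le_of_le_one_right (by linarith) hh1
  exact (hL.jacFlow_isC0Semigroup N c).norm_phi_le (mul_nonneg hγ0 hh)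
    (fun s hs => hc.flow _ (Metric.mem_ball_self hρ) s ⟨hs.1, by linarith [hs.2]⟩) k x

/-- The bounded part `N(w) - N'(w) w` of `f(w)` is Lipschitz. -/
theorem norm_affine_sub_le (hc : PointBounds L N ρ K Γ κ c) (hρ : 0 < ρ) (hρ1 : ρ ≤ 1)
    (hw : (w : X) ∈ Metric.ball (c : X) ρ) :
    ‖(N w - fderiv ℝ N w w) - (N c - fderiv ℝ N c c)‖ ≤ (2 * K + K * (K + 1)) * ‖(w : X) - c‖ := by
  have hcc := Metric.mem_ball_self (x := (c : X)) hρ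
  have hK := hc.K_nonneg
  have e : (N w - fderiv ℝ N w w) - (N c - fderiv ℝ N c c)
      = (N w - N c) - fderiv ℝ N c (w - c) - (fderiv ℝ N w - fderiv ℝ N c) (w : X) := by
    simp only [map_sub, _root_.sub_apply]; abel
  rw [e]
  have h1 := hc.lip_N _ hw _ hcc
  have h2 := (fderiv ℝ N (c : X)).le_of_opNorm_le (hc.norm_D _ hcc) ((w : X) - c)
  have h3 := (fderiv ℝ N (w : X) - fderiv ℝ N (c : X)).le_of_opNorm_le
    (hc.lip_D _ hw _ hcc) (w : X)
  have h4 := hc.norm_le hρ1 hw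
  calc _ ≤ K * ‖(w : X) - c‖ + K * ‖(w : X) - c‖ + K * ‖(w : X) - c‖ * ‖(w : X)‖ :=
        (norm_sub_le _ _).trans (add_le_add ((norm_sub_le _ _).trans (add_le_add h1 h2)) h3)
    _ ≤ K * ‖(w : X) - c‖ + K * ‖(w : X) - c‖ + K * ‖(w : X) - c‖ * (K + 1) := by gcongr
    _ = _ := by ring

theorem norm_affine_le (hc : PointBounds L N ρ K Γ κ c) (hρ : 0 < ρ) :
    ‖N c - fderiv ℝ N c c‖ ≤ K + K * K := by
  have hcc := Metric.mem_ball_self (x := (c : X)) hρ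
  have hK := hc.K_nonneg
  refine (norm_sub_le _ _).trans (add_le_add (hc.norm_N _ hcc) ?_)
  exact ((fderiv ℝ N (c : X)).le_of_opNorm_le (hc.norm_D _ hcc) _).trans
    (mul_le_mul_of_nonneg_left hc.norm_center hK)

/-- Plain Lipschitz dependence on the stage and on the base point suffices, since remainders enter
the step with a factor `h`. -/
theorem norm_linRem_sub_le (hc : PointBounds L N ρ K Γ κ c) (hρ : 0 < ρ) (hρ1 : ρ ≤ 1)
    (hw : (w : X) ∈ Metric.ball (c : X) ρ) {V U : X} (hV : V ∈ Metric.ball (c : X) ρ)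
    (hU : U ∈ Metric.ball (c : X) ρ) :
    ‖linRem N w V - linRem N c U‖ ≤ 2 * K * ‖V - U‖ + 4 * K * ‖(w : X) - c‖ := by
  have hcc := Metric.mem_ball_self (x := (c : X)) hρ
  have hK := hc.K_nonneg
  have e : linRem N w V - linRem N c U = (N V - N U) - (N w - N c)
      - fderiv ℝ N w (V - U) + fderiv ℝ N w (w - c)
      - (fderiv ℝ N w - fderiv ℝ N c) (U - c) := by
    simp only [linRem, map_sub, _root_.sub_apply]; abel
  rw [e]
  have h1 := hc.lip_N _ hV _ hU
  have h2 := hc.lip_N _ hw _ hcc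
  have h3 := (fderiv ℝ N (w : X)).le_of_opNorm_le (hc.norm_D _ hw) (V - U)
  have h4 := (fderiv ℝ N (w : X)).le_of_opNorm_le (hc.norm_D _ hw) ((w : X) - c)
  have h5 := (fderiv ℝ N (w : X) - fderiv ℝ N (c : X)).le_of_opNorm_le
    (hc.lip_D _ hw _ hcc) (U - c)
  have h6 : ‖U - c‖ ≤ 1 := (mem_ball_iff_norm.1 hU).le.trans hρ1
  have h7 : K * ‖(w : X) - c‖ * ‖U - c‖ ≤ K * ‖(w : X) - c‖ * 1 := by gcongr
  refine (norm_sub_le _ _).trans ((add_le_add ((norm_add_le _ _).trans (add_le_add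
    ((norm_sub_le _ _).trans (add_le_add ((norm_sub_le _ _).trans (add_le_add h1 h2)) h3)) h4))
    h5).trans ?_)
  have := mul_nonneg hK (norm_nonneg ((w : X) - c))
  linarith

theorem norm_linRem_le (hc : PointBounds L N ρ K Γ κ c) (hρ : 0 < ρ)
    {U : X} (hU : U ∈ Metric.ball (c : X) ρ) : ‖linRem N c U‖ ≤ 2 * K * ‖U - c‖ := by
  have hcc := Metric.mem_ball_self (x := (c : X)) hρ
  have h1 := hc.lip_N _ hU _ hcc
  have h2 := (fderiv ℝ N (c : X)).le_of_opNorm_le (hc.norm_D _ hcc) (U - c)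
  exact (norm_sub_le _ _).trans ((add_le_add h1 h2).trans (by linarith))

/-- `h φ_k(g h J) f(w)` for `g > 0`, with the unbounded operator removed. -/
theorem smul_phi_eq [CompleteSpace X]
    (hL : GeneratesC0Semigroup L) (hh : 0 ≤ h) {γ : ℝ} (hγ : 0 < γ) (k : ℕ) :
    h • phi (fun t x => jacFlow L N w t x) (k + 1) (γ * h) (L w + N w)
      = γ⁻¹ • (phi (fun t x => jacFlow L N w t x) k (γ * h) w - (1 / (k ! : ℝ)) • (w : X))
        + h • phi (fun t x => jacFlow L N w t x) (k + 1) (γ * h) (N w - fderiv ℝ N w w) := by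
  have hS := hL.jacFlow_isC0Semigroup N w
  have hg : ((w : X), L w + fderiv ℝ N w w) ∈ (jacobian L N w).graph := by
    rw [mem_graph_jacobian_iff, add_sub_cancel_right]
    exact L.mem_graph w
  have h1 := hS.phi_eq_add (hL.jacFlow_isGenerator N w) hg (mul_nonneg hγ.le hh) k
  obtain ⟨Φ, hΦ⟩ := hS.exists_phi_clm (mul_nonneg hγ.le hh) (k + 1)
  rw [h1, add_sub_cancel_left, smul_smul, ← mul_assoc, inv_mul_cancel₀ hγ.ne', one_mul, ← smul_add,
    ← hΦ, ← hΦ, ← hΦ, ← map_add]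
  congr 2
  abel

/-- No estimate of `L w - L c` is available. For `g_i > 0` the identity `smul_phi_eq` expresses each
term through bounded operators applied to `w` and to the Lipschitz part `N w - N'(w) w`. For `g_i =
0` there is no smoothing, and the coefficient restriction is what removes the term. -/
theorem exists_norm_psi_sub_le [CompleteSpace X]
    (M : EPIRK) (hM : M.CoeffRestriction) (hMB : M.Bounds Γ Q)
    (hL : GeneratesC0Semigroup L) (N : X → X) (hρ : 0 < ρ) (hρ1 : ρ ≤ 1) (K κ : ℝ) {i : ℕ}
    (hi : i ∈ Finset.Icc 2 M.s) :
    ∃ C : ℝ, ∀ (c w : L.domain) (h : ℝ), PointBounds L N ρ K Γ κ c →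
      (w : X) ∈ Metric.ball (c : X) ρ → 0 ≤ h → h ≤ 1 →
      ‖(M.α i * h) • M.psi i (fun t x => jacFlow L N w t x) h (L w + N w)
        - (M.α i * h) • M.psi i (fun t x => jacFlow L N c t x) h (L c + N c)‖
        ≤ C * ‖(w : X) - c‖ := by
  have hk : ∀ k ∈ Finset.Icc 1 M.q, ∃ C : ℝ, ∀ (c w : L.domain) (h : ℝ),
      PointBounds L N ρ K Γ κ c → (w : X) ∈ Metric.ball (c : X) ρ → 0 ≤ h → h ≤ 1 →
      ‖(M.α i * M.p i k) • h • phi (fun t x => jacFlow L N w t x) k (M.g i * h) (L w + N w)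
        - (M.α i * M.p i k) • h • phi (fun t x => jacFlow L N c t x) k (M.g i * h) (L c + N c)‖
        ≤ C * ‖(w : X) - c‖ := by
    intro k hk
    have hg0 := M.g_nonneg i hi
    have hgΓ := hMB.g_le i hi
    rcases hg0.eq_or_lt with hg | hg
    · refine ⟨0, fun c w h _ _ _ _ => ?_⟩
      -- With `g_i = 0` each of the three alternatives of (A3) makes a factor, or the product
      -- itself, zero.
      have : M.α i * M.p i k = 0 := by
        rcases hM i hi k hk with h1 | h1 | h1 <;> rw [h1, ← hg] <;> simp
      simp [this]
    · obtain ⟨j, rfl⟩ : ∃ j, k = j + 1 :=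
        ⟨k - 1, (Nat.sub_add_cancel (Finset.mem_Icc.1 hk).1).symm⟩
      refine ⟨|M.α i * M.p i (j + 1)| * ((M.g i)⁻¹ * (κ + κ * Γ * K + 1)
        + (κ * (2 * K + K * (K + 1)) + κ * Γ * (K + K * K))), fun c w h hc hw hh hh1 => ?_⟩
      have hK := hc.K_nonneg
      have hκ := hc.κ_nonneg hρ (by linarith [hMB.one_le])
      have hΓ0 : 0 ≤ Γ := by linarith [hMB.one_le]
      rw [← smul_sub, norm_smul, Real.norm_eq_abs, mul_assoc]
      refine mul_le_mul_of_nonneg_left ?_ (abs_nonneg _)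
      rw [smul_phi_eq hL hh hg, smul_phi_eq hL hh hg, add_sub_add_comm, ← smul_sub, ← smul_sub,
        sub_sub_sub_comm, ← smul_sub, add_mul]
      have h1 := hc.norm_phi_sub_le hL hρ hMB.one_le hw hh hh1 hg0 hgΓ j w c
      have h2 := hc.norm_phi_sub_le hL hρ hMB.one_le hw hh hh1 hg0 hgΓ (j + 1)
        (N w - fderiv ℝ N w w) (N c - fderiv ℝ N c c)
      have h3 := hc.norm_affine_sub_le hρ hρ1 hw
      have h4 := hc.norm_affine_le hρ
      have h5 := hc.norm_center
      refine (norm_add_le _ _).trans (add_le_add ?_ ?_)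
      · rw [norm_smul, Real.norm_eq_abs, abs_of_pos (inv_pos.2 hg), mul_assoc]
        refine mul_le_mul_of_nonneg_left ?_ (inv_pos.2 hg).le
        have hf1 : ‖(1 / (j ! : ℝ)) • ((w : X) - c)‖ ≤ ‖(w : X) - c‖ := by
          rw [norm_smul]
          refine mul_le_of_le_one_left (norm_nonneg _) ?_
          have := abs_pow_div_factorial_le_one (θ := 1) ⟨zero_le_one, le_rfl⟩ j
          simpa using this
        refine (norm_sub_le _ _).trans ((add_le_add h1 hf1).trans ?_)
        calc κ * ‖(w : X) - c‖ + κ * ‖(w : X) - c‖ * (Γ * h) * ‖(c : X)‖ + ‖(w : X) - c‖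
            ≤ κ * ‖(w : X) - c‖ + κ * ‖(w : X) - c‖ * (Γ * 1) * K + ‖(w : X) - c‖ := by gcongr
          _ = _ := by ring
      · rw [norm_smul, Real.norm_eq_abs, abs_of_nonneg hh]
        refine (mul_le_of_le_one_left (norm_nonneg _) hh1).trans (h2.trans ?_)
        calc _ ≤ κ * ((2 * K + K * (K + 1)) * ‖(w : X) - c‖)
              + κ * ‖(w : X) - c‖ * (Γ * 1) * (K + K * K) := by gcongr
          _ = _ := by ring
  choose! C hC using hk
  refine ⟨∑ k ∈ Finset.Icc 1 M.q, C k, fun c w h hc hw hh hh1 => ?_⟩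
  have e : ∀ v : L.domain, (M.α i * h) • M.psi i (fun t x => jacFlow L N v t x) h (L v + N v)
      = ∑ k ∈ Finset.Icc 1 M.q, (M.α i * M.p i k) • h •
        phi (fun t x => jacFlow L N v t x) k (M.g i * h) (L v + N v) := by
    intro v
    rw [EPIRK.psi, Finset.smul_sum]
    refine Finset.sum_congr rfl fun k _ => ?_
    rw [smul_smul, smul_smul]; congr 1; ring
  rw [e, e, ← Finset.sum_sub_distrib, Finset.sum_mul]
  exact norm_sum_le_of_le _ fun k hk => hC k hk c w h hc hw hh hh1

theorem norm_psi_le [CompleteSpace X]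
    (hc : PointBounds L N ρ K Γ κ c) (M : EPIRK) (hMB : M.Bounds Γ Q)
    (hL : GeneratesC0Semigroup L) (hρ : 0 < ρ) (hh : 0 ≤ h) (hh1 : h ≤ 1) {i : ℕ}
    (hi : i ∈ Finset.Icc 2 M.s) (y : X) :
    ‖M.psi i (fun t x => jacFlow L N c t x) h y‖
      ≤ (∑ k ∈ Finset.Icc 1 M.q, |M.p i k|) * (κ * ‖y‖) := by
  rw [EPIRK.psi, Finset.sum_mul]
  refine norm_sum_le_of_le _ fun k _ => ?_
  rw [norm_smul, Real.norm_eq_abs]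
  gcongr
  exact hc.norm_phi_le hL hρ hMB.one_le hh hh1 (M.g_nonneg i hi) (hMB.g_le i hi) k y

set_option maxHeartbeats 1000000 in
/-- The stages depend Lipschitz continuously on the starting value and stay close to it. -/
theorem exists_stage_bounds [CompleteSpace X]
    (M : EPIRK) (hM : M.CoeffRestriction) (hMB : M.Bounds Γ Q)
    (hL : GeneratesC0Semigroup L) (N : X → X) (hρ : 0 < ρ) (hρ1 : ρ ≤ 1) (K κ : ℝ)
    (hK : 0 ≤ K) (hκ : 0 ≤ κ) :
    ∃ C η : ℝ, 0 ≤ C ∧ 0 < η ∧ η ≤ 1 ∧ η < ρ ∧ ∀ i ∈ Finset.Icc 2 M.s, ∀ (c w : L.domain) (h : ℝ),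
      PointBounds L N ρ K Γ κ c → ‖(w : X) - c‖ ≤ η → 0 ≤ h → h ≤ η →
      M.stageAt L N h w i ∈ Metric.ball (c : X) ρ ∧
      ‖M.stageAt L N h w i - M.stageAt L N h c i‖ ≤ C * ‖(w : X) - c‖ ∧
      ‖M.stageAt L N h c i - c‖ ≤ C * h := by
  have hind : ∀ n : ℕ, ∃ C η : ℝ, 0 ≤ C ∧ 0 < η ∧ η ≤ 1 ∧ η < ρ ∧ ∀ i ∈ Finset.Icc 2 M.s, i < n →
      ∀ (c w : L.domain) (h : ℝ),
      PointBounds L N ρ K Γ κ c → ‖(w : X) - c‖ ≤ η → 0 ≤ h → h ≤ η →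
      M.stageAt L N h w i ∈ Metric.ball (c : X) ρ ∧
      ‖M.stageAt L N h w i - M.stageAt L N h c i‖ ≤ C * ‖(w : X) - c‖ ∧
      ‖M.stageAt L N h c i - c‖ ≤ C * h := by
    -- Induction over the stages, which is possible because the method is explicit: stage `n` refers
    -- only to earlier ones.
    intro n
    induction n with
    | zero =>
      exact ⟨0, min 1 (ρ / 2), le_rfl, by positivity, min_le_left _ _,
        (min_le_right _ _).trans_lt (by linarith), fun i _ hi => absurd hi (Nat.not_lt_zero i)⟩
    | succ n ih =>
      obtain ⟨C, η, hC, hη, hη1, hηρ, H⟩ := ih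
      by_cases hn : n ∈ Finset.Icc 2 M.s
      swap
      · refine ⟨C, η, hC, hη, hη1, hηρ, fun i hi hin => H i hi ?_⟩
        rcases Nat.lt_succ_iff_lt_or_eq.1 hin with h | h
        · exact h
        · exact absurd (h ▸ hi) hn
      obtain ⟨Cψ, hCψ⟩ := exists_norm_psi_sub_le M hM hMB hL N hρ hρ1 K κ hn
      have hQ := hMB.Q_nonneg
      have hΓ0 : 0 ≤ Γ := by linarith [hMB.one_le]
      set P := |M.α n| * ∑ k ∈ Finset.Icc 1 M.q, |M.p n k| with hP
      have hP0 : 0 ≤ P := by positivity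
      -- `D₁` is the Lipschitz constant of the new stage (the `1` comes from the starting value
      -- itself), `D₂` bounds its distance from the unperturbed centre per unit of `h`.
      set D₁ := 1 + |Cψ| + n * (Q * (κ * (2 * K * C + 4 * K) + κ * Γ * (2 * K * C))) with hD₁
      set D₂ := P * (κ * K) + n * (Q * (κ * (2 * K * C))) with hD₂
      have hD₁0 : 0 ≤ D₁ := by positivity
      have hD₂0 : 0 ≤ D₂ := by positivity
      set C' := C + D₁ + D₂ with hC'
      have hCC' : C ≤ C' := by linarith
      have hD₁C' : D₁ ≤ C' := by linarith
      have hD₂C' : D₂ ≤ C' := by linarith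
      have hC'0 : 0 ≤ C' := by linarith
      -- With both the perturbation and `h` below `ρ / (2 C' + 1) / 2`, the stage moves by at most
      -- `C' ρ / (2 C' + 1) < ρ` and stays in the ball.
      refine ⟨C', min η (ρ / (2 * C' + 1) / 2), hC'0, by positivity, (min_le_left _ _).trans hη1,
        (min_le_left _ _).trans_lt hηρ, fun i hi hin c w h hc hw hh hh1 => ?_⟩
      have hwη := hw.trans (min_le_left _ _)
      have hhη := hh1.trans (min_le_left _ _)
      have hwb : (w : X) ∈ Metric.ball (c : X) ρ := mem_ball_iff_norm.2 (hwη.trans_lt hηρ)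
      have hcη : ‖(c : X) - c‖ ≤ η := by simpa using hη.le
      rcases Nat.lt_succ_iff_lt_or_eq.1 hin with hlt | rfl
      · obtain ⟨h1, h2, h3⟩ := H i hi hlt c w h hc hwη hh hhη
        exact ⟨h1, h2.trans (by gcongr), h3.trans (by gcongr)⟩
      have hhone : h ≤ 1 := hhη.trans hη1
      have hj : ∀ j ∈ Finset.Ico 2 i, j ∈ Finset.Icc 2 M.s ∧ j < i := fun j hj => by
        rw [Finset.mem_Ico] at hj; rw [Finset.mem_Icc] at hi ⊢
        exact ⟨⟨hj.1, hj.2.le.trans hi.2⟩, hj.2⟩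
      have hcard : ((Finset.Ico 2 i).card : ℝ) ≤ i := by
        rw [Nat.card_Ico]; exact_mod_cast Nat.sub_le _ _
      have hdiff : ‖M.stageAt L N h w i - M.stageAt L N h c i‖ ≤ D₁ * ‖(w : X) - c‖ := by
        rw [M.stageAt_eq L N h w i, M.stageAt_eq L N h c i, add_sub_add_comm, add_sub_add_comm,
          ← smul_sub h, ← Finset.sum_sub_distrib]
        have h1 := hCψ c w h hc hwb hh hhone
        have h2 : ‖∑ j ∈ Finset.Ico 2 i, ((M.a i j).eval (fun t x => jacFlow L N w t x) h
            (linRem N w (M.stageAt L N h w j)) - (M.a i j).eval (fun t x => jacFlow L N c t x) h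
            (linRem N c (M.stageAt L N h c j)))‖
            ≤ i * (Q * (κ * (2 * K * C + 4 * K) + κ * Γ * (2 * K * C)) * ‖(w : X) - c‖) := by
          refine (norm_sum_le_of_le (f := _) (n := fun _ =>
            Q * (κ * (2 * K * C + 4 * K) + κ * Γ * (2 * K * C)) * ‖(w : X) - c‖) _
            fun j hj' => ?_).trans ?_
          · obtain ⟨hjs, hji⟩ := hj j hj'
            obtain ⟨g1, g2, g3⟩ := H j hjs hji c w h hc hwη hh hhη
            obtain ⟨g4, -, -⟩ := H j hjs hji c c h hc hcη hh hhη
            have r1 := hc.norm_linRem_sub_le hρ hρ1 hwb g1 g4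
            have r2 := hc.norm_linRem_le hρ g4
            refine (hc.norm_eval_sub_le hL hρ hMB.one_le hwb hh hhone
              (M.a_admissible i hi j hj') (hMB.a_le i hi j hj') (hMB.a_size i hi j hj')
              _ _).trans ?_
            have r3 : ‖linRem N w (M.stageAt L N h w j) - linRem N c (M.stageAt L N h c j)‖
                ≤ (2 * K * C + 4 * K) * ‖(w : X) - c‖ := by
              refine r1.trans ?_
              have : 2 * K * ‖M.stageAt L N h w j - M.stageAt L N h c j‖
                  ≤ 2 * K * (C * ‖(w : X) - c‖) := by gcongr
              linarith
            have r4 : ‖linRem N c (M.stageAt L N h c j)‖ ≤ 2 * K * C := by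
              refine r2.trans ?_
              have : 2 * K * ‖M.stageAt L N h c j - c‖ ≤ 2 * K * (C * 1) := by
                gcongr; exact g3.trans (by gcongr)
              linarith
            calc _ ≤ Q * (κ * ((2 * K * C + 4 * K) * ‖(w : X) - c‖)
                  + κ * ‖(w : X) - c‖ * (Γ * 1) * (2 * K * C)) := by gcongr
              _ = _ := by ring
          · rw [Finset.sum_const, nsmul_eq_mul]
            gcongr
        have h3 : ‖h • ∑ j ∈ Finset.Ico 2 i, ((M.a i j).eval (fun t x => jacFlow L N w t x) h
            (linRem N w (M.stageAt L N h w j)) - (M.a i j).eval (fun t x => jacFlow L N c t x) h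
            (linRem N c (M.stageAt L N h c j)))‖
            ≤ i * (Q * (κ * (2 * K * C + 4 * K) + κ * Γ * (2 * K * C)) * ‖(w : X) - c‖) := by
          rw [norm_smul, Real.norm_eq_abs, abs_of_nonneg hh]
          exact (mul_le_of_le_one_left (norm_nonneg _) hhone).trans h2
        refine (norm_add_le _ _).trans ((add_le_add ((norm_add_le _ _).trans
          (add_le_add le_rfl h1)) h3).trans ?_)
        have := mul_le_mul_of_nonneg_right (le_abs_self Cψ) (norm_nonneg ((w : X) - c))
        rw [hD₁]
        linarith
      have hsize : ‖M.stageAt L N h c i - c‖ ≤ D₂ * h := by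
        rw [M.stageAt_eq L N h c i, add_assoc, add_sub_cancel_left]
        have h1 : ‖(M.α i * h) • M.psi i (fun t x => jacFlow L N c t x) h (L c + N c)‖
            ≤ P * (κ * K) * h := by
          rw [norm_smul, Real.norm_eq_abs, abs_mul, abs_of_nonneg hh]
          have := hc.norm_psi_le M hMB hL hρ hh hhone hi (L c + N c)
          have h' := hc.norm_f
          calc _ ≤ |M.α i| * h * ((∑ k ∈ Finset.Icc 1 M.q, |M.p i k|) * (κ * K)) := by
                gcongr; exact this.trans (by gcongr)
            _ = _ := by rw [hP]; ring
        have h2 : ‖∑ j ∈ Finset.Ico 2 i, (M.a i j).eval (fun t x => jacFlow L N c t x) h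
            (linRem N c (M.stageAt L N h c j))‖ ≤ i * (Q * (κ * (2 * K * C))) := by
          refine (norm_sum_le_of_le (f := _) (n := fun _ => Q * (κ * (2 * K * C))) _
            fun j hj' => ?_).trans ?_
          · obtain ⟨hjs, hji⟩ := hj j hj'
            obtain ⟨g4, -, g3⟩ := H j hjs hji c c h hc hcη hh hhη
            have r2 := hc.norm_linRem_le hρ g4
            refine (hc.norm_eval_le hL hρ hMB.one_le hh hhone
              (M.a_admissible i hi j hj') (hMB.a_le i hi j hj') (hMB.a_size i hi j hj')
              _).trans ?_
            have r4 : ‖linRem N c (M.stageAt L N h c j)‖ ≤ 2 * K * C := by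
              refine r2.trans ?_
              have : 2 * K * ‖M.stageAt L N h c j - c‖ ≤ 2 * K * (C * 1) := by
                gcongr; exact g3.trans (by gcongr)
              linarith
            gcongr
          · rw [Finset.sum_const, nsmul_eq_mul]
            gcongr
        refine (norm_add_le _ _).trans ?_
        rw [hD₂, add_mul]
        refine add_le_add h1 ?_
        rw [norm_smul, Real.norm_eq_abs, abs_of_nonneg hh, mul_comm]
        gcongr
      have hC'w : ‖M.stageAt L N h w i - M.stageAt L N h c i‖ ≤ C' * ‖(w : X) - c‖ :=
        hdiff.trans (by gcongr)
      have hC'c : ‖M.stageAt L N h c i - c‖ ≤ C' * h := hsize.trans (by gcongr)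
      refine ⟨?_, hC'w, hC'c⟩
      rw [mem_ball_iff_norm]
      have hη' : min η (ρ / (2 * C' + 1) / 2) ≤ ρ / (2 * C' + 1) / 2 := min_le_right _ _
      have e : M.stageAt L N h w i - c = (M.stageAt L N h w i - M.stageAt L N h c i)
          + (M.stageAt L N h c i - c) := by abel
      rw [e]
      have h1 : C' * ‖(w : X) - c‖ ≤ C' * (ρ / (2 * C' + 1) / 2) := by gcongr; exact hw.trans hη'
      have h2 : C' * h ≤ C' * (ρ / (2 * C' + 1) / 2) := by gcongr; exact hh1.trans hη'
      have h3 : C' * (ρ / (2 * C' + 1) / 2) + C' * (ρ / (2 * C' + 1) / 2) < ρ := by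
        rw [← mul_add, add_halves, mul_div_assoc', div_lt_iff₀ (by positivity)]
        nlinarith [mul_nonneg hC'0 hρ.le]
      linarith [norm_add_le (M.stageAt L N h w i - M.stageAt L N h c i)
          (M.stageAt L N h c i - c)]
  obtain ⟨C, η, h1, h2, h3, h4, H⟩ := hind (M.s + 1)
  exact ⟨C, η, h1, h2, h3, h4, fun i hi => H i hi (Nat.lt_succ_of_le (Finset.mem_Icc.1 hi).2)⟩

/-- One step from a perturbed value: the perturbation is propagated by `e^{hJ}` up to terms of
size `h` times the perturbation. -/
theorem exists_step_stability [CompleteSpace X]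
    (M : EPIRK) (hM : M.CoeffRestriction) (hMB : M.Bounds Γ Q)
    (hL : GeneratesC0Semigroup L) (N : X → X) (hρ : 0 < ρ) (hρ1 : ρ ≤ 1) (K κ : ℝ)
    (hK : 0 ≤ K) (hκ : 0 ≤ κ) :
    ∃ C η : ℝ, 0 ≤ C ∧ 0 < η ∧ ∀ (c w : L.domain) (h : ℝ),
      PointBounds L N ρ K Γ κ c → ‖(w : X) - c‖ ≤ η → 0 ≤ h → h ≤ η →
      ‖M.step L N h w - M.step L N h c - jacFlow L N c h ((w : X) - c)‖
        ≤ C * h * ‖(w : X) - c‖ := by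
  obtain ⟨C, η, hC, hη, hη1, hηρ, H⟩ := exists_stage_bounds M hM hMB hL N hρ hρ1 K κ hK hκ
  have hQ := hMB.Q_nonneg
  have hΓ0 : 0 ≤ Γ := by linarith [hMB.one_le]
  set D := κ * (K + 1) + (κ * (2 * K + K * (K + 1)) + κ * Γ * (K + K * K))
    + M.s * (Q * (κ * (2 * K * C + 4 * K) + κ * Γ * (2 * K * C))) with hD
  refine ⟨D, η, by positivity, hη, fun c w h hc hw hh hhη => ?_⟩
  have hh1 := hhη.trans hη1
  have hwb : (w : X) ∈ Metric.ball (c : X) ρ := mem_ball_iff_norm.2 (hw.trans_lt hηρ)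
  have hcc := Metric.mem_ball_self (x := (c : X)) hρ
  have hcη : ‖(c : X) - c‖ ≤ η := by simpa using hη.le
  -- For `φ_1` the recurrence is exact with leading term `e^{hJ} v`; all of `L v` is absorbed there,
  -- and the rest is bounded and carries a factor `h`.
  have heq : ∀ v : L.domain, (v : X) + h • phi (fun t x => jacFlow L N v t x) 1 h (L v + N v)
      = jacFlow L N v h v + h • phi (fun t x => jacFlow L N v t x) 1 h (N v - fderiv ℝ N v v) := by
    intro v
    have := smul_phi_eq (w := v) (N := N) hL hh zero_lt_one 0
    simp only [zero_add, one_mul, Nat.factorial_zero, Nat.cast_one, div_one, one_smul, inv_one]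
      at this
    rw [this]
    simp only [phi]
    abel
  rw [M.step_eq, M.step_eq, heq, heq]
  have e : ∀ a b b' d d' f f' : X, a + d + f - (b + d' + f') - b'
      = (a - b - b') + (d - d') + (f - f') := by intros; abel
  rw [e, ← smul_sub, ← smul_sub, ← Finset.sum_sub_distrib]
  -- Only the change of semigroup remains here, and `flow_lip` supplies the factor `h`.
  have h1 : ‖jacFlow L N w h w - jacFlow L N c h c - jacFlow L N c h ((w : X) - c)‖
      ≤ κ * (K + 1) * h * ‖(w : X) - c‖ := by
    have e2 : jacFlow L N w h w - jacFlow L N c h c - jacFlow L N c h ((w : X) - c)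
        = (jacFlow L N w h - jacFlow L N c h) (w : X) := by
      simp only [map_sub, _root_.sub_apply]; abel
    rw [e2]
    refine (ContinuousLinearMap.le_of_opNorm_le _ (hc.flow_lip _ hwb _ hcc h
      ⟨hh, by linarith [hMB.one_le]⟩) _).trans ?_
    have := hc.norm_le hρ1 hwb
    calc _ ≤ κ * ‖(w : X) - c‖ * h * (K + 1) := by gcongr
      _ = _ := by ring
  have h2 : ‖h • (phi (fun t x => jacFlow L N w t x) 1 h (N w - fderiv ℝ N w w)
      - phi (fun t x => jacFlow L N c t x) 1 h (N c - fderiv ℝ N c c))‖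
      ≤ (κ * (2 * K + K * (K + 1)) + κ * Γ * (K + K * K)) * h * ‖(w : X) - c‖ := by
    rw [norm_smul, Real.norm_eq_abs, abs_of_nonneg hh]
    have g1 := hc.norm_phi_sub_le hL hρ hMB.one_le hwb hh hh1 zero_le_one hMB.one_le 1
        (N w - fderiv ℝ N w w) (N c - fderiv ℝ N c c)
    rw [one_mul] at g1
    have g2 := hc.norm_affine_sub_le hρ hρ1 hwb
    have g3 := hc.norm_affine_le hρ
    calc _ ≤ h * (κ * ((2 * K + K * (K + 1)) * ‖(w : X) - c‖)
          + κ * ‖(w : X) - c‖ * (Γ * 1) * (K + K * K)) := by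
            gcongr; exact g1.trans (by gcongr)
      _ = _ := by ring
  have h3 : ‖∑ j ∈ Finset.Icc 2 M.s, ((M.b j).eval (fun t x => jacFlow L N w t x) h
      (linRem N w (M.stageAt L N h w j)) - (M.b j).eval (fun t x => jacFlow L N c t x) h
      (linRem N c (M.stageAt L N h c j)))‖
      ≤ M.s * (Q * (κ * (2 * K * C + 4 * K) + κ * Γ * (2 * K * C)) * ‖(w : X) - c‖) := by
    refine (norm_sum_le_of_le (f := _) (n := fun _ =>
      Q * (κ * (2 * K * C + 4 * K) + κ * Γ * (2 * K * C)) * ‖(w : X) - c‖) _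
      fun j hj => ?_).trans ?_
    · obtain ⟨g1, g2, g3⟩ := H j hj c w h hc hw hh hhη
      obtain ⟨g4, -, -⟩ := H j hj c c h hc hcη hh hhη
      have r1 := hc.norm_linRem_sub_le hρ hρ1 hwb g1 g4
      have r2 := hc.norm_linRem_le hρ g4
      refine (hc.norm_eval_sub_le hL hρ hMB.one_le hwb hh hh1
        (M.b_admissible j hj) (hMB.b_le j hj) (hMB.b_size j hj) _ _).trans ?_
      have r3 : ‖linRem N w (M.stageAt L N h w j) - linRem N c (M.stageAt L N h c j)‖
          ≤ (2 * K * C + 4 * K) * ‖(w : X) - c‖ := by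
        refine r1.trans ?_
        have : 2 * K * ‖M.stageAt L N h w j - M.stageAt L N h c j‖
            ≤ 2 * K * (C * ‖(w : X) - c‖) := by gcongr
        linarith
      have r4 : ‖linRem N c (M.stageAt L N h c j)‖ ≤ 2 * K * C := by
        refine r2.trans ?_
        have : 2 * K * ‖M.stageAt L N h c j - c‖ ≤ 2 * K * (C * 1) := by
          gcongr; exact g3.trans (by gcongr)
        linarith
      calc _ ≤ Q * (κ * ((2 * K * C + 4 * K) * ‖(w : X) - c‖)
            + κ * ‖(w : X) - c‖ * (Γ * 1) * (2 * K * C)) := by gcongr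
        _ = _ := by ring
    · rw [Finset.sum_const, nsmul_eq_mul]
      have hcard : ((Finset.Icc 2 M.s).card : ℝ) ≤ M.s := by
        rw [Nat.card_Icc]; exact_mod_cast (by omega : M.s + 1 - 2 ≤ M.s)
      gcongr
  have h4 : ‖h • ∑ j ∈ Finset.Icc 2 M.s, ((M.b j).eval (fun t x => jacFlow L N w t x) h
      (linRem N w (M.stageAt L N h w j)) - (M.b j).eval (fun t x => jacFlow L N c t x) h
      (linRem N c (M.stageAt L N h c j)))‖
      ≤ h * (M.s * (Q * (κ * (2 * K * C + 4 * K) + κ * Γ * (2 * K * C)) * ‖(w : X) - c‖)) := by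
    rw [norm_smul, Real.norm_eq_abs, abs_of_nonneg hh]
    gcongr
  refine (norm_add_le _ _).trans ((add_le_add ((norm_add_le _ _).trans
    (add_le_add h1 h2)) h4).trans (le_of_eq ?_))
  rw [hD]; ring

end PointBounds

end StepStability

set_option maxSynthPendingDepth 3

/-! ### Taylor's formula for chains of derivatives. -/

section Taylor

variable {E : Type*} [NormedAddCommGroup E] [NormedSpace ℝ E]

/-- Taylor's formula for a chain of functions `F 0, F 1, …` with `(F k)' = F (k + 1)`. -/
theorem taylor_chain {a C : ℝ} (hC : 0 ≤ C) (n : ℕ) : ∀ (F : ℕ → ℝ → E),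
    (∀ k < n, ∀ s ∈ Icc 0 a, HasDerivWithinAt (F k) (F (k + 1) s) (Icc 0 a) s) →
    (∀ s ∈ Icc 0 a, ‖F n s‖ ≤ C) → ∀ s ∈ Icc 0 a,
    ‖F 0 s - ∑ k ∈ Finset.range n, (s ^ k / (k ! : ℝ)) • F k 0‖ ≤ C * s ^ n := by
  induction n with
  | zero => intro F _ hb s hs; simpa using hb s hs
  | succ n ih =>
    intro F hF hb s hs
    have h1 := ih (fun k => F (k + 1)) (fun k hk => hF (k + 1) (by omega)) hb
    have hsub : Icc 0 s ⊆ Icc 0 a := Icc_subset_Icc_right hs.2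
    have hpoly : ∀ r : ℝ, HasDerivAt
        (fun r : ℝ => ∑ k ∈ Finset.range (n + 1), (r ^ k / (k ! : ℝ)) • F k 0)
        (∑ k ∈ Finset.range n, (r ^ k / (k ! : ℝ)) • F (k + 1) 0) r := by
      intro r
      have : ∀ k ∈ Finset.range (n + 1), HasDerivAt (fun r : ℝ => (r ^ k / (k ! : ℝ)) • F k 0)
          ((k * r ^ (k - 1) / (k ! : ℝ)) • F k 0) r := fun k _ =>
        ((hasDerivAt_pow k r).div_const _).smul_const _
      refine (HasDerivAt.fun_sum this).congr_deriv ?_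
      rw [Finset.sum_range_succ']
      simp only [Nat.cast_zero, zero_mul, zero_div, zero_smul, add_zero]
      refine Finset.sum_congr rfl fun k _ => ?_
      congr 1
      rw [Nat.factorial_succ]; push_cast
      have : (k ! : ℝ) ≠ 0 := by positivity
      field_simp
    -- The mean value inequality on `[0, s]` gains one power of `s`; the factor `1 / n!` of the
    -- sharp remainder is given away.
    have h2 := (convex_Icc (0 : ℝ) s).norm_image_sub_le_of_norm_hasDerivWithin_le
      (f := fun r => F 0 r - ∑ k ∈ Finset.range (n + 1), (r ^ k / (k ! : ℝ)) • F k 0)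
      (f' := fun r => F 1 r - ∑ k ∈ Finset.range n, (r ^ k / (k ! : ℝ)) • F (k + 1) 0)
      (C := C * s ^ n)
      (fun r hr => ((hF 0 (by omega) r (hsub hr)).mono hsub).sub (hpoly r).hasDerivWithinAt)
      (fun r hr => (h1 r (hsub hr)).trans (by
        have := hr.1; have := hr.2
        gcongr)) (left_mem_Icc.2 hs.1) (right_mem_Icc.2 hs.1)
    have h0 : F 0 0 - ∑ k ∈ Finset.range (n + 1), ((0 : ℝ) ^ k / (k ! : ℝ)) • F k 0 = 0 := by
      rw [Finset.sum_range_succ']; simp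
    simp only [h0, sub_zero] at h2
    refine h2.trans (le_of_eq ?_)
    rw [Real.norm_eq_abs, abs_of_nonneg hs.1]; ring

end Taylor

/-! ### Taylor's formula for `N` on balls, and curried derivatives. -/

section Remainder

variable {X : Type*} [NormedAddCommGroup X] [NormedSpace ℝ X] {N : X → X} {c V : X} {ρ K : ℝ}

/-- Regularity of `N` on a ball: the derivatives up to order `n` exist and are bounded by `K`. -/
structure SmoothOnBall (N : X → X) (c : X) (ρ K : ℝ) (n : ℕ) : Prop where
  diff : ∀ k < n, DifferentiableOn ℝ (iteratedFDeriv ℝ k N) (Metric.ball c ρ)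
  bound : ∀ k ≤ n, ∀ v ∈ Metric.ball c ρ, ‖iteratedFDeriv ℝ k N v‖ ≤ K

theorem SmoothOnBall.mono {m n : ℕ} (hN : SmoothOnBall N c ρ K n) (hmn : m ≤ n) :
    SmoothOnBall N c ρ K m :=
  ⟨fun k hk => hN.diff k (hk.trans_le hmn), fun k hk => hN.bound k (hk.trans hmn)⟩

/-- Taylor's formula for `N` on a ball. -/
theorem SmoothOnBall.norm_sub_taylor_le {n : ℕ} (hN : SmoothOnBall N c ρ K n) (hV : ‖V‖ < ρ) :
    ‖N (c + V) - ∑ k ∈ Finset.range n, (1 / (k ! : ℝ)) • iteratedFDeriv ℝ k N c (fun _ => V)‖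
      ≤ K * ‖V‖ ^ n := by
  have hρ : 0 < ρ := (norm_nonneg _).trans_lt hV
  have hball : ∀ s ∈ Icc (0 : ℝ) 1, c + s • V ∈ Metric.ball c ρ := by
    intro s hs
    rw [mem_ball_iff_norm, add_sub_cancel_left, norm_smul, Real.norm_eq_abs, abs_of_nonneg hs.1]
    exact (mul_le_of_le_one_left (norm_nonneg _) hs.2).trans_lt hV
  have hK : 0 ≤ K := (norm_nonneg _).trans (hN.bound n le_rfl c (Metric.mem_ball_self hρ))
  have h := taylor_chain (a := 1) (C := K * ‖V‖ ^ n) (by positivity) n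
    (fun k s => iteratedFDeriv ℝ k N (c + s • V) (fun _ => V))
    (fun k hk s hs => by
      have h1 := ((hN.diff k hk).differentiableAt
        (Metric.isOpen_ball.mem_nhds (hball s hs))).hasFDerivAt
      have h2 : HasDerivAt (fun s : ℝ => c + s • V) V s := by
        simpa using ((hasDerivAt_id s).smul_const V).const_add c
      have h3 := (ContinuousMultilinearMap.apply ℝ (fun _ : Fin k => X) X
        (fun _ => V)).hasFDerivAt.comp_hasDerivAt s (h1.comp_hasDerivAt s h2)
      exact h3.hasDerivWithinAt)
    (fun s hs => by
      refine ((iteratedFDeriv ℝ n N (c + s • V)).le_opNorm _).trans ?_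
      rw [Finset.prod_const, Finset.card_univ, Fintype.card_fin]
      gcongr
      exact hN.bound n le_rfl _ (hball s hs)) 1 ⟨zero_le_one, le_rfl⟩
  simpa using h

/-- The curried form of a bilinear map. -/
noncomputable def curryTwo : (X [×2]→L[ℝ] X) →L[ℝ] X →L[ℝ] X →L[ℝ] X :=
  (ContinuousLinearMap.compL ℝ X (X [×1]→L[ℝ] X) (X →L[ℝ] X)
    (continuousMultilinearCurryFin1 ℝ X X : (X [×1]→L[ℝ] X) →L[ℝ] (X →L[ℝ] X))).comp
    (continuousMultilinearCurryLeftEquiv ℝ (fun _ : Fin 2 => X) X :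
      (X [×2]→L[ℝ] X) →L[ℝ] (X →L[ℝ] (X [×1]→L[ℝ] X)))

/-- The curried form of a trilinear map. -/
noncomputable def curryThree : (X [×3]→L[ℝ] X) →L[ℝ] X →L[ℝ] X →L[ℝ] X →L[ℝ] X :=
  (ContinuousLinearMap.compL ℝ X (X [×2]→L[ℝ] X) (X →L[ℝ] X →L[ℝ] X) curryTwo).comp
    (continuousMultilinearCurryLeftEquiv ℝ (fun _ : Fin 3 => X) X :
      (X [×3]→L[ℝ] X) →L[ℝ] (X →L[ℝ] (X [×2]→L[ℝ] X)))

theorem curryTwo_self (f : X [×2]→L[ℝ] X) (V : X) : curryTwo f V V = f (fun _ => V) := by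
  change f (Fin.cons V (Fin.snoc 0 V)) = _
  congr 1
  ext i; fin_cases i <;> rfl

theorem curryThree_self (f : X [×3]→L[ℝ] X) (V : X) : curryThree f V V V = f (fun _ => V) := by
  change f (Fin.cons V (Fin.cons V (Fin.snoc 0 V))) = _
  congr 1
  ext i; fin_cases i <;> rfl

end Remainder

/-- `f = O(h^k)`, uniformly over the index set. -/
def UniformO {ι E : Type*} [NormedAddCommGroup E] (h : ι → ℝ) (k : ℕ) (f : ι → E) : Prop :=
  ∃ C, ∀ i, ‖f i‖ ≤ C * h i ^ k

/-! ### Calculus of uniform `O(h^k)` estimates. -/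

namespace UniformO

variable {ι E F : Type*} [NormedAddCommGroup E] [NormedAddCommGroup F]
  {h : ι → ℝ} {j k : ℕ} {f g : ι → E}

theorem exists_nonneg (hh : ∀ i, 0 ≤ h i) (hf : UniformO h k f) :
    ∃ C, 0 ≤ C ∧ ∀ i, ‖f i‖ ≤ C * h i ^ k := by
  obtain ⟨C, hC⟩ := hf
  exact ⟨|C|, abs_nonneg C, fun i => (hC i).trans
    (mul_le_mul_of_nonneg_right (le_abs_self C) (pow_nonneg (hh i) k))⟩

theorem congr (hf : UniformO h k f) (hfg : ∀ i, g i = f i) : UniformO h k g := by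
  obtain ⟨C, hC⟩ := hf
  exact ⟨C, fun i => by rw [hfg]; exact hC i⟩

theorem add (hf : UniformO h k f) (hg : UniformO h k g) : UniformO h k fun i => f i + g i := by
  obtain ⟨C, hC⟩ := hf
  obtain ⟨D, hD⟩ := hg
  exact ⟨C + D, fun i => (norm_add_le _ _).trans (by linarith [hC i, hD i])⟩

theorem neg (hf : UniformO h k f) : UniformO h k fun i => -f i := by
  obtain ⟨C, hC⟩ := hf
  exact ⟨C, fun i => by rw [norm_neg]; exact hC i⟩

theorem sub (hf : UniformO h k f) (hg : UniformO h k g) : UniformO h k fun i => f i - g i := by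
  simpa only [sub_eq_add_neg] using hf.add hg.neg

theorem zero : UniformO h k fun _ : ι => (0 : E) := ⟨0, fun _ => by simp⟩

theorem sum {κ : Type*} (s : Finset κ) {f : κ → ι → E} (hf : ∀ a ∈ s, UniformO h k (f a)) :
    UniformO h k fun i => ∑ a ∈ s, f a i := by
  classical
  induction s using Finset.induction_on with
  | empty => simpa using zero
  | insert a s ha ih =>
    refine ((hf a (by simp)).add (ih fun b hb => hf b (by simp [hb]))).congr fun i => ?_
    rw [Finset.sum_insert ha]

theorem mono (hh : ∀ i, 0 ≤ h i) (hh1 : ∀ i, h i ≤ 1) (hf : UniformO h k f) (hjk : j ≤ k) :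
    UniformO h j f := by
  obtain ⟨C, hC0, hC⟩ := hf.exists_nonneg hh
  exact ⟨C, fun i => (hC i).trans (mul_le_mul_of_nonneg_left
    (pow_le_pow_of_le_one (hh i) (hh1 i) hjk) hC0)⟩

/-- Operators given as functions with a uniform bound. -/
theorem map {T : ι → E → F} {κ : ℝ} (hκ : 0 ≤ κ) (hT : ∀ i x, ‖T i x‖ ≤ κ * ‖x‖)
    (hf : UniformO h k f) : UniformO h k fun i => T i (f i) := by
  obtain ⟨C, hC⟩ := hf
  exact ⟨κ * C, fun i => (hT i _).trans (by
    rw [mul_assoc]; exact mul_le_mul_of_nonneg_left (hC i) hκ)⟩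

variable [NormedSpace ℝ E] [NormedSpace ℝ F]

theorem const_smul (r : ℝ) (hf : UniformO h k f) : UniformO h k fun i => r • f i := by
  obtain ⟨C, hC⟩ := hf
  refine ⟨|r| * C, fun i => ?_⟩
  rw [norm_smul, Real.norm_eq_abs, mul_assoc]
  exact mul_le_mul_of_nonneg_left (hC i) (abs_nonneg r)

theorem pow_smul (hh : ∀ i, 0 ≤ h i) (hf : UniformO h k f) (j : ℕ) :
    UniformO h (j + k) fun i => h i ^ j • f i := by
  obtain ⟨C, hC⟩ := hf
  refine ⟨C, fun i => ?_⟩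
  rw [norm_smul, Real.norm_eq_abs, abs_of_nonneg (pow_nonneg (hh i) j), pow_add]
  calc h i ^ j * ‖f i‖ ≤ h i ^ j * (C * h i ^ k) :=
        mul_le_mul_of_nonneg_left (hC i) (pow_nonneg (hh i) j)
    _ = _ := by ring

theorem clm_apply (hh : ∀ i, 0 ≤ h i) {T : ι → E →L[ℝ] F} (hT : UniformO h j T)
    (hf : UniformO h k f) : UniformO h (j + k) fun i => T i (f i) := by
  obtain ⟨C, hC0, hC⟩ := hT.exists_nonneg hh
  obtain ⟨D, hD⟩ := hf
  refine ⟨C * D, fun i => ((T i).le_opNorm _).trans ?_⟩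
  rw [pow_add]
  have h1 := pow_nonneg (hh i) j
  calc ‖T i‖ * ‖f i‖ ≤ (C * h i ^ j) * (D * h i ^ k) :=
        mul_le_mul (hC i) (hD i) (norm_nonneg _) (by positivity)
    _ = _ := by ring

theorem const_clm (T : E →L[ℝ] F) (hf : UniformO h k f) : UniformO h k fun i => T (f i) := by
  obtain ⟨C, hC⟩ := hf
  exact ⟨‖T‖ * C, fun i => (T.le_opNorm _).trans (by
    rw [mul_assoc]; exact mul_le_mul_of_nonneg_left (hC i) (norm_nonneg _))⟩

end UniformO

/-! ### Expansions of bilinear, trilinear and multilinear expressions. -/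

section MultilinearExpansion

variable {ι X : Type*} [NormedAddCommGroup X] [NormedSpace ℝ X] {h : ι → ℝ}
  {A B D V : ι → X}

theorem UniformO.bilin (hh : ∀ i, 0 ≤ h i) (hh1 : ∀ i, h i ≤ 1) {N₂ : ι → X →L[ℝ] X →L[ℝ] X}
    (hN : UniformO h 0 N₂) {j k n : ℕ} {f g : ι → X} (hn : n ≤ j + k) (hf : UniformO h j f)
    (hg : UniformO h k g) : UniformO h n fun i => N₂ i (f i) (g i) :=
  ((hN.clm_apply hh hf).clm_apply hh hg).mono hh hh1 (by omega)

theorem UniformO.trilin (hh : ∀ i, 0 ≤ h i) (hh1 : ∀ i, h i ≤ 1)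
    {N₃ : ι → X →L[ℝ] X →L[ℝ] X →L[ℝ] X} (hN : UniformO h 0 N₃) {j k l n : ℕ} {f g e : ι → X}
    (hn : n ≤ j + k + l) (hf : UniformO h j f) (hg : UniformO h k g) (he : UniformO h l e) :
    UniformO h n fun i => N₃ i (f i) (g i) (e i) :=
  (((hN.clm_apply hh hf).clm_apply hh hg).clm_apply hh he).mono hh hh1 (by omega)

/-- This and the following expansions telescope: with the approximation `W` of `V`, the difference
`N₂ V V - N₂ W W` is `N₂ (V - W) V + N₂ W (V - W)`, and the surplus products in `N₂ W W` are of
higher order. Symmetry of the derivatives is not used, so mixed terms occur in every order. -/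
theorem bilin_expansion_one (hh : ∀ i, 0 ≤ h i) (hh1 : ∀ i, h i ≤ 1)
    {N₂ : ι → X →L[ℝ] X →L[ℝ] X} (hN : UniformO h 0 N₂) (hA : UniformO h 0 A)
    (hV1 : UniformO h 1 V) (hV : UniformO h 2 fun i => V i - h i • A i) :
    UniformO h 3 fun i => N₂ i (V i) (V i) - h i ^ 2 • N₂ i (A i) (A i) := by
  have hA1 : UniformO h 1 fun i => h i ^ 1 • A i := hA.pow_smul hh 1
  refine ((hN.bilin hh hh1 (by norm_num) hV hV1).add (hN.bilin hh hh1 (by norm_num) hA1 hV)).congr fun i => ?_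
  simp only [map_sub, map_smul, _root_.sub_apply, _root_.smul_apply, pow_one]
  module

theorem bilin_expansion_two (hh : ∀ i, 0 ≤ h i) (hh1 : ∀ i, h i ≤ 1)
    {N₂ : ι → X →L[ℝ] X →L[ℝ] X} (hN : UniformO h 0 N₂) (hA : UniformO h 0 A)
    (hB : UniformO h 0 B) (hV1 : UniformO h 1 V)
    (hV : UniformO h 3 fun i => V i - (h i • A i + h i ^ 2 • B i)) :
    UniformO h 4 fun i => N₂ i (V i) (V i) - (h i ^ 2 • N₂ i (A i) (A i)
      + h i ^ 3 • (N₂ i (A i) (B i) + N₂ i (B i) (A i))) := by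
  have hA1 : UniformO h 1 fun i => h i ^ 1 • A i := hA.pow_smul hh 1
  have hB2 : UniformO h 2 fun i => h i ^ 2 • B i := hB.pow_smul hh 2
  have hAB : UniformO h 1 fun i => h i ^ 1 • A i + h i ^ 2 • B i :=
    hA1.add (hB2.mono hh hh1 (by norm_num))
  refine (((hN.bilin hh hh1 (by norm_num) hV hV1).add (hN.bilin hh hh1 (by norm_num) hAB hV)).add (hN.bilin hh hh1 (by norm_num) hB2 hB2)).congr
    fun i => ?_
  simp only [map_sub, map_add, map_smul, _root_.sub_apply, _root_.add_apply, _root_.smul_apply,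
    pow_one]
  module

theorem bilin_expansion_three (hh : ∀ i, 0 ≤ h i) (hh1 : ∀ i, h i ≤ 1)
    {N₂ : ι → X →L[ℝ] X →L[ℝ] X} (hN : UniformO h 0 N₂) (hA : UniformO h 0 A)
    (hB : UniformO h 0 B) (hD : UniformO h 0 D) (hV1 : UniformO h 1 V)
    (hV : UniformO h 4 fun i => V i - (h i • A i + h i ^ 2 • B i + h i ^ 3 • D i)) :
    UniformO h 5 fun i => N₂ i (V i) (V i) - (h i ^ 2 • N₂ i (A i) (A i)
      + h i ^ 3 • (N₂ i (A i) (B i) + N₂ i (B i) (A i))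
      + h i ^ 4 • (N₂ i (B i) (B i) + N₂ i (A i) (D i) + N₂ i (D i) (A i))) := by
  have hA1 : UniformO h 1 fun i => h i ^ 1 • A i := hA.pow_smul hh 1
  have hB2 : UniformO h 2 fun i => h i ^ 2 • B i := hB.pow_smul hh 2
  have hD3 : UniformO h 3 fun i => h i ^ 3 • D i := hD.pow_smul hh 3
  have hABD : UniformO h 1 fun i => h i ^ 1 • A i + h i ^ 2 • B i + h i ^ 3 • D i :=
    (hA1.add (hB2.mono hh hh1 (by norm_num))).add (hD3.mono hh hh1 (by norm_num))
  refine (((((hN.bilin hh hh1 (by norm_num) hV hV1).add (hN.bilin hh hh1 (by norm_num) hABD hV)).add (hN.bilin hh hh1 (by norm_num) hB2 hD3)).add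
    (hN.bilin hh hh1 (by norm_num) hD3 hB2)).add (hN.bilin hh hh1 (by norm_num) hD3 hD3)).congr fun i => ?_
  simp only [map_sub, map_add, map_smul, _root_.sub_apply, _root_.add_apply, _root_.smul_apply,
    pow_one]
  module

theorem trilin_expansion_one (hh : ∀ i, 0 ≤ h i) (hh1 : ∀ i, h i ≤ 1)
    {N₃ : ι → X →L[ℝ] X →L[ℝ] X →L[ℝ] X} (hN : UniformO h 0 N₃) (hA : UniformO h 0 A)
    (hV1 : UniformO h 1 V) (hV : UniformO h 2 fun i => V i - h i • A i) :
    UniformO h 4 fun i => N₃ i (V i) (V i) (V i) - h i ^ 3 • N₃ i (A i) (A i) (A i) := by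
  have hA1 : UniformO h 1 fun i => h i ^ 1 • A i := hA.pow_smul hh 1
  refine (((hN.trilin hh hh1 (by norm_num) hV hV1 hV1).add (hN.trilin hh hh1 (by norm_num) hA1 hV hV1)).add
    (hN.trilin hh hh1 (by norm_num) hA1 hA1 hV)).congr fun i => ?_
  simp only [map_sub, map_smul, _root_.sub_apply, _root_.smul_apply, pow_one]
  module

theorem trilin_expansion_two (hh : ∀ i, 0 ≤ h i) (hh1 : ∀ i, h i ≤ 1)
    {N₃ : ι → X →L[ℝ] X →L[ℝ] X →L[ℝ] X} (hN : UniformO h 0 N₃) (hA : UniformO h 0 A)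
    (hB : UniformO h 0 B) (hV1 : UniformO h 1 V)
    (hV : UniformO h 3 fun i => V i - (h i • A i + h i ^ 2 • B i)) :
    UniformO h 5 fun i => N₃ i (V i) (V i) (V i) - (h i ^ 3 • N₃ i (A i) (A i) (A i)
      + h i ^ 4 • (N₃ i (A i) (A i) (B i) + N₃ i (A i) (B i) (A i) + N₃ i (B i) (A i) (A i))) := by
  have hA1 : UniformO h 1 fun i => h i ^ 1 • A i := hA.pow_smul hh 1
  have hB2 : UniformO h 2 fun i => h i ^ 2 • B i := hB.pow_smul hh 2
  have hAB : UniformO h 1 fun i => h i ^ 1 • A i + h i ^ 2 • B i :=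
    hA1.add (hB2.mono hh hh1 (by norm_num))
  refine (((((((hN.trilin hh hh1 (by norm_num) hV hV1 hV1).add (hN.trilin hh hh1 (by norm_num) hAB hV hV1)).add
    (hN.trilin hh hh1 (by norm_num) hAB hAB hV)).add (hN.trilin hh hh1 (by norm_num) hA1 hB2 hB2)).add
    (hN.trilin hh hh1 (by norm_num) hB2 hA1 hB2)).add (hN.trilin hh hh1 (by norm_num) hB2 hB2 hA1)).add
    (hN.trilin hh hh1 (by norm_num) hB2 hB2 hB2)).congr fun i => ?_
  simp only [map_sub, map_add, map_smul, _root_.sub_apply, _root_.add_apply, _root_.smul_apply,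
    pow_one]
  module

/-- Only the leading term is needed, so the Lipschitz estimate for multilinear maps on a ball of
radius `O(h)` replaces the telescoping. -/
theorem multilin_expansion_one (hh : ∀ i, 0 ≤ h i) {n : ℕ}
    {f : ι → X [×(n + 1)]→L[ℝ] X} (hf : UniformO h 0 f) (hA : UniformO h 0 A)
    (hV1 : UniformO h 1 V) (hV : UniformO h 2 fun i => V i - h i • A i) :
    UniformO h (n + 2) fun i => f i (fun _ => V i) - h i ^ (n + 1) • f i (fun _ => A i) := by
  obtain ⟨F, hF0, hF⟩ := hf.exists_nonneg hh
  obtain ⟨a, ha0, ha⟩ := hA.exists_nonneg hh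
  obtain ⟨v, hv0, hv⟩ := hV1.exists_nonneg hh
  obtain ⟨e, he0, he⟩ := hV.exists_nonneg hh
  refine ⟨F * (n + 1) * (v + a) ^ n * e, fun i => ?_⟩
  have h0 := hh i
  have e1 : h i ^ (n + 1) • f i (fun _ => A i) = f i (fun _ => h i • A i) := by
    have := (f i).map_smul_univ (fun _ => h i) (fun _ => A i)
    simpa using this.symm
  change ‖f i (fun _ => V i) - h i ^ (n + 1) • f i (fun _ => A i)‖ ≤ _
  rw [e1]
  refine ((f i).norm_image_sub_le _ _).trans ?_
  have hpi : ∀ z : X, ‖(fun _ : Fin (n + 1) => z)‖ = ‖z‖ := fun z => pi_norm_const z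
  have hsub : (fun _ : Fin (n + 1) => V i) - (fun _ => h i • A i) = fun _ => V i - h i • A i := rfl
  rw [hsub, hpi, hpi, hpi, Fintype.card_fin, Nat.add_sub_cancel]
  have hF' := hF i
  have ha' := ha i
  have hv' := hv i
  have he' := he i
  rw [pow_zero, mul_one] at hF' ha'
  rw [pow_one] at hv'
  have hmax : max ‖V i‖ ‖h i • A i‖ ≤ (v + a) * h i := by
    refine max_le (hv'.trans (by nlinarith)) ?_
    rw [norm_smul, Real.norm_eq_abs, abs_of_nonneg h0]
    nlinarith
  calc ‖f i‖ * ((n + 1 : ℕ) : ℝ) * max ‖V i‖ ‖h i • A i‖ ^ n * ‖V i - h i • A i‖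
      ≤ F * ((n + 1 : ℕ) : ℝ) * ((v + a) * h i) ^ n * (e * h i ^ 2) := by gcongr
    _ = _ := by rw [mul_pow]; push_cast; ring

end MultilinearExpansion

/-! ### Expansion of the remainder `r` in powers of the step size. -/

section LinRemExpansion

variable {ι X : Type*} [NormedAddCommGroup X] [NormedSpace ℝ X] {N : X → X} {ρ K : ℝ}

/-- The second derivative as a bilinear map. -/
noncomputable def secondDeriv (N : X → X) (c : X) : X →L[ℝ] X →L[ℝ] X :=
  curryTwo (iteratedFDeriv ℝ 2 N c)

/-- The third derivative as a trilinear map. -/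
noncomputable def thirdDeriv (N : X → X) (c : X) : X →L[ℝ] X →L[ℝ] X →L[ℝ] X :=
  curryThree (iteratedFDeriv ℝ 3 N c)

/-- The coefficient of `h ^ 2` in `linRem N c (c + h A + ⋯)`. -/
noncomputable def quadTerm (N : X → X) (c A : X) : X := (1 / 2 : ℝ) • secondDeriv N c A A

/-- The coefficient of `h ^ 3` in `linRem N c (c + h A + h ^ 2 B + ⋯)`. -/
noncomputable def cubicTerm (N : X → X) (c A B : X) : X :=
  (1 / 2 : ℝ) • (secondDeriv N c A B + secondDeriv N c B A)
    + (1 / 6 : ℝ) • thirdDeriv N c A A A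

/-- The coefficient of `h ^ 4` in `linRem N c (c + h A + h ^ 2 B + h ^ 3 D + ⋯)`. -/
noncomputable def quarticTerm (N : X → X) (c A B D : X) : X :=
  (1 / 2 : ℝ) • (secondDeriv N c B B + secondDeriv N c A D + secondDeriv N c D A)
    + (1 / 6 : ℝ) • (thirdDeriv N c A A B + thirdDeriv N c A B A + thirdDeriv N c B A A)
    + (1 / 24 : ℝ) • iteratedFDeriv ℝ 4 N c (fun _ => A)

/-- The remainder `r` is `N` without its Taylor terms of order `0` and `1`, whence the shift of the
index by two. -/
theorem linRem_add_sub_taylor {n : ℕ} (c V : X) :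
    linRem N c (c + V) - ∑ k ∈ Finset.range n, (1 / ((k + 2) ! : ℝ)) •
        iteratedFDeriv ℝ (k + 2) N c (fun _ => V)
      = N (c + V) - ∑ k ∈ Finset.range (n + 2), (1 / (k ! : ℝ)) •
        iteratedFDeriv ℝ k N c (fun _ => V) := by
  have e1 : (1 / ((0 + 1) ! : ℝ)) • iteratedFDeriv ℝ (0 + 1) N c (fun _ => V) = fderiv ℝ N c V := by
    rw [zero_add, iteratedFDeriv_one_apply]; simp
  rw [Finset.sum_range_succ' _ (n + 1), Finset.sum_range_succ' _ n, linRem, add_sub_cancel_left,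
    e1]
  simp only [Nat.factorial_zero, Nat.cast_one, div_one, one_smul, iteratedFDeriv_zero_apply]
  abel

variable {h : ι → ℝ} {c A B D V : ι → X}

theorem SmoothOnBall.uniformO_taylor {n : ℕ} (hN : ∀ i, SmoothOnBall N (c i) ρ K (n + 2))
    (hh : ∀ i, 0 ≤ h i) (hVρ : ∀ i, ‖V i‖ < ρ) (hV1 : UniformO h 1 V) :
    UniformO h (n + 2) fun i => linRem N (c i) (c i + V i) - ∑ k ∈ Finset.range n,
      (1 / ((k + 2) ! : ℝ)) • iteratedFDeriv ℝ (k + 2) N (c i) (fun _ => V i) := by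
  obtain ⟨v, hv0, hv⟩ := hV1.exists_nonneg hh
  refine ⟨|K| * v ^ (n + 2), fun i => ?_⟩
  have h0 := hh i
  change ‖linRem N (c i) (c i + V i) - ∑ k ∈ Finset.range n, (1 / ((k + 2) ! : ℝ)) •
    iteratedFDeriv ℝ (k + 2) N (c i) (fun _ => V i)‖ ≤ _
  rw [linRem_add_sub_taylor]
  refine ((hN i).norm_sub_taylor_le (hVρ i)).trans ?_
  have hvi := hv i
  rw [pow_one] at hvi
  calc K * ‖V i‖ ^ (n + 2) ≤ |K| * (v * h i) ^ (n + 2) := by gcongr; exact le_abs_self K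
    _ = _ := by rw [mul_pow]; ring

theorem SmoothOnBall.uniformO_deriv {n k : ℕ} (hN : ∀ i, SmoothOnBall N (c i) ρ K n) (hρ : 0 < ρ)
    (hk : k ≤ n) : UniformO h 0 fun i => iteratedFDeriv ℝ k N (c i) :=
  ⟨K, fun i => by simpa using (hN i).bound k hk _ (Metric.mem_ball_self hρ)⟩

theorem SmoothOnBall.uniformO_secondDeriv {n : ℕ} (hN : ∀ i, SmoothOnBall N (c i) ρ K n)
    (hρ : 0 < ρ) (hn : 2 ≤ n) : UniformO h 0 fun i => secondDeriv N (c i) :=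
  (uniformO_deriv hN hρ hn).const_clm curryTwo

theorem SmoothOnBall.uniformO_thirdDeriv {n : ℕ} (hN : ∀ i, SmoothOnBall N (c i) ρ K n)
    (hρ : 0 < ρ) (hn : 3 ≤ n) : UniformO h 0 fun i => thirdDeriv N (c i) :=
  (uniformO_deriv hN hρ hn).const_clm curryThree

/-- The remainder starts quadratically and `V = O(h)`, so an error `O(h^k)` in `V` costs only
`O(h^{k+1})`: the stages need one order less than the remainder. The same holds for the next two
expansions. -/
theorem linRem_expansion_two (hN : ∀ i, SmoothOnBall N (c i) ρ K 3) (hρ : 0 < ρ)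
    (hh : ∀ i, 0 ≤ h i) (hh1 : ∀ i, h i ≤ 1) (hVρ : ∀ i, ‖V i‖ < ρ) (hA : UniformO h 0 A)
    (hV1 : UniformO h 1 V) (hV : UniformO h 2 fun i => V i - h i • A i) :
    UniformO h 3 fun i => linRem N (c i) (c i + V i) - h i ^ 2 • quadTerm N (c i) (A i) := by
  have h2 := (bilin_expansion_one hh hh1 (SmoothOnBall.uniformO_secondDeriv hN hρ (by norm_num))
    hA hV1 hV).const_smul (1 / 2)
  refine ((SmoothOnBall.uniformO_taylor (n := 1) hN hh hVρ hV1).add h2).congr fun i => ?_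
  simp only [Finset.sum_range_one, zero_add, quadTerm, secondDeriv, curryTwo_self,
    Nat.factorial_two, Nat.cast_ofNat]
  module

theorem linRem_expansion_three (hN : ∀ i, SmoothOnBall N (c i) ρ K 4) (hρ : 0 < ρ)
    (hh : ∀ i, 0 ≤ h i) (hh1 : ∀ i, h i ≤ 1) (hVρ : ∀ i, ‖V i‖ < ρ) (hA : UniformO h 0 A)
    (hB : UniformO h 0 B) (hV1 : UniformO h 1 V)
    (hV : UniformO h 3 fun i => V i - (h i • A i + h i ^ 2 • B i)) :
    UniformO h 4 fun i => linRem N (c i) (c i + V i) - (h i ^ 2 • quadTerm N (c i) (A i)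
      + h i ^ 3 • cubicTerm N (c i) (A i) (B i)) := by
  have hV' : UniformO h 2 fun i => V i - h i • A i :=
    ((hV.mono hh hh1 (by norm_num)).add ((hB.pow_smul hh 2).mono hh hh1 (by norm_num))).congr
      fun i => by abel
  have h2 := (bilin_expansion_two hh hh1 (SmoothOnBall.uniformO_secondDeriv hN hρ (by norm_num))
    hA hB hV1 hV).const_smul (1 / 2)
  have h3 := (trilin_expansion_one hh hh1 (SmoothOnBall.uniformO_thirdDeriv hN hρ (by norm_num))
    hA hV1 hV').const_smul (1 / 6)
  refine (((SmoothOnBall.uniformO_taylor (n := 2) hN hh hVρ hV1).add h2).add h3).congr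
    fun i => ?_
  simp only [Finset.sum_range_succ, Finset.sum_range_zero, zero_add, quadTerm, cubicTerm,
    secondDeriv, thirdDeriv, curryTwo_self, curryThree_self, Nat.factorial, Nat.reduceAdd]
  module

theorem linRem_expansion_four (hN : ∀ i, SmoothOnBall N (c i) ρ K 5) (hρ : 0 < ρ)
    (hh : ∀ i, 0 ≤ h i) (hh1 : ∀ i, h i ≤ 1) (hVρ : ∀ i, ‖V i‖ < ρ) (hA : UniformO h 0 A)
    (hB : UniformO h 0 B) (hD : UniformO h 0 D) (hV1 : UniformO h 1 V)
    (hV : UniformO h 4 fun i => V i - (h i • A i + h i ^ 2 • B i + h i ^ 3 • D i)) :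
    UniformO h 5 fun i => linRem N (c i) (c i + V i) - (h i ^ 2 • quadTerm N (c i) (A i)
      + h i ^ 3 • cubicTerm N (c i) (A i) (B i)
      + h i ^ 4 • quarticTerm N (c i) (A i) (B i) (D i)) := by
  have hV'' : UniformO h 3 fun i => V i - (h i • A i + h i ^ 2 • B i) :=
    ((hV.mono hh hh1 (by norm_num)).add ((hD.pow_smul hh 3).mono hh hh1 (by norm_num))).congr
      fun i => by abel
  have hV' : UniformO h 2 fun i => V i - h i • A i :=
    ((hV''.mono hh hh1 (by norm_num)).add ((hB.pow_smul hh 2).mono hh hh1 (by norm_num))).congr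
      fun i => by abel
  have h2 := (bilin_expansion_three hh hh1
    (SmoothOnBall.uniformO_secondDeriv hN hρ (by norm_num)) hA hB hD hV1 hV).const_smul (1 / 2)
  have h3 := (trilin_expansion_two hh hh1
    (SmoothOnBall.uniformO_thirdDeriv hN hρ (by norm_num)) hA hB hV1 hV'').const_smul (1 / 6)
  have h4 := (multilin_expansion_one hh
    (SmoothOnBall.uniformO_deriv (k := 4) hN hρ (by norm_num)) hA hV1 hV').const_smul (1 / 24)
  refine ((((SmoothOnBall.uniformO_taylor (n := 3) hN hh hVρ hV1).add h2).add h3).add h4).congr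
    fun i => ?_
  simp only [Finset.sum_range_succ, Finset.sum_range_zero, zero_add, quadTerm, cubicTerm,
    quarticTerm, secondDeriv, thirdDeriv, curryTwo_self, curryThree_self, Nat.factorial,
    Nat.cast_ofNat, Nat.reduceAdd, Nat.reduceMul, Nat.succ_eq_add_one]
  module

end LinRemExpansion

/-! ### The recurrence for the functions `ψ_{i1}`. -/

section PsiExpansion

variable {X : Type*} [NormedAddCommGroup X] [NormedSpace ℝ X] [CompleteSpace X]
  {S : ℝ → X →L[ℝ] X} {A : X →ₗ.[ℝ] X}

/-- `∑ p_{i1k} φ_{k+m}(g_{i1} t A) x`. -/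
noncomputable def EPIRK.psiShift (M : EPIRK) (i m : ℕ) (E : ℝ → X → X) (t : ℝ) (x : X) : X :=
  ∑ k ∈ Finset.Icc 1 M.q, M.p i k • phi E (k + m) (M.g i * t) x

/-- The `p`-weighted sum of the recurrence for `φ_{k+m}`; the constants `1 / (k + m)!` add up to
`ℙ_{i,m+1}`. -/
theorem EPIRK.psiShift_eq_add (M : EPIRK) {i : ℕ} (hi : i ∈ Finset.Icc 2 M.s)
    (hS : IsC0Semigroup S) (hA : IsGenerator A S) {x y : X} (hxy : (x, y) ∈ A.graph) {t : ℝ}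
    (ht : 0 ≤ t) (m : ℕ) :
    M.psiShift i m (fun t x => S t x) t x
      = M.P i (m + 1) • x + (M.g i * t) • M.psiShift i (m + 1) (fun t x => S t x) t y := by
  simp only [EPIRK.psiShift, EPIRK.P, Finset.sum_smul, Finset.smul_sum, ← Finset.sum_add_distrib]
  refine Finset.sum_congr rfl fun k _ => ?_
  rw [hS.phi_eq_add hA hxy (mul_nonneg (M.g_nonneg i hi) ht) (k + m),
    show k + (m + 1) - 1 = k + m by omega, show k + (m + 1) = k + m + 1 by omega]
  module

theorem EPIRK.psiShift_sub (M : EPIRK) {i : ℕ} (hi : i ∈ Finset.Icc 2 M.s)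
    (hS : IsC0Semigroup S) {t : ℝ} (ht : 0 ≤ t) (m : ℕ) (x y : X) :
    M.psiShift i m (fun t x => S t x) t (x - y)
      = M.psiShift i m (fun t x => S t x) t x - M.psiShift i m (fun t x => S t x) t y := by
  simp only [EPIRK.psiShift, ← Finset.sum_sub_distrib]
  refine Finset.sum_congr rfl fun k _ => ?_
  obtain ⟨Φ, hΦ⟩ := hS.exists_phi_clm (mul_nonneg (M.g_nonneg i hi) ht) (k + m)
  rw [← hΦ, ← hΦ, ← hΦ, map_sub, smul_sub]

end PsiExpansion

/-! ### The order conditions applied to the terms of the expansion. -/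

section Matching

variable {X : Type*} [NormedAddCommGroup X] [NormedSpace ℝ X] [CompleteSpace X]
  {S : ℝ → X →L[ℝ] X} {M : EPIRK} {p : ℕ} {N : X → X}

theorem PhiComb.eval_smul_vec {b : PhiComb} (hb : ∀ q ∈ b.support, 0 ≤ q.2)
    (hS : IsC0Semigroup S) {t : ℝ} (ht : 0 ≤ t) (r : ℝ) (x : X) :
    b.eval (fun t x => S t x) t (r • x) = r • b.eval (fun t x => S t x) t x := by
  obtain ⟨Φ, hΦ⟩ := PhiComb.exists_eval_clm hb hS ht
  rw [← hΦ, ← hΦ, map_smul]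

theorem PhiComb.eval_add_vec {b : PhiComb} (hb : ∀ q ∈ b.support, 0 ≤ q.2)
    (hS : IsC0Semigroup S) {t : ℝ} (ht : 0 ≤ t) (x y : X) :
    b.eval (fun t x => S t x) t (x + y)
      = b.eval (fun t x => S t x) t x + b.eval (fun t x => S t x) t y := by
  obtain ⟨Φ, hΦ⟩ := PhiComb.exists_eval_clm hb hS ht
  rw [← hΦ, ← hΦ, ← hΦ, map_add]

theorem EPIRK.sum_eval_add (hS : IsC0Semigroup S) {t : ℝ} (ht : 0 ≤ t) (x y : ℕ → X) :
    ∑ j ∈ Finset.Icc 2 M.s, (M.b j).eval (fun t x => S t x) t (x j + y j)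
      = ∑ j ∈ Finset.Icc 2 M.s, (M.b j).eval (fun t x => S t x) t (x j)
        + ∑ j ∈ Finset.Icc 2 M.s, (M.b j).eval (fun t x => S t x) t (y j) := by
  rw [← Finset.sum_add_distrib]
  exact Finset.sum_congr rfl fun j hj =>
    PhiComb.eval_add_vec (fun q hq => (M.b_admissible j hj q hq).2) hS ht _ _

theorem EPIRK.WeightCondition.sum_eval {c : ℕ → ℝ} {d : ℝ} {k : ℕ}
    (hc : M.WeightCondition c d k) (hS : IsC0Semigroup S) {t : ℝ} (ht : 0 ≤ t) (x : X) :
    ∑ j ∈ Finset.Icc 2 M.s, (M.b j).eval (fun t x => S t x) t (c j • x)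
      = d • phi (fun t x => S t x) k t x := by
  rw [← hc.semigroup hS ht x]
  exact Finset.sum_congr rfl fun j hj =>
    PhiComb.eval_smul_vec (fun q hq => (M.b_admissible j hj q hq).2) hS ht _ _

/-- Here and in the next two lemmas the right-hand side has the form `k! φ_{k+1}` of the `k`-th
coefficient of the exact remainder, where `y₂` and `y₃` carry their Taylor factors `1/2` and `1/6`.
This is exactly what the variation-of-constants integral produces. -/
theorem EPIRK.StiffOrderConditions.sum_quadTerm (hM : M.StiffOrderConditions p)
    (hS : IsC0Semigroup S) {t : ℝ} (ht : 0 ≤ t) (c y₁ : X) :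
    ∑ j ∈ Finset.Icc 2 M.s, (M.b j).eval (fun t x => S t x) t
        (quadTerm N c ((M.α j * M.P j 1) • y₁))
      = (2 : ℝ) • phi (fun t x => S t x) 3 t (quadTerm N c y₁) := by
  rw [← hM.c1.sum_eval hS ht]
  refine Finset.sum_congr rfl fun j _ => ?_
  congr 1
  simp only [quadTerm, map_smul, _root_.smul_apply]
  module

theorem EPIRK.StiffOrderConditions.sum_cubicTerm (hM : M.StiffOrderConditions p) (hp : 4 ≤ p)
    (hS : IsC0Semigroup S) {t : ℝ} (ht : 0 ≤ t) (c y₁ y₂ : X) :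
    ∑ j ∈ Finset.Icc 2 M.s, (M.b j).eval (fun t x => S t x) t
        (cubicTerm N c ((M.α j * M.P j 1) • y₁) ((M.α j * M.g j * M.P j 2) • y₂))
      = (6 : ℝ) • phi (fun t x => S t x) 4 t (cubicTerm N c y₁ ((1 / 2 : ℝ) • y₂)) := by
  have e : ∀ j, cubicTerm N c ((M.α j * M.P j 1) • y₁) ((M.α j * M.g j * M.P j 2) • y₂)
      = (M.α j ^ 2 * M.g j * M.P j 1 * M.P j 2) •
          ((1 / 2 : ℝ) • (secondDeriv N c y₁ y₂ + secondDeriv N c y₂ y₁))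
        + (M.α j ^ 3 * M.P j 1 ^ 3) • ((1 / 6 : ℝ) • thirdDeriv N c y₁ y₁ y₁) := by
    intro j
    simp only [cubicTerm, map_smul, _root_.smul_apply]
    module
  simp only [e]
  rw [sum_eval_add hS ht, (hM.c2 hp).sum_eval hS ht, (hM.c3 hp).sum_eval hS ht]
  obtain ⟨Φ, hΦ⟩ := hS.exists_phi_clm ht 4
  simp only [← hΦ, cubicTerm, map_add, map_smul, _root_.smul_apply]
  module

theorem EPIRK.StiffOrderConditions.sum_quarticTerm (hM : M.StiffOrderConditions p) (hp : 5 ≤ p)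
    (hS : IsC0Semigroup S) {t : ℝ} (ht : 0 ≤ t) (c y₁ y₂ y₃ x : X) :
    ∑ j ∈ Finset.Icc 2 M.s, (M.b j).eval (fun t x => S t x) t
        (quarticTerm N c ((M.α j * M.P j 1) • y₁) ((M.α j * M.g j * M.P j 2) • y₂)
          ((M.α j * M.g j ^ 2 * M.P j 3) • y₃ + M.bigPsi j (fun t x => S t x) t x))
      = (24 : ℝ) • phi (fun t x => S t x) 5 t
          (quarticTerm N c y₁ ((1 / 2 : ℝ) • y₂) ((1 / 6 : ℝ) • y₃)) := by
  -- The third-order stage coefficient enters linearly through `N''(c)` with `y₁` in one slot. Its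
  -- `Ψ`-part is therefore `Ψ_j` under the fixed operator `B`, which plays the role of `K` in (C8);
  -- the other four groups belong to (C5), (C4), (C6) and (C7).
  let B : X →L[ℝ] X := (1 / 2 : ℝ) • (secondDeriv N c y₁ + (secondDeriv N c).flip y₁)
  have e : ∀ j, quarticTerm N c ((M.α j * M.P j 1) • y₁) ((M.α j * M.g j * M.P j 2) • y₂)
          ((M.α j * M.g j ^ 2 * M.P j 3) • y₃ + M.bigPsi j (fun t x => S t x) t x)
      = (M.α j ^ 2 * M.g j ^ 2 * M.P j 2 ^ 2) • ((1 / 2 : ℝ) • secondDeriv N c y₂ y₂)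
        + ((M.g j ^ 2 * M.α j ^ 2 * M.P j 1 * M.P j 3) •
            ((1 / 2 : ℝ) • (secondDeriv N c y₁ y₃ + secondDeriv N c y₃ y₁))
        + ((M.g j * M.α j ^ 3 * M.P j 1 ^ 2 * M.P j 2) • ((1 / 6 : ℝ) •
            (thirdDeriv N c y₁ y₁ y₂ + thirdDeriv N c y₁ y₂ y₁ + thirdDeriv N c y₂ y₁ y₁))
        + ((M.α j ^ 4 * M.P j 1 ^ 4) • ((1 / 24 : ℝ) • iteratedFDeriv ℝ 4 N c (fun _ => y₁))
        + B ((M.α j * M.P j 1) • M.bigPsi j (fun t x => S t x) t x)))) := by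
    intro j
    have e4 : iteratedFDeriv ℝ 4 N c (fun _ => (M.α j * M.P j 1) • y₁)
        = (M.α j * M.P j 1) ^ 4 • iteratedFDeriv ℝ 4 N c (fun _ => y₁) := by
      have := (iteratedFDeriv ℝ 4 N c).map_smul_univ (fun _ => M.α j * M.P j 1) (fun _ => y₁)
      simpa using this
    simp only [quarticTerm, e4, B, map_smul, map_add, _root_.smul_apply, _root_.add_apply,
      ContinuousLinearMap.flip_apply]
    module
  simp only [e]
  rw [sum_eval_add hS ht, sum_eval_add hS ht, sum_eval_add hS ht, sum_eval_add hS ht,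
    (hM.c5 hp).sum_eval hS ht, (hM.c4 hp).sum_eval hS ht, (hM.c6 hp).sum_eval hS ht,
    (hM.c7 hp).sum_eval hS ht, sum_eval_bigPsi_eq_zero (hM.c8 hp) hS ht]
  obtain ⟨Φ, hΦ⟩ := hS.exists_phi_clm ht 5
  simp only [← hΦ, quarticTerm, map_add, map_smul, _root_.smul_apply]
  module

end Matching

/-! ### Expansion of the stages and the local error. -/

section Consistency

variable {X : Type*} [NormedAddCommGroup X] [NormedSpace ℝ X]

/-- A solution `v` on `[0, h]` that starts at `c`, with its first derivatives
`L c + N c, y₂, y₃` at `0`, and all bounds that enter the local error. -/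
structure LocalSolution (L : X →ₗ.[ℝ] X) (N : X → X) (ρ K Γ κ : ℝ) (p : ℕ) (h : ℝ) (c : L.domain)
    (v : ℝ → X) (y₂ y₃ z : X) : Prop where
  bounds : PointBounds L N ρ K Γ κ c
  smooth : SmoothOnBall N (c : X) ρ K p
  h_nonneg : 0 ≤ h
  h_le_one : h ≤ 1
  graph_one : (L c + N c, y₂) ∈ (jacobian L N c).graph
  graph_two : (y₂, y₃ - secondDeriv N c (L c + N c) (L c + N c)) ∈ (jacobian L N c).graph
  graph_three : (y₃, z) ∈ (jacobian L N c).graph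
  norm_two : ‖y₂‖ ≤ K
  norm_three : ‖y₃‖ ≤ K
  norm_z : ‖z‖ ≤ K
  mem_ball : ∀ s ∈ Icc 0 h, v s ∈ Metric.ball (c : X) ρ
  continuousOn : ContinuousOn (fun s => linRem N c (v s)) (Icc 0 h)
  taylor : ∀ s ∈ Icc 0 h, ‖v s - c - (s • (L c + N c) + s ^ 2 • ((1 / 2 : ℝ) • y₂)
    + s ^ 3 • ((1 / 6 : ℝ) • y₃))‖ ≤ K * s ^ 4
  eq_integral : v h = c + h • phi (fun t x => jacFlow L N c t x) 1 h (L c + N c)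
    + ∫ s in (0 : ℝ)..h, jacFlow L N c (max (h - s) 0) (linRem N c (v s))

variable {ι : Type*} {L : X →ₗ.[ℝ] X} {N : X → X} {ρ K Γ κ Q : ℝ} {p : ℕ}
  {h : ι → ℝ} {c : ι → L.domain} {v : ι → ℝ → X} {y₂ y₃ z : ι → X} {M : EPIRK}

namespace LocalSolution

theorem uniformO_one (hS : ∀ i, LocalSolution L N ρ K Γ κ p (h i) (c i) (v i) (y₂ i) (y₃ i) (z i)) :
    UniformO h 0 fun i => L (c i) + N (c i) := ⟨K, fun i => by simpa using (hS i).bounds.norm_f⟩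

theorem uniformO_two (hS : ∀ i, LocalSolution L N ρ K Γ κ p (h i) (c i) (v i) (y₂ i) (y₃ i) (z i)) :
    UniformO h 0 y₂ := ⟨K, fun i => by simpa using (hS i).norm_two⟩

theorem uniformO_three
    (hS : ∀ i, LocalSolution L N ρ K Γ κ p (h i) (c i) (v i) (y₂ i) (y₃ i) (z i)) :
    UniformO h 0 y₃ := ⟨K, fun i => by simpa using (hS i).norm_three⟩

theorem uniformO_z (hS : ∀ i, LocalSolution L N ρ K Γ κ p (h i) (c i) (v i) (y₂ i) (y₃ i) (z i)) :
    UniformO h 0 z := ⟨K, fun i => by simpa using (hS i).norm_z⟩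

variable [CompleteSpace X]

theorem _root_.UniformO.phi_apply (hc : ∀ i, PointBounds L N ρ K Γ κ (c i)) (hL : GeneratesC0Semigroup L)
    (hρ : 0 < ρ) (hΓ : 1 ≤ Γ) (hh : ∀ i, 0 ≤ h i) (hh1 : ∀ i, h i ≤ 1) {γ : ℝ} (hγ0 : 0 ≤ γ)
    (hγ : γ ≤ Γ) (k : ℕ) {n : ℕ} {f : ι → X} (hf : UniformO h n f) :
    UniformO h n fun i => phi (fun t x => jacFlow L N (c i) t x) k (γ * h i) (f i) :=
  hf.map (κ := |κ|) (T := fun i x => phi (fun t x => jacFlow L N (c i) t x) k (γ * h i) x)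
    (abs_nonneg κ) fun i x =>
    ((hc i).norm_phi_le hL hρ hΓ (hh i) (hh1 i) hγ0 hγ k x).trans
      (mul_le_mul_of_nonneg_right (le_abs_self κ) (norm_nonneg x))

theorem _root_.UniformO.eval_apply (hc : ∀ i, PointBounds L N ρ K Γ κ (c i)) (hL : GeneratesC0Semigroup L)
    (hρ : 0 < ρ) (hΓ : 1 ≤ Γ) (hh : ∀ i, 0 ≤ h i) (hh1 : ∀ i, h i ≤ 1) {a : PhiComb}
    (ha : a.IsAdmissible) (haΓ : ∀ q ∈ a.support, q.2 ≤ Γ) {n : ℕ} {f : ι → X}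
    (hf : UniformO h n f) :
    UniformO h n fun i => a.eval (fun t x => jacFlow L N (c i) t x) (h i) (f i) :=
  hf.map (κ := a.size * |κ|) (T := fun i x => a.eval (fun t x => jacFlow L N (c i) t x) (h i) x)
    (mul_nonneg a.size_nonneg (abs_nonneg κ)) fun i x =>
    ((hc i).norm_eval_le hL hρ hΓ (hh i) (hh1 i) ha haΓ le_rfl x).trans (by
      rw [mul_assoc]
      exact mul_le_mul_of_nonneg_left
        (mul_le_mul_of_nonneg_right (le_abs_self κ) (norm_nonneg x)) a.size_nonneg)

theorem _root_.UniformO.psiShift (hc : ∀ i, PointBounds L N ρ K Γ κ (c i)) (hL : GeneratesC0Semigroup L)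
    (hρ : 0 < ρ) (hMB : M.Bounds Γ Q) (hh : ∀ i, 0 ≤ h i) (hh1 : ∀ i, h i ≤ 1) {j : ℕ}
    (hj : j ∈ Finset.Icc 2 M.s) (m : ℕ) {n : ℕ} {f : ι → X} (hf : UniformO h n f) :
    UniformO h n fun i => M.psiShift j m (fun t x => jacFlow L N (c i) t x) (h i) (f i) :=
  UniformO.sum _ fun k _ => (hf.phi_apply hc hL hρ hMB.one_le hh hh1 (M.g_nonneg j hj)
    (hMB.g_le j hj) (k + m)).const_smul (M.p j k)

/-- The sum of the remainders in a stage. -/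
theorem uniformO_stage_sum
    (hS : ∀ i, LocalSolution L N ρ K Γ κ p (h i) (c i) (v i) (y₂ i) (y₃ i) (z i))
    (hL : GeneratesC0Semigroup L) (hρ : 0 < ρ) (hMB : M.Bounds Γ Q)
    {j n : ℕ} (hj : j ∈ Finset.Icc 2 M.s) {r : ℕ → ι → X}
    (hr : ∀ l ∈ Finset.Icc 2 M.s, UniformO h n (r l)) :
    UniformO h (1 + n) fun i => h i • ∑ l ∈ Finset.Ico 2 j,
      (M.a j l).eval (fun t x => jacFlow L N (c i) t x) (h i) (r l i) := by
  have := (UniformO.sum (Finset.Ico 2 j) fun l hl =>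
    (hr l (by simp only [Finset.mem_Icc, Finset.mem_Ico] at *; omega)).eval_apply
      (fun i => (hS i).bounds) hL hρ hMB.one_le (fun i => (hS i).h_nonneg)
      (fun i => (hS i).h_le_one) (M.a_admissible j hj l hl) (hMB.a_le j hj l hl)).pow_smul
      (fun i => (hS i).h_nonneg) 1
  simpa only [pow_one] using this

/-- First round of a bootstrap: stages within `O(h)` of the centre have remainders `O(h)`, which the
factor `h` in the stage turns into `O(h^2)`. -/
theorem stage_expansion_one
    (hS : ∀ i, LocalSolution L N ρ K Γ κ p (h i) (c i) (v i) (y₂ i) (y₃ i) (z i))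
    (hL : GeneratesC0Semigroup L) (hρ : 0 < ρ) (hMB : M.Bounds Γ Q)
    (hU : ∀ j ∈ Finset.Icc 2 M.s, ∀ i, M.stageAt L N (h i) (c i) j ∈ Metric.ball (c i : X) ρ)
    (hU1 : ∀ j ∈ Finset.Icc 2 M.s, UniformO h 1 fun i => M.stageAt L N (h i) (c i) j - c i)
    {j : ℕ} (hj : j ∈ Finset.Icc 2 M.s) :
    UniformO h 2 fun i => (M.stageAt L N (h i) (c i) j - c i)
      - h i • (M.α j * M.P j 1) • (L (c i) + N (c i)) := by
  have hh := fun i => (hS i).h_nonneg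
  have hh1 := fun i => (hS i).h_le_one
  have hb := fun i => (hS i).bounds
  have hr : ∀ l ∈ Finset.Icc 2 M.s,
      UniformO h 1 fun i => linRem N (c i) (M.stageAt L N (h i) (c i) l) := by
    intro l hl
    obtain ⟨C, hC⟩ := hU1 l hl
    exact ⟨2 * K * C, fun i => ((hb i).norm_linRem_le hρ (hU l hl i)).trans (by
      have := mul_le_mul_of_nonneg_left (hC i) (by linarith [(hb i).K_nonneg] : 0 ≤ 2 * K)
      linarith)⟩
  have h1 := (((uniformO_two hS).psiShift hb hL hρ hMB hh hh1 hj 1).pow_smul hh 2).const_smul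
    (M.α j * M.g j)
  refine (h1.add (uniformO_stage_sum hS hL hρ hMB hj hr)).congr fun i => ?_
  have e := M.psiShift_eq_add hj (hL.jacFlow_isC0Semigroup N (c i))
    (hL.jacFlow_isGenerator N (c i)) (hS i).graph_one (hh i) 0
  rw [EPIRK.stageAt_eq]
  change _ + _ • M.psiShift j 0 _ _ _ + _ - _ - _ = _
  rw [e]
  module

/-- Second round: the first-order expansion determines the inner remainders up to `O(h^3)`, hence
the stage up to `O(h^4)`. Applying the recurrence for `ψ` three times produces the terms in `y₁, y₂,
y₃` and a bounded rest in `z`. `Ψ_j` collects everything of order `h^3` that acts on `N''(y₁, y₁)`.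
-/
theorem stage_expansion
    (hS : ∀ i, LocalSolution L N ρ K Γ κ p (h i) (c i) (v i) (y₂ i) (y₃ i) (z i))
    (hL : GeneratesC0Semigroup L) (hρ : 0 < ρ) (hMB : M.Bounds Γ Q)
    (hU : ∀ j ∈ Finset.Icc 2 M.s, ∀ i, M.stageAt L N (h i) (c i) j ∈ Metric.ball (c i : X) ρ)
    (hU1 : ∀ j ∈ Finset.Icc 2 M.s, UniformO h 1 fun i => M.stageAt L N (h i) (c i) j - c i)
    (hp : 3 ≤ p) {j : ℕ} (hj : j ∈ Finset.Icc 2 M.s) :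
    UniformO h 4 fun i => (M.stageAt L N (h i) (c i) j - c i)
      - (h i • (M.α j * M.P j 1) • (L (c i) + N (c i))
        + h i ^ 2 • (M.α j * M.g j * M.P j 2) • y₂ i
        + h i ^ 3 • ((M.α j * M.g j ^ 2 * M.P j 3) • y₃ i
          + M.bigPsi j (fun t x => jacFlow L N (c i) t x) (h i)
            (secondDeriv N (c i) (L (c i) + N (c i)) (L (c i) + N (c i))))) := by
  have hh := fun i => (hS i).h_nonneg
  have hh1 := fun i => (hS i).h_le_one
  have hb := fun i => (hS i).bounds
  have hr : ∀ l ∈ Finset.Icc 2 M.s,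
      UniformO h 3 fun i => linRem N (c i) (M.stageAt L N (h i) (c i) l)
        - h i ^ 2 • quadTerm N (c i) ((M.α l * M.P l 1) • (L (c i) + N (c i))) := by
    intro l hl
    have := linRem_expansion_two (fun i => (hS i).smooth.mono hp) hρ hh hh1
      (fun i => mem_ball_iff_norm.1 (hU l hl i)) ((uniformO_one hS).const_smul (M.α l * M.P l 1))
      (hU1 l hl) (stage_expansion_one hS hL hρ hMB hU hU1 hl)
    simpa using this
  have h1 := (((uniformO_z hS).psiShift hb hL hρ hMB hh hh1 hj 3).pow_smul hh 4).const_smul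
    (M.α j * M.g j ^ 3)
  refine (h1.add (uniformO_stage_sum hS hL hρ hMB hj hr)).congr fun i => ?_
  have hF := hL.jacFlow_isC0Semigroup N (c i)
  have hG := hL.jacFlow_isGenerator N (c i)
  have e := M.psiShift_eq_add hj hF hG (hS i).graph_one (hh i) 0
  -- Since `J y₂ = y₃ - N''(y₁, y₁)`, this application also yields the part of `Ψ_j` with the
  -- functions `φ_{k+2}`.
  have e2 := M.psiShift_eq_add hj hF hG (hS i).graph_two (hh i) 1
  have e3 := M.psiShift_eq_add hj hF hG (hS i).graph_three (hh i) 2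
  have esum : ∑ l ∈ Finset.Ico 2 j, (M.a j l).eval (fun t x => jacFlow L N (c i) t x) (h i)
        (linRem N (c i) (M.stageAt L N (h i) (c i) l)
          - h i ^ 2 • quadTerm N (c i) ((M.α l * M.P l 1) • (L (c i) + N (c i))))
      = ∑ l ∈ Finset.Ico 2 j, (M.a j l).eval (fun t x => jacFlow L N (c i) t x) (h i)
        (linRem N (c i) (M.stageAt L N (h i) (c i) l))
        - h i ^ 2 • (1 / 2 : ℝ) • ∑ l ∈ Finset.Ico 2 j, (M.α l ^ 2 * M.P l 1 ^ 2) •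
          (M.a j l).eval (fun t x => jacFlow L N (c i) t x) (h i)
            (secondDeriv N (c i) (L (c i) + N (c i)) (L (c i) + N (c i))) := by
    rw [Finset.smul_sum, Finset.smul_sum, ← Finset.sum_sub_distrib]
    refine Finset.sum_congr rfl fun l hl => ?_
    obtain ⟨Φ, hΦ⟩ := PhiComb.exists_eval_clm (fun q hq => (M.a_admissible j hj l hl q hq).2)
      hF (hh i)
    simp only [← hΦ, quadTerm, map_sub, map_smul, _root_.smul_apply]
    module
  rw [EPIRK.stageAt_eq, esum]
  change _ + _ • M.psiShift j 0 _ _ _ + _ - _ - (_ + _ + _ • (_ + (_ - _ • M.psiShift j 2 _ _ _)))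
    = _
  rw [e, e2, M.psiShift_sub hj hF (hh i), e3]
  module

theorem uniformO_bigPsi
    (hS : ∀ i, LocalSolution L N ρ K Γ κ p (h i) (c i) (v i) (y₂ i) (y₃ i) (z i))
    (hL : GeneratesC0Semigroup L) (hρ : 0 < ρ) (hMB : M.Bounds Γ Q)
    {j n : ℕ} (hj : j ∈ Finset.Icc 2 M.s) {f : ι → X} (hf : UniformO h n f) :
    UniformO h n fun i => M.bigPsi j (fun t x => jacFlow L N (c i) t x) (h i) (f i) :=
  ((UniformO.sum _ fun l hl => (hf.eval_apply (fun i => (hS i).bounds) hL hρ hMB.one_le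
    (fun i => (hS i).h_nonneg) (fun i => (hS i).h_le_one) (M.a_admissible j hj l hl)
    (hMB.a_le j hj l hl)).const_smul (M.α l ^ 2 * M.P l 1 ^ 2)).const_smul (1 / 2)).sub
  ((hf.psiShift (fun i => (hS i).bounds) hL hρ hMB (fun i => (hS i).h_nonneg)
    (fun i => (hS i).h_le_one) hj 2).const_smul (M.α j * M.g j ^ 2))

/-- The local error, given matching expansions of the remainders. -/
theorem uniformO_step_sub
    (hS : ∀ i, LocalSolution L N ρ K Γ κ p (h i) (c i) (v i) (y₂ i) (y₃ i) (z i))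
    (hL : GeneratesC0Semigroup L) (hρ : 0 < ρ) (hMB : M.Bounds Γ Q) {q : ℕ → ι → X}
    {qs : ℕ → ℕ → ι → X} {I : Finset ℕ}
    (hnum : ∀ j ∈ Finset.Icc 2 M.s, UniformO h p fun i =>
      linRem N (c i) (M.stageAt L N (h i) (c i) j) - ∑ k ∈ I, h i ^ k • qs k j i)
    {C : ℝ} (hex : ∀ i, ∀ s ∈ Icc 0 (h i),
      ‖linRem N (c i) (v i s) - ∑ k ∈ I, s ^ k • q k i‖ ≤ C * s ^ p)
    (hmatch : ∀ k ∈ I, ∀ i, ∑ j ∈ Finset.Icc 2 M.s,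
      (M.b j).eval (fun t x => jacFlow L N (c i) t x) (h i) (qs k j i)
        = (k ! : ℝ) • phi (fun t x => jacFlow L N (c i) t x) (k + 1) (h i) (q k i)) :
    UniformO h (p + 1) fun i => M.step L N (h i) (c i) - v i (h i) := by
  have hh := fun i => (hS i).h_nonneg
  have hh1 := fun i => (hS i).h_le_one
  have hb := fun i => (hS i).bounds
  have h1 := (UniformO.sum (Finset.Icc 2 M.s) fun j hj =>
    (hnum j hj).eval_apply hb hL hρ hMB.one_le hh hh1 (M.b_admissible j hj)
      (hMB.b_le j hj)).pow_smul hh 1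
  rw [add_comm 1 p] at h1
  -- Beyond the matched terms the exact remainder is `O(s^p)`, and integration gains one power, just
  -- as the explicit factor `h` does on the numerical side.
  have h2 : UniformO h (p + 1) fun i => ∫ s in (0 : ℝ)..h i,
      jacFlow L N (c i) (max (h i - s) 0) (linRem N (c i) (v i s) - ∑ k ∈ I, s ^ k • q k i) := by
    refine ⟨κ * |C|, fun i => ?_⟩
    have hκ := (hb i).κ_nonneg hρ (by linarith [hMB.one_le])
    have := intervalIntegral.norm_integral_le_of_norm_le_const
      (a := (0 : ℝ)) (b := h i) (C := κ * (|C| * h i ^ p))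
      (f := fun s => jacFlow L N (c i) (max (h i - s) 0)
        (linRem N (c i) (v i s) - ∑ k ∈ I, s ^ k • q k i)) (fun s hs => by
        rw [uIoc_of_le (hh i)] at hs
        have hs0 := hs.1.le
        have hs1 := hs.2
        refine ((jacFlow L N (c i) (max (h i - s) 0)).le_of_opNorm_le
          ((hb i).flow _ (Metric.mem_ball_self hρ) _ ⟨le_max_right _ _, max_le
            (by linarith [hh1 i, hMB.one_le]) (by linarith [hMB.one_le])⟩) _).trans ?_
        refine mul_le_mul_of_nonneg_left ((hex i s ⟨hs0, hs1⟩).trans ?_) hκ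
        have := le_abs_self C
        gcongr)
    refine this.trans (le_of_eq ?_)
    rw [sub_zero, abs_of_nonneg (hh i)]; ring
  refine (h1.sub h2).congr fun i => ?_
  have hF := hL.jacFlow_isC0Semigroup N (c i)
  have hcont : ∀ w : ℝ → X, ContinuousOn w (Icc 0 (h i)) → IntervalIntegrable
      (fun s => jacFlow L N (c i) (max (h i - s) 0) (w s)) MeasureTheory.volume 0 (h i) := by
    intro w hw
    refine ContinuousOn.intervalIntegrable_of_Icc (hh i) ?_
    exact hF.continuous_clamp.comp_continuousOn (f := fun s : ℝ => (h i - s, w s))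
      ((by fun_prop : Continuous fun s : ℝ => h i - s).continuousOn.prodMk hw)
  have hpoly : ∀ k, ContinuousOn (fun s : ℝ => s ^ k • q k i) (Icc 0 (h i)) := fun k => by
    fun_prop
  have eint : ∫ s in (0 : ℝ)..h i,
      jacFlow L N (c i) (max (h i - s) 0) (linRem N (c i) (v i s) - ∑ k ∈ I, s ^ k • q k i)
      = (∫ s in (0 : ℝ)..h i, jacFlow L N (c i) (max (h i - s) 0) (linRem N (c i) (v i s)))
        - ∑ k ∈ I, ((k ! : ℝ) * h i ^ (k + 1)) •
          phi (fun t x => jacFlow L N (c i) t x) (k + 1) (h i) (q k i) := by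
    simp only [map_sub]
    rw [intervalIntegral.integral_sub (hcont _ (hS i).continuousOn)
      (hcont (fun s => ∑ k ∈ I, s ^ k • q k i) (continuousOn_finsetSum _ fun k _ => hpoly k))]
    simp only [map_sum]
    rw [intervalIntegral.integral_finsetSum fun k _ => hcont _ (hpoly k)]
    congr 1
    exact Finset.sum_congr rfl fun k _ => integral_clamp_pow_smul _ (hh i) k _
  have esum : ∑ j ∈ Finset.Icc 2 M.s, (M.b j).eval (fun t x => jacFlow L N (c i) t x) (h i)
        (linRem N (c i) (M.stageAt L N (h i) (c i) j) - ∑ k ∈ I, h i ^ k • qs k j i)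
      = ∑ j ∈ Finset.Icc 2 M.s, (M.b j).eval (fun t x => jacFlow L N (c i) t x) (h i)
        (linRem N (c i) (M.stageAt L N (h i) (c i) j))
        - ∑ k ∈ I, h i ^ k • (k ! : ℝ) •
          phi (fun t x => jacFlow L N (c i) t x) (k + 1) (h i) (q k i) := by
    have e : ∑ k ∈ I, h i ^ k • (k ! : ℝ) •
          phi (fun t x => jacFlow L N (c i) t x) (k + 1) (h i) (q k i)
        = ∑ k ∈ I, ∑ j ∈ Finset.Icc 2 M.s, h i ^ k •
          (M.b j).eval (fun t x => jacFlow L N (c i) t x) (h i) (qs k j i) :=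
      Finset.sum_congr rfl fun k hk => by rw [← hmatch k hk i, Finset.smul_sum]
    rw [e, Finset.sum_comm, ← Finset.sum_sub_distrib]
    refine Finset.sum_congr rfl fun j hj => ?_
    obtain ⟨Φ, hΦ⟩ := PhiComb.exists_eval_clm (fun q hq => (M.b_admissible j hj q hq).2) hF (hh i)
    simp only [← hΦ, map_sub, map_sum, map_smul]
  have ecancel : h i • ∑ k ∈ I, h i ^ k • (k ! : ℝ) •
        phi (fun t x => jacFlow L N (c i) t x) (k + 1) (h i) (q k i)
      = ∑ k ∈ I, ((k ! : ℝ) * h i ^ (k + 1)) •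
        phi (fun t x => jacFlow L N (c i) t x) (k + 1) (h i) (q k i) := by
    rw [Finset.smul_sum]
    exact Finset.sum_congr rfl fun k _ => by module
  rw [EPIRK.step_eq, (hS i).eq_integral, eint, esum, pow_one, smul_sub, ecancel]
  abel

/-- The coefficients of the expansion of `linRem N c (c + h A + h ^ 2 B + h ^ 3 D + ⋯)`. -/
noncomputable def _root_.linRemTerm (N : X → X) (c A B D : X) : ℕ → X
  | 2 => quadTerm N c A
  | 3 => cubicTerm N c A B
  | 4 => quarticTerm N c A B D
  | _ => 0

theorem _root_.linRem_expansion {ι X : Type*} [NormedAddCommGroup X] [NormedSpace ℝ X] {N : X → X}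
    {ρ K : ℝ} {p : ℕ} {h : ι → ℝ} {c A B D V : ι → X} (hp3 : 3 ≤ p) (hp5 : p ≤ 5)
    (hN : ∀ i, SmoothOnBall N (c i) ρ K p) (hρ : 0 < ρ)
    (hh : ∀ i, 0 ≤ h i) (hh1 : ∀ i, h i ≤ 1) (hVρ : ∀ i, ‖V i‖ < ρ) (hA : UniformO h 0 A)
    (hB : UniformO h 0 B) (hD : UniformO h 0 D) (hV1 : UniformO h 1 V)
    (hV : UniformO h 4 fun i => V i - (h i • A i + h i ^ 2 • B i + h i ^ 3 • D i)) :
    UniformO h p fun i => linRem N (c i) (c i + V i)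
      - ∑ k ∈ Finset.Ico 2 p, h i ^ k • linRemTerm N (c i) (A i) (B i) (D i) k := by
  have hV'' : UniformO h 3 fun i => V i - (h i • A i + h i ^ 2 • B i) :=
    ((hV.mono hh hh1 (by norm_num)).add ((hD.pow_smul hh 3).mono hh hh1 (by norm_num))).congr
      fun i => by abel
  have hV' : UniformO h 2 fun i => V i - h i • A i :=
    ((hV''.mono hh hh1 (by norm_num)).add ((hB.pow_smul hh 2).mono hh hh1 (by norm_num))).congr
      fun i => by abel
  interval_cases p
  · simpa [Finset.sum_Ico_succ_top, linRemTerm] using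
      linRem_expansion_two hN hρ hh hh1 hVρ hA hV1 hV'
  · simpa [Finset.sum_Ico_succ_top, linRemTerm] using
      linRem_expansion_three hN hρ hh hh1 hVρ hA hB hV1 hV''
  · simpa [Finset.sum_Ico_succ_top, linRemTerm] using
      linRem_expansion_four hN hρ hh hh1 hVρ hA hB hD hV1 hV

/-- The local error of a method of stiff order `p` is `O(h ^ (p + 1))`. -/
theorem uniformO_local_error
    (hS : ∀ i, LocalSolution L N ρ K Γ κ p (h i) (c i) (v i) (y₂ i) (y₃ i) (z i))
    (hL : GeneratesC0Semigroup L) (hρ : 0 < ρ) (hMB : M.Bounds Γ Q) (hp3 : 3 ≤ p) (hp5 : p ≤ 5)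
    (hM : M.StiffOrderConditions p)
    (hU : ∀ j ∈ Finset.Icc 2 M.s, ∀ i, M.stageAt L N (h i) (c i) j ∈ Metric.ball (c i : X) ρ)
    (hU1 : ∀ j ∈ Finset.Icc 2 M.s, UniformO h 1 fun i => M.stageAt L N (h i) (c i) j - c i) :
    UniformO h (p + 1) fun i => M.step L N (h i) (c i) - v i (h i) := by
  have hh := fun i => (hS i).h_nonneg
  have hh1 := fun i => (hS i).h_le_one
  have h1 := uniformO_one hS
  have h2 := uniformO_two hS
  have h3 := uniformO_three hS
  have hx := (SmoothOnBall.uniformO_secondDeriv (h := h) (fun i => (hS i).smooth) hρ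
    (by omega)).bilin hh hh1 (n := 0) (by norm_num) h1 h1
  have hnum : ∀ j ∈ Finset.Icc 2 M.s, UniformO h p fun i =>
      linRem N (c i) (M.stageAt L N (h i) (c i) j) - ∑ k ∈ Finset.Ico 2 p, h i ^ k •
        linRemTerm N (c i) ((M.α j * M.P j 1) • (L (c i) + N (c i)))
          ((M.α j * M.g j * M.P j 2) • y₂ i) ((M.α j * M.g j ^ 2 * M.P j 3) • y₃ i
            + M.bigPsi j (fun t x => jacFlow L N (c i) t x) (h i)
              (secondDeriv N (c i) (L (c i) + N (c i)) (L (c i) + N (c i)))) k := by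
    intro j hj
    have := linRem_expansion hp3 hp5 (fun i => (hS i).smooth) hρ hh hh1
      (fun i => mem_ball_iff_norm.1 (hU j hj i)) (h1.const_smul (M.α j * M.P j 1))
      (h2.const_smul (M.α j * M.g j * M.P j 2))
      ((h3.const_smul (M.α j * M.g j ^ 2 * M.P j 3)).add
        (uniformO_bigPsi hS hL hρ hMB hj hx))
      (hU1 j hj) (stage_expansion hS hL hρ hMB hU hU1 hp3 hj)
    simpa only [add_sub_cancel] using this
  have hK : ∀ i, 0 ≤ K := fun i => (hS i).bounds.K_nonneg
  -- The same expansion serves the exact solution: the index set is enlarged by the time `s ∈ [0, h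
  -- i]`, and `s` takes the role of the step size.
  have hex := linRem_expansion (ι := Σ i, Icc 0 (h i)) (h := fun x => (x.2 : ℝ))
    (c := fun x => (c x.1 : X)) (V := fun x => v x.1 x.2 - c x.1)
    (A := fun x => L (c x.1) + N (c x.1)) (B := fun x => (1 / 2 : ℝ) • y₂ x.1)
    (D := fun x => (1 / 6 : ℝ) • y₃ x.1)
    hp3 hp5 (fun x => (hS x.1).smooth) hρ (fun x => x.2.2.1) (fun x => x.2.2.2.trans (hh1 x.1))
    (fun x => mem_ball_iff_norm.1 ((hS x.1).mem_ball _ x.2.2))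
    ⟨K, fun x => by simpa using (hS x.1).bounds.norm_f⟩
    (UniformO.const_smul _ ⟨K, fun x => by simpa using (hS x.1).norm_two⟩)
    (UniformO.const_smul _ ⟨K, fun x => by simpa using (hS x.1).norm_three⟩)
    -- Three Taylor terms and the remainder, each at most `K * s` because `s ≤ 1`.
    ⟨4 * K, fun x => by
      obtain ⟨i, s, hs⟩ := x
      have hs0 := hs.1
      have hs1 : s ≤ 1 := hs.2.trans (hh1 i)
      have hK := hK i
      have h4 := (hS i).taylor s hs
      have h5 := (hS i).bounds.norm_f
      have h6 := (hS i).norm_two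
      have h7 := (hS i).norm_three
      have e : v i s - c i = (v i s - c i - (s • (L (c i) + N (c i)) + s ^ 2 • ((1 / 2 : ℝ) • y₂ i)
        + s ^ 3 • ((1 / 6 : ℝ) • y₃ i))) + (s • (L (c i) + N (c i)))
        + s ^ 2 • ((1 / 2 : ℝ) • y₂ i) + s ^ 3 • ((1 / 6 : ℝ) • y₃ i) := by abel
      change ‖v i s - c i‖ ≤ 4 * K * s ^ 1
      rw [e]
      refine (norm_add₄_le).trans ?_
      have hs4 : s ^ 4 ≤ s := pow_le_of_le_one hs0 hs1 (by norm_num)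
      have hs3 : s ^ 3 ≤ s := pow_le_of_le_one hs0 hs1 (by norm_num)
      have hs2 : s ^ 2 ≤ s := pow_le_of_le_one hs0 hs1 (by norm_num)
      have a1 : ‖s • (L (c i) + N (c i))‖ ≤ s * K := by
        rw [norm_smul, Real.norm_eq_abs, abs_of_nonneg hs0]; gcongr
      have a2 : ‖s ^ 2 • ((1 / 2 : ℝ) • y₂ i)‖ ≤ s * K := by
        rw [norm_smul, norm_smul, Real.norm_eq_abs, abs_of_nonneg (by positivity)]
        norm_num
        gcongr
        linarith [norm_nonneg (y₂ i)]
      have a3 : ‖s ^ 3 • ((1 / 6 : ℝ) • y₃ i)‖ ≤ s * K := by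
        rw [norm_smul, norm_smul, Real.norm_eq_abs, abs_of_nonneg (by positivity)]
        norm_num
        gcongr
        linarith [norm_nonneg (y₃ i)]
      have a4 : K * s ^ 4 ≤ K * s := by gcongr
      linarith⟩
    ⟨K, fun x => (hS x.1).taylor _ x.2.2⟩
  simp only [add_sub_cancel] at hex
  obtain ⟨C, hC⟩ := hex
  refine uniformO_step_sub hS hL hρ hMB (I := Finset.Ico 2 p) (C := C)
    (q := fun k i => linRemTerm N (c i) (L (c i) + N (c i)) ((1 / 2 : ℝ) • y₂ i)
      ((1 / 6 : ℝ) • y₃ i) k) hnum (fun i s hs => hC ⟨i, s, hs⟩) fun k hk i => ?_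
  have hF := hL.jacFlow_isC0Semigroup N (c i)
  rw [Finset.mem_Ico] at hk
  obtain ⟨hk2, hkp⟩ := hk
  have hk4 : k ≤ 4 := by omega
  interval_cases k
  · simpa [linRemTerm] using hM.sum_quadTerm hF (hh i) (c i : X) (L (c i) + N (c i))
  · simpa [linRemTerm, Nat.factorial] using
      hM.sum_cubicTerm hkp hF (hh i) (c i : X) (L (c i) + N (c i)) (y₂ i)
  · simpa [linRemTerm, Nat.factorial] using
      hM.sum_quarticTerm hkp hF (hh i) (c i : X) (L (c i) + N (c i)) (y₂ i) (y₃ i)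
        (secondDeriv N (c i) (L (c i) + N (c i)) (L (c i) + N (c i)))

end LocalSolution

end Consistency

/-! ### The strip around the solution. -/

section Strip

variable {X : Type*} [NormedAddCommGroup X] {u : ℝ → X} {t₀ T R : ℝ}

theorem isOpen_strip (u : ℝ → X) (t₀ T R : ℝ) : IsOpen (strip u t₀ T R) := by
  have : strip u t₀ T R = ⋃ t ∈ Icc t₀ T, Metric.ball (u t) R := by
    ext v; simp [strip, dist_eq_norm]
  rw [this]
  exact isOpen_biUnion fun t _ => Metric.isOpen_ball

theorem mem_strip (hR : 0 < R) {t : ℝ} (ht : t ∈ Icc t₀ T) : u t ∈ strip u t₀ T R :=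
  ⟨t, ht, by simpa using hR⟩

end Strip

/-! ### Bounds that are uniform along the solution curve. -/

section UniformBounds

variable {X : Type*} [NormedAddCommGroup X] [NormedSpace ℝ X] {N : X → X} {u : ℝ → X}
  {t₀ T R : ℝ} {p : ℕ}

/-- A neighbourhood of a compact curve on which all derivatives are bounded. -/
theorem exists_smoothOnBall (hR : 0 < R) (hu : ContinuousOn u (Icc t₀ T))
    (hN : ContDiffOn ℝ ((p + 1 : ℕ) : WithTop ℕ∞) N (strip u t₀ T R)) :
    ∃ ρ K : ℝ, 0 < ρ ∧ ρ ≤ 1 ∧ ∀ t ∈ Icc t₀ T, SmoothOnBall N (u t) ρ K p := by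
  have hO := isOpen_strip u t₀ T R
  have hat : ∀ v ∈ strip u t₀ T R, ContDiffAt ℝ ((p + 1 : ℕ) : WithTop ℕ∞) N v :=
    fun v hv => hN.contDiffAt (hO.mem_nhds hv)
  have hcont : ContinuousOn (fun v => ∑ k ∈ Finset.range (p + 1), ‖iteratedFDeriv ℝ k N v‖)
      (strip u t₀ T R) := by
    refine continuousOn_finsetSum _ fun k hk v hv => ?_
    have hk' : k ≤ p + 1 := (Finset.mem_range.1 hk).le
    exact ((hat v hv).continuousAt_iteratedFDeriv (by exact_mod_cast hk')).norm.continuousWithinAt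
  have hcomp : IsCompact (u '' Icc t₀ T) := isCompact_Icc.image_of_continuousOn hu
  have hsub : u '' Icc t₀ T ⊆ strip u t₀ T R := by
    rintro _ ⟨t, ht, rfl⟩; exact mem_strip hR ht
  obtain ⟨K, hK⟩ := hcomp.exists_bound_of_continuousOn (hcont.mono hsub)
  -- Balls need not be compact in `X`, so continuity alone bounds nothing on the strip. The curve is
  -- compact, and the open set where the derivatives are below `K + 1` contains a thickening of it.
  obtain ⟨δ, hδ, hδsub⟩ := hcomp.exists_thickening_subset_open
    (hcont.isOpen_inter_preimage hO (isOpen_Iio (a := K + 1)))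
    (fun v hv => ⟨hsub hv, (le_abs_self _).trans_lt ((hK v hv).trans_lt (lt_add_one K))⟩)
  have hball : ∀ t ∈ Icc t₀ T, Metric.ball (u t) (min δ 1) ⊆ strip u t₀ T R ∩
      (fun v => ∑ k ∈ Finset.range (p + 1), ‖iteratedFDeriv ℝ k N v‖) ⁻¹' Iio (K + 1) :=
    fun t ht => ((Metric.ball_subset_ball (min_le_left _ _)).trans
      (Metric.ball_subset_thickening (mem_image_of_mem u ht) δ)).trans hδsub
  refine ⟨min δ 1, K + 1, lt_min hδ one_pos, min_le_right _ _, fun t ht => ⟨?_, ?_⟩⟩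
  · intro k hk v hv
    have hk' : k < p + 1 := by omega
    exact ((hat v (hball t ht hv).1).differentiableAt_iteratedFDeriv
      (by exact_mod_cast hk')).differentiableWithinAt
  · intro k hk v hv
    have h1 := (hball t ht hv).2
    have h2 : ‖iteratedFDeriv ℝ k N v‖ ≤ _ := Finset.single_le_sum
      (f := fun k => ‖iteratedFDeriv ℝ k N v‖) (fun _ _ => norm_nonneg _)
      (Finset.mem_range.2 (Nat.lt_succ_of_le hk))
    exact h2.trans (le_of_lt h1)

variable {c : X} {ρ K : ℝ} {n : ℕ}

namespace SmoothOnBall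

theorem mono_const {K' : ℝ} (hN : SmoothOnBall N c ρ K n) (hK : K ≤ K') :
    SmoothOnBall N c ρ K' n := ⟨hN.diff, fun k hk v hv => (hN.bound k hk v hv).trans hK⟩

theorem norm_apply_le (hN : SmoothOnBall N c ρ K n) {v : X} (hv : v ∈ Metric.ball c ρ) :
    ‖N v‖ ≤ K := by
  simpa only [norm_iteratedFDeriv_zero] using hN.bound 0 (Nat.zero_le _) v hv

theorem norm_fderiv_le (hN : SmoothOnBall N c ρ K n) (hn : 1 ≤ n) {v : X}
    (hv : v ∈ Metric.ball c ρ) : ‖fderiv ℝ N v‖ ≤ K := by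
  simpa only [norm_iteratedFDeriv_one] using hN.bound 1 hn v hv

theorem differentiableAt (hN : SmoothOnBall N c ρ K n) (hn : 1 ≤ n) {v : X}
    (hv : v ∈ Metric.ball c ρ) : DifferentiableAt ℝ N v := by
  have h := (hN.diff 0 hn).differentiableAt (Metric.isOpen_ball.mem_nhds hv)
  rw [iteratedFDeriv_zero_eq_comp] at h
  exact (LinearIsometryEquiv.comp_differentiableAt_iff _).1 h

theorem differentiableAt_fderiv (hN : SmoothOnBall N c ρ K n) (hn : 2 ≤ n) {v : X}
    (hv : v ∈ Metric.ball c ρ) : DifferentiableAt ℝ (fderiv ℝ N) v := by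
  have e : fderiv ℝ N = continuousMultilinearCurryFin1 ℝ X X ∘ iteratedFDeriv ℝ 1 N := by
    funext x; ext y
    simp [continuousMultilinearCurryFin1_apply, iteratedFDeriv_one_apply]
  rw [e, LinearIsometryEquiv.comp_differentiableAt_iff]
  exact (hN.diff 1 hn).differentiableAt (Metric.isOpen_ball.mem_nhds hv)

theorem norm_sub_le (hN : SmoothOnBall N c ρ K n) (hn : 1 ≤ n) {v w : X}
    (hv : v ∈ Metric.ball c ρ) (hw : w ∈ Metric.ball c ρ) : ‖N v - N w‖ ≤ K * ‖v - w‖ :=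
  Convex.norm_image_sub_le_of_norm_fderiv_le (𝕜 := ℝ) (fun _ hx => hN.differentiableAt hn hx)
    (fun _ hx => hN.norm_fderiv_le hn hx) (convex_ball c ρ) hw hv

theorem norm_fderiv_sub_le (hN : SmoothOnBall N c ρ K n) (hn : 2 ≤ n) {v w : X}
    (hv : v ∈ Metric.ball c ρ) (hw : w ∈ Metric.ball c ρ) :
    ‖fderiv ℝ N v - fderiv ℝ N w‖ ≤ K * ‖v - w‖ :=
  Convex.norm_image_sub_le_of_norm_fderiv_le (𝕜 := ℝ)
    (fun _ hx => hN.differentiableAt_fderiv hn hx)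
    (fun x hx => by
      rw [← norm_iteratedFDeriv_one, norm_iteratedFDeriv_fderiv]
      exact hN.bound 2 hn x hx) (convex_ball c ρ) hw hv

end SmoothOnBall

/-- Bounds for the semigroups `e^{tJ(v)}`, uniform in the point. -/
theorem GeneratesC0Semigroup.exists_flow_bounds [CompleteSpace X] {L : X →ₗ.[ℝ] X}
    (hL : GeneratesC0Semigroup L) (N : X → X) (K Γ : ℝ) :
    ∃ κ : ℝ, 0 ≤ κ ∧ (∀ v, ‖fderiv ℝ N v‖ ≤ K → ∀ s ∈ Icc 0 Γ, ‖jacFlow L N v s‖ ≤ κ) ∧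
      ∀ v w, ‖fderiv ℝ N v‖ ≤ K → ‖fderiv ℝ N w‖ ≤ K → ‖fderiv ℝ N v - fderiv ℝ N w‖ ≤ K * ‖v - w‖ →
        ∀ s ∈ Icc 0 Γ, ‖jacFlow L N v s - jacFlow L N w s‖ ≤ κ * ‖v - w‖ * s := by
  obtain ⟨S, hS, hA⟩ := hL
  have hL : GeneratesC0Semigroup L := ⟨S, hS, hA⟩
  obtain ⟨m, hm1, hm⟩ := hS.exists_bound Γ
  have hm0 : 0 ≤ m := by linarith
  set κ₀ := m * Real.exp (m * K * Γ) with hκ₀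
  have hκ₀0 : 0 ≤ κ₀ := by positivity
  have hflow : ∀ v, ‖fderiv ℝ N v‖ ≤ K → ∀ s ∈ Icc 0 Γ, ‖jacFlow L N v s‖ ≤ κ₀ :=
    fun v hv s hs => (isVolterraSolution_of_isGenerator hS hA (hL.jacFlow_isC0Semigroup N v)
      (hL.jacFlow_isGenerator N v)).norm_le (hL.jacFlow_isC0Semigroup N v) hm0 hm hv hs
  refine ⟨κ₀ + κ₀ * κ₀ * |K|, by positivity, fun v hv s hs => (hflow v hv s hs).trans
    (le_add_of_nonneg_right (by positivity)), fun v w hv hw hvw s hs => ?_⟩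
  -- Viewing `J(v)` as a bounded perturbation of `J(w)` rather than of `L` makes the difference of
  -- the semigroups proportional to `‖N'(v) - N'(w)‖`.
  have hJ : jacobian L N v
      = ((fderiv ℝ N v - fderiv ℝ N w : X →L[ℝ] X) : X →ₗ[ℝ] X) +ᵥ jacobian L N w := by
    rw [jacobian, jacobian, vadd_vadd]
    congr 1
    ext x; simp
  have hV := isVolterraSolution_of_isGenerator (hL.jacFlow_isC0Semigroup N w)
    (hL.jacFlow_isGenerator N w) (hL.jacFlow_isC0Semigroup N v)
    (hJ ▸ hL.jacFlow_isGenerator N v)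
  refine (hV.norm_sub_le hκ₀0 hκ₀0 (hflow w hw) (hflow v hv) hs).trans ?_
  have hs0 := hs.1
  have h1 : ‖fderiv ℝ N v - fderiv ℝ N w‖ ≤ |K| * ‖v - w‖ :=
    hvw.trans (mul_le_mul_of_nonneg_right (le_abs_self K) (norm_nonneg _))
  calc κ₀ * κ₀ * ‖fderiv ℝ N v - fderiv ℝ N w‖ * s ≤ κ₀ * κ₀ * (|K| * ‖v - w‖) * s := by gcongr
    _ = (κ₀ * κ₀ * |K|) * ‖v - w‖ * s := by ring
    _ ≤ _ := by gcongr; linarith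

end UniformBounds

/-! ### The exact solution: derivatives in the domain and variation of constants. -/

section Curve

variable {X : Type*} [NormedAddCommGroup X] [NormedSpace ℝ X]

theorem secondDeriv_apply (N : X → X) (c a b : X) :
    secondDeriv N c a b = fderiv ℝ (fderiv ℝ N) c a b := by
  change iteratedFDeriv ℝ 2 N c (Fin.cons a (Fin.snoc 0 b)) = _
  rw [iteratedFDeriv_two_apply]
  rfl

variable {t₀ T : ℝ} {n : ℕ} {f : ℝ → X}

theorem hasDerivWithinAt_iteratedDerivWithin (ht : t₀ < T)
    (hf : ContDiffOn ℝ (n : WithTop ℕ∞) f (Icc t₀ T)) {k : ℕ} (hk : k < n) {t : ℝ}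
    (htI : t ∈ Icc t₀ T) :
    HasDerivWithinAt (iteratedDerivWithin k f (Icc t₀ T))
      (iteratedDerivWithin (k + 1) f (Icc t₀ T) t) (Icc t₀ T) t := by
  rw [iteratedDerivWithin_succ]
  exact (hf.differentiableOn_iteratedDerivWithin (by exact_mod_cast hk) (uniqueDiffOn_Icc ht)
    t htI).hasDerivWithinAt

/-- The differentiated equation: `L u^{(k)} = u^{(k+1)} - (N ∘ u)^{(k)}`. -/
theorem iteratedDerivWithin_mem_graph [CompleteSpace X] {L : X →ₗ.[ℝ] X} {N : X → X} {u : ℝ → X}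
    (hL : GeneratesC0Semigroup L) (ht : t₀ < T) (hu : IsSolution L N t₀ T u)
    (hus : ContDiffOn ℝ (n : WithTop ℕ∞) u (Icc t₀ T))
    (hNs : ContDiffOn ℝ (n : WithTop ℕ∞) (N ∘ u) (Icc t₀ T)) :
    ∀ k < n, ∀ t ∈ Icc t₀ T, (iteratedDerivWithin k u (Icc t₀ T) t,
      iteratedDerivWithin (k + 1) u (Icc t₀ T) t - iteratedDerivWithin k (N ∘ u) (Icc t₀ T) t)
        ∈ L.graph := by
  obtain ⟨S, hS, hA⟩ := hL
  intro k
  induction k with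
  | zero =>
    intro _ t htI
    obtain ⟨hut, hd⟩ := hu t htI
    rw [iteratedDerivWithin_succ, iteratedDerivWithin_zero, iteratedDerivWithin_zero,
      hd.derivWithin (uniqueDiffOn_Icc ht t htI), Function.comp_apply, add_sub_cancel_right]
    exact L.mem_graph ⟨u t, hut⟩
  | succ k ih =>
    intro hk t htI
    -- By induction the difference quotients of both components form pairs in the graph of `L`; they
    -- converge by smoothness of `u` and `N ∘ u`, and the graph is closed.
    have hne : (𝓝[Icc t₀ T \ {t}] t).NeBot :=
      accPt_principal_iff_nhdsWithin.1 (uniqueDiffOn_Icc ht t htI).accPt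
    have h1 := hasDerivWithinAt_iteratedDerivWithin ht hus (by omega : k < n) htI
    have h2 := (hasDerivWithinAt_iteratedDerivWithin ht hus hk htI).sub
      (hasDerivWithinAt_iteratedDerivWithin ht hNs (by omega : k < n) htI)
    refine hS.mem_graph_of_tendsto hA (hasDerivWithinAt_iff_tendsto_slope.1 h1)
      (hasDerivWithinAt_iff_tendsto_slope.1 h2) ?_
    filter_upwards [self_mem_nhdsWithin] with s hs
    exact L.graph.smul_mem (s - t)⁻¹ (L.graph.sub_mem (ih (by omega) s hs.1)
      (ih (by omega) t htI))

/-- The derivatives of order `1` and `2` of `N ∘ u`. -/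
theorem iteratedDerivWithin_comp {N : X → X} {u : ℝ → X} (ht : t₀ < T)
    (hus : ContDiffOn ℝ (n : WithTop ℕ∞) u (Icc t₀ T))
    (hn : 2 ≤ n)
    (hN1 : ∀ t ∈ Icc t₀ T, DifferentiableAt ℝ N (u t))
    (hN2 : ∀ t ∈ Icc t₀ T, DifferentiableAt ℝ (fderiv ℝ N) (u t)) :
    (∀ t ∈ Icc t₀ T, iteratedDerivWithin 1 (N ∘ u) (Icc t₀ T) t
      = fderiv ℝ N (u t) (iteratedDerivWithin 1 u (Icc t₀ T) t)) ∧
    ∀ t ∈ Icc t₀ T, iteratedDerivWithin 2 (N ∘ u) (Icc t₀ T) t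
      = secondDeriv N (u t) (iteratedDerivWithin 1 u (Icc t₀ T) t)
          (iteratedDerivWithin 1 u (Icc t₀ T) t)
        + fderiv ℝ N (u t) (iteratedDerivWithin 2 u (Icc t₀ T) t) := by
  have hd0 : ∀ t ∈ Icc t₀ T,
      HasDerivWithinAt u (iteratedDerivWithin 1 u (Icc t₀ T) t) (Icc t₀ T) t := fun t htI => by
    simpa only [iteratedDerivWithin_zero] using
      hasDerivWithinAt_iteratedDerivWithin ht hus (by omega : 0 < n) htI
  have h1 : ∀ t ∈ Icc t₀ T, iteratedDerivWithin 1 (N ∘ u) (Icc t₀ T) t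
      = fderiv ℝ N (u t) (iteratedDerivWithin 1 u (Icc t₀ T) t) := by
    intro t htI
    rw [iteratedDerivWithin_one]
    exact ((hN1 t htI).hasFDerivAt.comp_hasDerivWithinAt t (hd0 t htI)).derivWithin
      (uniqueDiffOn_Icc ht t htI)
  refine ⟨h1, fun t htI => ?_⟩
  have h2 := ((hN2 t htI).hasFDerivAt.comp_hasDerivWithinAt t (hd0 t htI)).clm_apply
    (hasDerivWithinAt_iteratedDerivWithin ht hus (by omega : 1 < n) htI)
  rw [iteratedDerivWithin_succ (n := 1), secondDeriv_apply]
  exact (h2.congr h1 (h1 t htI)).derivWithin (uniqueDiffOn_Icc ht t htI)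

theorem exists_bound_iteratedDerivWithin (ht : t₀ < T)
    (hf : ContDiffOn ℝ (n : WithTop ℕ∞) f (Icc t₀ T)) :
    ∃ C, 0 ≤ C ∧ ∀ k ≤ n, ∀ t ∈ Icc t₀ T, ‖iteratedDerivWithin k f (Icc t₀ T) t‖ ≤ C := by
  have hcont : ContinuousOn (fun t => ∑ k ∈ Finset.range (n + 1),
      ‖iteratedDerivWithin k f (Icc t₀ T) t‖) (Icc t₀ T) :=
    continuousOn_finsetSum _ fun k hk => (hf.continuousOn_iteratedDerivWithin
      (by exact_mod_cast Nat.le_of_lt_succ (Finset.mem_range.1 hk)) (uniqueDiffOn_Icc ht)).norm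
  obtain ⟨C, hC⟩ := isCompact_Icc.exists_bound_of_continuousOn hcont
  refine ⟨C, (norm_nonneg _).trans (hC t₀ (left_mem_Icc.2 ht.le)), fun k hk t htI => ?_⟩
  have h2 : ‖iteratedDerivWithin k f (Icc t₀ T) t‖ ≤ _ := Finset.single_le_sum
    (f := fun k => ‖iteratedDerivWithin k f (Icc t₀ T) t‖) (fun _ _ => norm_nonneg _)
    (Finset.mem_range.2 (Nat.lt_succ_of_le hk))
  exact h2.trans ((le_abs_self _).trans (hC t htI))

/-- Variation of constants along the linearization at `u t`. -/
theorem IsSolution.eq_add_integral [CompleteSpace X] {L : X →ₗ.[ℝ] X} {N : X → X} {u : ℝ → X}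
    (hu : IsSolution L N t₀ T u) (hL : GeneratesC0Semigroup L)
    (hNu : ContinuousOn (N ∘ u) (Icc t₀ T)) {t h : ℝ} (hut : u t ∈ L.domain) (ht0 : t₀ ≤ t)
    (hh : 0 ≤ h) (hth : t + h ≤ T) :
    u (t + h) = u t
      + h • phi (fun s x => jacFlow L N (u t) s x) 1 h (L ⟨u t, hut⟩ + N (u t))
      + ∫ s in (0 : ℝ)..h, jacFlow L N (u t) (max (h - s) 0) (linRem N (u t) (u (t + s))) := by
  have hF := hL.jacFlow_isC0Semigroup N (u t)
  have hG := hL.jacFlow_isGenerator N (u t)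
  have hmaps : MapsTo (fun s => t + s) (Icc 0 h) (Icc t₀ T) := fun s hs =>
    ⟨by linarith [hs.1], by linarith [hs.2]⟩
  have huc : ContinuousOn (fun s => u (t + s)) (Icc 0 h) :=
    ContinuousOn.comp (g := u) (fun s hs => (hu s hs).2.continuousWithinAt) (by fun_prop) hmaps
  have hNc : ContinuousOn (fun s => N (u (t + s))) (Icc 0 h) := hNu.comp (by fun_prop) hmaps
  have hd : ∀ s ∈ Ioo 0 h, HasDerivAt (fun s => u (t + s)) (deriv u (t + s)) s := by
    intro s hs
    have hs' := hmaps (Ioo_subset_Icc_self hs)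
    have h1 := ((hu _ hs').2.hasDerivAt
      (Icc_mem_nhds (by linarith [hs.1]) (by linarith [hs.2]))).differentiableAt.hasDerivAt
    exact h1.comp_const_add t s
  -- The equation is read as `v' = J v + (N(v) - N'(u t) v)` with `J` frozen at `u t`. The constant
  -- part of the forcing integrates to a `φ_1` term and leaves `linRem` under the integral.
  have key := hF.duhamel hG (v' := fun s => deriv u (t + s))
    (f := fun s => N (u (t + s)) - fderiv ℝ N (u t) (u (t + s))) hh huc
    (hNc.sub ((fderiv ℝ N (u t)).continuous.comp_continuousOn huc)) hd (by
      intro s hs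
      have hs' := hmaps (Ioo_subset_Icc_self hs)
      have h1 := ((hu _ hs').2.hasDerivAt
        (Icc_mem_nhds (by linarith [hs.1]) (by linarith [hs.2])))
      rw [mem_graph_jacobian_iff, h1.deriv]
      have := L.mem_graph ⟨u (t + s), (hu _ hs').1⟩
      convert this using 2
      abel)
  have e0 : jacFlow L N (u t) h (u t) = u t + h • phi (fun s x => jacFlow L N (u t) s x) 1 h
      (L ⟨u t, hut⟩ + fderiv ℝ N (u t) (u t)) := by
    have hg : (u t, L ⟨u t, hut⟩ + fderiv ℝ N (u t) (u t)) ∈ (jacobian L N (u t)).graph := by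
      rw [mem_graph_jacobian_iff, add_sub_cancel_right]
      exact L.mem_graph ⟨u t, hut⟩
    simpa [phi] using hF.phi_eq_add hG hg hh 0
  have hcont : ∀ w : ℝ → X, ContinuousOn w (Icc 0 h) → IntervalIntegrable
      (fun s => jacFlow L N (u t) (max (h - s) 0) (w s)) MeasureTheory.volume 0 h := by
    intro w hw
    refine ContinuousOn.intervalIntegrable_of_Icc hh ?_
    exact hF.continuous_clamp.comp_continuousOn (f := fun s : ℝ => (h - s, w s))
      ((by fun_prop : Continuous fun s : ℝ => h - s).continuousOn.prodMk hw)
  have hlin : ContinuousOn (fun s => linRem N (u t) (u (t + s))) (Icc 0 h) :=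
    (hNc.sub continuousOn_const).sub ((fderiv ℝ N (u t)).continuous.comp_continuousOn
      (huc.sub continuousOn_const))
  have e1 : ∫ s in (0 : ℝ)..h, jacFlow L N (u t) (max (h - s) 0)
        (N (u (t + s)) - fderiv ℝ N (u t) (u (t + s)))
      = (∫ s in (0 : ℝ)..h, jacFlow L N (u t) (max (h - s) 0) (linRem N (u t) (u (t + s))))
        + h • phi (fun s x => jacFlow L N (u t) s x) 1 h (N (u t) - fderiv ℝ N (u t) (u t)) := by
    have e2 := integral_clamp_pow_smul (jacFlow L N (u t)) hh 0
      (N (u t) - fderiv ℝ N (u t) (u t))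
    simp only [pow_zero, one_smul, Nat.factorial_zero, Nat.cast_one, one_mul, zero_add,
      pow_one] at e2
    rw [← e2, ← intervalIntegral.integral_add (hcont _ hlin) (hcont _ continuousOn_const)]
    refine intervalIntegral.integral_congr fun s _ => ?_
    rw [← map_add, linRem, map_sub (fderiv ℝ N (u t))]
    congr 1
    abel
  obtain ⟨Φ, hΦ⟩ := hF.exists_phi_clm hh 1
  simp only [add_zero] at key
  rw [key, e0, e1, ← hΦ, ← hΦ, ← hΦ]
  simp only [map_add, map_sub]
  module

/-- Uniform bounds along the solution, and its local expansions. -/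
theorem exists_localSolution [CompleteSpace X] {L : X →ₗ.[ℝ] X} {N : X → X} {u : ℝ → X}
    {p : ℕ} {R : ℝ} (hL : GeneratesC0Semigroup L) (ht : t₀ < T) (hu : IsSolution L N t₀ T u)
    (hus : ContDiffOn ℝ ((p + 1 : ℕ) : WithTop ℕ∞) u (Icc t₀ T)) (hR : 0 < R)
    (hN : ContDiffOn ℝ ((p + 1 : ℕ) : WithTop ℕ∞) N (strip u t₀ T R)) (hp : 3 ≤ p) (Γ : ℝ) :
    ∃ ρ K κ η : ℝ, 0 < ρ ∧ ρ ≤ 1 ∧ 0 ≤ K ∧ 0 ≤ κ ∧ 0 < η ∧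
      ∀ t ∈ Icc t₀ T, ∀ hut : u t ∈ L.domain, PointBounds L N ρ K Γ κ ⟨u t, hut⟩ ∧
        ∀ h, 0 ≤ h → h ≤ η → t + h ≤ T → ∃ y₂ y₃ z,
          LocalSolution L N ρ K Γ κ p h ⟨u t, hut⟩ (fun s => u (t + s)) y₂ y₃ z := by
  have hNs : ContDiffOn ℝ ((p + 1 : ℕ) : WithTop ℕ∞) (N ∘ u) (Icc t₀ T) :=
    hN.comp hus fun t htI => mem_strip hR htI
  obtain ⟨ρ, K₀, hρ, hρ1, hsm⟩ := exists_smoothOnBall hR hus.continuousOn hN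
  obtain ⟨Cu, hCu0, hCu⟩ := exists_bound_iteratedDerivWithin ht hus
  obtain ⟨Cm, hCm0, hCm⟩ := exists_bound_iteratedDerivWithin ht hNs
  -- One constant for everything; the last three summands are those needed for `z`, which combines
  -- derivatives of `u` and `N ∘ u` with `N'(u) u'''`.
  set K := |K₀| + Cu + Cm + |K₀| * Cu with hKdef
  have hmul : 0 ≤ |K₀| * Cu := by positivity
  have habs := abs_nonneg K₀
  have hK0 : 0 ≤ K := by positivity
  have hK1 : K₀ ≤ K := (le_abs_self K₀).trans (by linarith)
  have hCuK : Cu ≤ K := by linarith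
  obtain ⟨κ, hκ0, hflow, hfliplip⟩ := hL.exists_flow_bounds N K Γ
  have hsm' : ∀ t ∈ Icc t₀ T, SmoothOnBall N (u t) ρ K p := fun t htI => (hsm t htI).mono_const hK1
  have hself : ∀ t, u t ∈ Metric.ball (u t) ρ := fun t => Metric.mem_ball_self hρ
  obtain ⟨hm1, hm2⟩ := iteratedDerivWithin_comp ht hus (by omega)
    (fun t htI => (hsm t htI).differentiableAt (by omega) (hself t))
    (fun t htI => (hsm t htI).differentiableAt_fderiv (by omega) (hself t))
  have hgraph := iteratedDerivWithin_mem_graph hL ht hu hus hNs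
  -- The second bound keeps the solution in the ball of radius `ρ` during a step, since its speed is
  -- at most `Cu ≤ K`.
  refine ⟨ρ, K, κ, min 1 (ρ / (2 * (K + 1))), hρ, hρ1, hK0, hκ0,
    lt_min one_pos (by positivity), fun t htI hut => ?_⟩
  have hf1 : L ⟨u t, hut⟩ + N (u t) = iteratedDerivWithin 1 u (Icc t₀ T) t := by
    rw [iteratedDerivWithin_one, (hu t htI).2.derivWithin (uniqueDiffOn_Icc ht t htI)]
  have hPB : PointBounds L N ρ K Γ κ ⟨u t, hut⟩ :=
    { norm_center := by simpa using (hCu 0 (by omega) t htI).trans hCuK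
      norm_f := by
        change ‖L ⟨u t, hut⟩ + N (u t)‖ ≤ K
        rw [hf1]; exact (hCu 1 (by omega) t htI).trans hCuK
      norm_N := fun v hv => (hsm' t htI).norm_apply_le hv
      norm_D := fun v hv => (hsm' t htI).norm_fderiv_le (by omega) hv
      lip_N := fun v hv w hw => (hsm' t htI).norm_sub_le (by omega) hv hw
      lip_D := fun v hv w hw => (hsm' t htI).norm_fderiv_sub_le (by omega) hv hw
      flow := fun v hv => hflow v ((hsm' t htI).norm_fderiv_le (by omega) hv)
      flow_lip := fun v hv w hw => hfliplip v w ((hsm' t htI).norm_fderiv_le (by omega) hv)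
        ((hsm' t htI).norm_fderiv_le (by omega) hw)
        ((hsm' t htI).norm_fderiv_sub_le (by omega) hv hw) }
  refine ⟨hPB, fun h hh hhη hth => ?_⟩
  have hh1 : h ≤ 1 := hhη.trans (min_le_left _ _)
  have hmaps : MapsTo (fun s => t + s) (Icc 0 h) (Icc t₀ T) := fun s hs =>
    ⟨by linarith [hs.1, htI.1], by linarith [hs.2]⟩
  have hchain : ∀ k < p + 1, ∀ s ∈ Icc 0 h,
      HasDerivWithinAt (fun s => iteratedDerivWithin k u (Icc t₀ T) (t + s))
        (iteratedDerivWithin (k + 1) u (Icc t₀ T) (t + s)) (Icc 0 h) s := by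
    intro k hk s hs
    have h1 := HasDerivWithinAt.scomp s (hasDerivWithinAt_iteratedDerivWithin ht hus hk (hmaps hs))
      ((hasDerivWithinAt_id s (Icc 0 h)).const_add t) hmaps
    rw [one_smul] at h1
    exact h1
  have htaylor := fun (m : ℕ) (hm : m ≤ p + 1) => taylor_chain hCu0 m
    (fun k s => iteratedDerivWithin k u (Icc t₀ T) (t + s))
    (fun k hk => hchain k (by omega)) (fun s hs => hCu m hm _ (hmaps hs))
  have huc : ContinuousOn (fun s => u (t + s)) (Icc 0 h) :=
    hus.continuousOn.comp (by fun_prop) hmaps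
  have hNc : ContinuousOn (fun s => N (u (t + s))) (Icc 0 h) :=
    hNs.continuousOn.comp (by fun_prop) hmaps
  -- The last witness is `J u'''`, read off from `L u''' = u'''' - (N ∘ u)'''`.
  refine ⟨iteratedDerivWithin 2 u (Icc t₀ T) t, iteratedDerivWithin 3 u (Icc t₀ T) t,
    iteratedDerivWithin 4 u (Icc t₀ T) t - iteratedDerivWithin 3 (N ∘ u) (Icc t₀ T) t
      + fderiv ℝ N (u t) (iteratedDerivWithin 3 u (Icc t₀ T) t), ?_⟩
  exact
    { bounds := hPB
      smooth := hsm' t htI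
      h_nonneg := hh
      h_le_one := hh1
      graph_one := by
        change (L ⟨u t, hut⟩ + N (u t), _) ∈ (jacobian L N (u t)).graph
        rw [hf1, mem_graph_jacobian_iff, ← hm1 t htI]
        exact hgraph 1 (by omega) t htI
      graph_two := by
        change (_, _ - secondDeriv N (u t) (L ⟨u t, hut⟩ + N (u t)) (L ⟨u t, hut⟩ + N (u t)))
          ∈ (jacobian L N (u t)).graph
        rw [hf1, mem_graph_jacobian_iff, sub_sub, ← hm2 t htI]
        exact hgraph 2 (by omega) t htI
      graph_three := by
        rw [mem_graph_jacobian_iff]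
        change (_, _ + fderiv ℝ N (u t) _ - fderiv ℝ N (u t) _) ∈ L.graph
        rw [add_sub_cancel_right]
        exact hgraph 3 (by omega) t htI
      norm_two := (hCu 2 (by omega) t htI).trans hCuK
      norm_three := (hCu 3 (by omega) t htI).trans hCuK
      norm_z := by
        have a1 := hCu 4 (by omega) t htI
        have a2 := hCm 3 (by omega) t htI
        have a3 := (fderiv ℝ N (u t)).le_of_opNorm_le_of_le
          (((hsm t htI).norm_fderiv_le (by omega) (hself t)).trans (le_abs_self K₀))
          (hCu 3 (by omega) t htI)
        refine (norm_add_le _ _).trans ((add_le_add ((norm_sub_le _ _).trans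
          (add_le_add a1 a2)) a3).trans ?_)
        linarith
      mem_ball := fun s hs => by
        have a1 := htaylor 1 (by omega) s hs
        simp only [iteratedDerivWithin_zero, Finset.sum_range_one, pow_zero, Nat.factorial_zero,
          Nat.cast_one, div_one, one_smul, add_zero, pow_one] at a1
        rw [mem_ball_iff_norm]
        refine a1.trans_lt ?_
        have a2 : s ≤ ρ / (2 * (K + 1)) := hs.2.trans (hhη.trans (min_le_right _ _))
        rw [le_div_iff₀ (by positivity)] at a2
        have := hs.1
        nlinarith
      continuousOn := (hNc.sub continuousOn_const).sub
        ((fderiv ℝ N (u t)).continuous.comp_continuousOn (huc.sub continuousOn_const))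
      taylor := fun s hs => by
        have a1 := htaylor 4 (by omega) s hs
        have hs0 := hs.1
        refine le_trans (le_of_eq ?_) (a1.trans (mul_le_mul_of_nonneg_right hCuK (by positivity)))
        change ‖u (t + s) - u t - (s • (L ⟨u t, hut⟩ + N (u t)) + _ + _)‖ = _
        congr 1
        rw [hf1]
        simp only [iteratedDerivWithin_zero, Finset.sum_range_succ, Finset.sum_range_zero, pow_zero,
          Nat.factorial, Nat.cast_one, div_one, one_smul, add_zero, pow_one, zero_add]
        push_cast
        module
      eq_integral := hu.eq_add_integral hL hNs.continuousOn hut htI.1 hh hth }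

end Curve

/-! ### Error recursion, discrete Gronwall inequality and convergence. -/

section Convergence

variable {X : Type*} [NormedAddCommGroup X] [NormedSpace ℝ X]

/-- A step with `γ > 0` throughout the weights `b_j` stays in the domain. -/
theorem EPIRK.step_mem_domain [CompleteSpace X] (M : EPIRK) {L : X →ₗ.[ℝ] X}
    (hL : GeneratesC0Semigroup L) (N : X → X)
    (hb : ∀ j ∈ Finset.Icc 2 M.s, ∀ q ∈ (M.b j).support, 0 < q.2) {h : ℝ} (hh : 0 < h)
    (w : L.domain) : M.step L N h w ∈ L.domain := by
  have hF := hL.jacFlow_isC0Semigroup N w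
  have hG := hL.jacFlow_isGenerator N w
  have hphi : ∀ k t x, 1 ≤ k → 0 < t →
      phi (fun t x => jacFlow L N w t x) k t x ∈ L.domain := by
    intro k t x hk ht
    obtain ⟨k, rfl⟩ := Nat.exists_eq_add_of_le' hk
    exact LinearPMap.mem_domain_of_mem_graph
      (mem_graph_jacobian_iff.1 (hF.phi_succ_mem_graph hG x ht k))
  rw [EPIRK.step_eq]
  refine L.domain.add_mem (L.domain.add_mem w.2 (L.domain.smul_mem _ (hphi 1 h _ le_rfl hh)))
    (L.domain.smul_mem _ (L.domain.sum_mem fun j hj => L.domain.sum_mem fun q hq =>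
      L.domain.smul_mem _ (hphi _ _ _ (M.b_admissible j hj q hq).1 (mul_pos (hb j hj q hq) hh))))

theorem EPIRK.exists_isNumericalSolution (M : EPIRK) {L : X →ₗ.[ℝ] X} {N : X → X} {u₀ : X}
    (hu₀ : u₀ ∈ L.domain) {t : ℕ → ℝ} {m : ℕ}
    (hstep : ∀ n < m, ∀ w : L.domain, M.step L N (t (n + 1) - t n) w ∈ L.domain) :
    ∃ w : ℕ → L.domain, M.IsNumericalSolution L N u₀ t m w := by
  classical
  -- The default `0` can occur only from index `m` on, where nothing is claimed.
  refine ⟨fun n => Nat.rec ⟨u₀, hu₀⟩ (fun n w =>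
    if hw : M.step L N (t (n + 1) - t n) w ∈ L.domain then ⟨_, hw⟩ else 0) n, rfl, fun n hn => ?_⟩
  simp only [dif_pos (hstep n hn _)]

/-- The error recursion. -/
theorem exists_error_recursion [CompleteSpace X] {L : X →ₗ.[ℝ] X} {N : X → X} {u : ℝ → X}
    {t₀ T R : ℝ} {p : ℕ} {M : EPIRK} (hL : GeneratesC0Semigroup L) (ht : t₀ < T)
    (hu : IsSolution L N t₀ T u)
    (hus : ContDiffOn ℝ ((p + 1 : ℕ) : WithTop ℕ∞) u (Icc t₀ T)) (hR : 0 < R)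
    (hN : ContDiffOn ℝ ((p + 1 : ℕ) : WithTop ℕ∞) N (strip u t₀ T R))
    (hp3 : 3 ≤ p) (hp5 : p ≤ 5) (hM : M.CoeffRestriction) (hMo : M.StiffOrderConditions p) :
    ∃ C₁ C₂ η : ℝ, 0 ≤ C₁ ∧ 0 ≤ C₂ ∧ 0 < η ∧ ∀ t ∈ Icc t₀ T, ∀ h, 0 ≤ h → h ≤ η → t + h ≤ T →
      ∀ w : L.domain, ‖(w : X) - u t‖ ≤ η →
        ‖M.step L N h w - u (t + h) - jacFlow L N (u t) h (w - u t)‖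
          ≤ C₁ * h * ‖(w : X) - u t‖ + C₂ * h ^ (p + 1) := by
  obtain ⟨Γ, Q, hMB⟩ := M.exists_bounds
  obtain ⟨ρ, K, κ, η₁, hρ, hρ1, hK, hκ, hη₁, hloc⟩ :=
    exists_localSolution hL ht hu hus hR hN hp3 Γ
  obtain ⟨Cs, η₂, -, hη₂, -, -, hstage⟩ :=
    PointBounds.exists_stage_bounds M hM hMB hL N hρ hρ1 K κ hK hκ
  obtain ⟨C₁, η₃, hC₁, hη₃, hstab⟩ :=
    PointBounds.exists_step_stability M hM hMB hL N hρ hρ1 K κ hK hκ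
  set η := min η₁ (min η₂ η₃) with hη
  have hη1 : η ≤ η₁ := min_le_left _ _
  have hη2 : η ≤ η₂ := (min_le_right _ _).trans (min_le_left _ _)
  have hη3 : η ≤ η₃ := (min_le_right _ _).trans (min_le_right _ _)
  -- Indexing by all admissible pairs of time and step size makes the constant of the local error
  -- independent of any grid.
  let ι := {x : ℝ × ℝ // x.1 ∈ Icc t₀ T ∧ 0 ≤ x.2 ∧ x.2 ≤ η ∧ x.1 + x.2 ≤ T}
  let c : ι → L.domain := fun i => ⟨u i.1.1, (hu _ i.2.1).1⟩
  have hex : ∀ i : ι, ∃ y₂ y₃ z, LocalSolution L N ρ K Γ κ p i.1.2 (c i)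
      (fun s => u (i.1.1 + s)) y₂ y₃ z := fun i =>
    (hloc _ i.2.1 _).2 _ i.2.2.1 (i.2.2.2.1.trans hη1) i.2.2.2.2
  choose y₂ y₃ z hS using hex
  have hst : ∀ j ∈ Finset.Icc 2 M.s, ∀ i : ι, M.stageAt L N i.1.2 (c i) j
      ∈ Metric.ball (c i : X) ρ ∧ ‖M.stageAt L N i.1.2 (c i) j - c i‖ ≤ Cs * i.1.2 := by
    intro j hj i
    have := hstage j hj (c i) (c i) i.1.2 (hS i).bounds (by simpa using hη₂.le) i.2.2.1
      (i.2.2.2.1.trans hη2)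
    exact ⟨this.1, this.2.2⟩
  have herr := LocalSolution.uniformO_local_error (h := fun i : ι => i.1.2) hS hL hρ hMB hp3 hp5
    hMo (fun j hj i => (hst j hj i).1) (fun j hj => ⟨Cs, fun i => by
      simpa using (hst j hj i).2⟩)
  obtain ⟨C₂, hC₂, hC⟩ := herr.exists_nonneg (fun i => i.2.2.1)
  refine ⟨C₁, C₂, η, hC₁, hC₂, lt_min hη₁ (lt_min hη₂ hη₃), fun t htI h hh hhη hth w hw => ?_⟩
  have h1 := hC ⟨(t, h), htI, hh, hhη, hth⟩
  have h2 := hstab ⟨u t, (hu t htI).1⟩ w h (hloc t htI _).1 (hw.trans hη3) hh (hhη.trans hη3)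
  have e : M.step L N h w - u (t + h) - jacFlow L N (u t) h (w - u t)
      = (M.step L N h w - M.step L N h ⟨u t, (hu t htI).1⟩ - jacFlow L N (u t) h (w - u t))
        + (M.step L N h ⟨u t, (hu t htI).1⟩ - u (t + h)) := by abel
  rw [e]
  exact (norm_add_le _ _).trans (add_le_add h2 h1)

/-- The discrete Gronwall inequality in summed form. -/
theorem le_mul_exp_of_le_add_sum {a α : ℕ → ℝ} {B : ℝ} {n : ℕ} (hα : ∀ ν < n, 0 ≤ α ν) (hB : 0 ≤ B)
    (h : ∀ k ≤ n, a k ≤ B + ∑ ν ∈ Finset.range k, α ν * a ν) :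
    a n ≤ B * Real.exp (∑ ν ∈ Finset.range n, α ν) := by
  -- The right-hand side of the hypothesis is what gets iterated; each step multiplies it by at most
  -- `1 + α k ≤ exp (α k)`.
  have key : ∀ k ≤ n, B + ∑ ν ∈ Finset.range k, α ν * a ν
      ≤ B * Real.exp (∑ ν ∈ Finset.range k, α ν) := by
    intro k
    induction k with
    | zero => simp
    | succ k ih =>
      intro hk
      have h1 := ih (by omega)
      have h2 := h k (by omega)
      have h3 := hα k (by omega)
      have h4 : 1 + α k ≤ Real.exp (α k) := by linarith [Real.add_one_le_exp (α k)]
      rw [Finset.sum_range_succ, Finset.sum_range_succ, Real.exp_add]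
      have h5 : 0 ≤ B * Real.exp (∑ ν ∈ Finset.range k, α ν) := by positivity
      calc B + (∑ ν ∈ Finset.range k, α ν * a ν + α k * a k)
          ≤ (B + ∑ ν ∈ Finset.range k, α ν * a ν)
            + α k * (B + ∑ ν ∈ Finset.range k, α ν * a ν) := by
            linarith [mul_le_mul_of_nonneg_left h2 h3]
        _ = (B + ∑ ν ∈ Finset.range k, α ν * a ν) * (1 + α k) := by ring
        _ ≤ (B * Real.exp (∑ ν ∈ Finset.range k, α ν)) * Real.exp (α k) :=
            mul_le_mul h1 h4 (by linarith) h5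
        _ = _ := by ring
  exact (h n le_rfl).trans (key n le_rfl)

variable {L : X →ₗ.[ℝ] X} {N : X → X} {u : ℝ → X} {t : ℕ → ℝ} {m : ℕ} {CS : ℝ}

/-- The stability bound speaks of nonempty products only; the `1` covers the empty product, which
multiplies the most recent defect. -/
theorem StabilityBound.norm_propagatorProd_le (hCS : StabilityBound L N u t m CS) {ν k : ℕ}
    (hk : ν + k ≤ m) : ‖propagatorProd L N u t ν k‖ ≤ max CS 1 := by
  rcases k with _ | k
  · exact ContinuousLinearMap.norm_id_le.trans (le_max_right _ _)
  · have := hCS ν (ν + k) (by omega) (by omega)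
    rw [Nat.add_sub_cancel_left] at this
    exact this.trans (le_max_left _ _)

/-- Solution of a linear recursion with the propagators. -/
theorem eq_sum_propagatorProd {e d : ℕ → X} {n : ℕ} (h0 : e 0 = 0)
    (hrec : ∀ k < n, e (k + 1) = jacFlow L N (u (t k)) (t (k + 1) - t k) (e k) + d k) :
    e n = ∑ ν ∈ Finset.range n, propagatorProd L N u t (ν + 1) (n - (ν + 1)) (d ν) := by
  induction n with
  | zero => simpa using h0
  | succ n ih =>
    rw [hrec n (by omega), ih fun k hk => hrec k (by omega), Finset.sum_range_succ, map_sum]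
    congr 1
    · refine Finset.sum_congr rfl fun ν hν => ?_
      have hν' := Finset.mem_range.1 hν
      obtain ⟨k, rfl⟩ : ∃ k, n = ν + 1 + k := ⟨n - (ν + 1), by omega⟩
      rw [show ν + 1 + k + 1 - (ν + 1) = k + 1 by omega, Nat.add_sub_cancel_left]
      rfl
    · simp [propagatorProd]

end Convergence

theorem mainTheorem1 {X : Type*} [NormedAddCommGroup X] [NormedSpace ℝ X] [CompleteSpace X]
    (L : X →ₗ.[ℝ] X) (N : X → X) (t₀ T : ℝ) (ht : t₀ < T) (u : ℝ → X)
    (M : EPIRK) (p : ℕ) (hp3 : 3 ≤ p) (hp5 : p ≤ 5)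
    (hL : GeneratesC0Semigroup L)
    (hu : IsSolution L N t₀ T u)
    (hu_smooth : ContDiffOn ℝ ((p + 1 : ℕ) : WithTop ℕ∞) u (Set.Icc t₀ T))
    (R : ℝ) (hR : 0 < R)
    (hN_smooth : ContDiffOn ℝ ((p + 1 : ℕ) : WithTop ℕ∞) N (strip u t₀ T R))
    (hM : M.CoeffRestriction)
    (hM_order : M.StiffOrderConditions p)
    (CS : ℝ) :
    ∃ H : ℝ, 0 < H ∧ ∃ C : ℝ, ∀ (t : ℕ → ℝ) (m : ℕ), IsGrid t₀ T H t m →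
      StabilityBound L N u t m CS →
      ((∀ j ∈ Finset.Icc 2 M.s, ∀ q ∈ (M.b j).support, 0 < q.2) →
        ∃ w : ℕ → L.domain, M.IsNumericalSolution L N (u t₀) t m w) ∧
      ∀ w : ℕ → L.domain, M.IsNumericalSolution L N (u t₀) t m w →
        ∀ n ≤ m, ‖(w n : X) - u (t n)‖ ≤
          C * ∑ ν ∈ Finset.range n, (t (ν + 1) - t ν) ^ (p + 1) := by
  obtain ⟨C₁, C₂, η, hC₁, hC₂, hη, hrec⟩ :=
    exists_error_recursion hL ht hu hu_smooth hR hN_smooth hp3 hp5 hM hM_order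
  set D := max CS 1 with hD
  have hD0 : 0 ≤ D := zero_le_one.trans (le_max_right _ _)
  -- The Gronwall constant; fixing it before `H` allows `H` to depend on it.
  set C := D * C₂ * Real.exp (D * C₁ * (T - t₀)) with hC
  have hC0 : 0 ≤ C := by positivity
  have hT : 0 < T - t₀ := sub_pos.2 ht
  -- For steps below the last bound the claimed error `C ∑ h^{p+1} ≤ C H (T - t₀)` stays within the
  -- radius `η` where the recursion is valid.
  refine ⟨min (min 1 η) (η / (C * (T - t₀) + 1)), lt_min (lt_min one_pos hη) (by positivity), C,
    fun t m hgrid hCS => ⟨fun hb => ?_, fun w hw => ?_⟩⟩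
  · exact M.exists_isNumericalSolution (hu t₀ (left_mem_Icc.2 ht.le)).1 fun n hn w =>
      M.step_mem_domain hL N hb (sub_pos.2 (hgrid.2.1 n hn).1) w
  set H := min (min 1 η) (η / (C * (T - t₀) + 1)) with hH
  have hH0 : 0 < H := lt_min (lt_min one_pos hη) (by positivity)
  have hH1 : H ≤ 1 := (min_le_left _ _).trans (min_le_left _ _)
  have hHη : H ≤ η := (min_le_left _ _).trans (min_le_right _ _)
  have hHC : H * (C * (T - t₀) + 1) ≤ η := (le_div_iff₀ (by positivity)).1 (min_le_right _ _)
  obtain ⟨ht0, hstep, htm⟩ := hgrid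
  have hpos : ∀ n < m, 0 ≤ t (n + 1) - t n := fun n hn => (sub_pos.2 (hstep n hn).1).le
  have hsum : ∀ n, ∑ ν ∈ Finset.range n, (t (ν + 1) - t ν) = t n - t₀ := fun n => by
    rw [Finset.sum_range_sub, ht0]
  have hmem : ∀ n ≤ m, t n ∈ Icc t₀ T := by
    intro n hn
    constructor
    · have := Finset.sum_nonneg fun ν (hν : ν ∈ Finset.range n) =>
        hpos ν ((Finset.mem_range.1 hν).trans_le hn)
      rw [hsum] at this; linarith
    · have := Finset.sum_nonneg fun ν (hν : ν ∈ Finset.Ico n m) => hpos ν (Finset.mem_Ico.1 hν).2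
      rw [Finset.sum_Ico_sub _ hn] at this; linarith
  have hpow : ∀ n ≤ m, ∑ ν ∈ Finset.range n, (t (ν + 1) - t ν) ^ (p + 1) ≤ H * (T - t₀) := by
    intro n hn
    calc ∑ ν ∈ Finset.range n, (t (ν + 1) - t ν) ^ (p + 1)
        ≤ ∑ ν ∈ Finset.range n, H * (t (ν + 1) - t ν) := by
          refine Finset.sum_le_sum fun ν hν => ?_
          have hν' := (Finset.mem_range.1 hν).trans_le hn
          have h0 := hpos ν hν'
          have h1 := (hstep ν hν').2
          rw [pow_succ]
          refine mul_le_mul_of_nonneg_right ?_ h0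
          exact (pow_le_of_le_one h0 (h1.trans hH1) (by omega)).trans h1
      _ = H * (t n - t₀) := by rw [← Finset.mul_sum, hsum]
      _ ≤ H * (T - t₀) := by
          have := (hmem n hn).2
          gcongr
  have hsmall : ∀ n ≤ m, C * ∑ ν ∈ Finset.range n, (t (ν + 1) - t ν) ^ (p + 1) ≤ η := by
    intro n hn
    have := mul_le_mul_of_nonneg_left (hpow n hn) hC0
    nlinarith
  -- Strong induction: the recursion up to `n` may be used only once the earlier errors are known to
  -- be at most `η`, and the claim for them implies this through `hsmall`.
  intro n
  induction n using Nat.strong_induction_on with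
  | _ n ih =>
  intro hn
  have hη' : ∀ ν < n, ‖(w ν : X) - u (t ν)‖ ≤ η := fun ν hν =>
    (ih ν hν (by omega)).trans (hsmall ν (by omega))
  set d : ℕ → X := fun k => ((w (k + 1) : X) - u (t (k + 1)))
    - jacFlow L N (u (t k)) (t (k + 1) - t k) ((w k : X) - u (t k)) with hd
  have hdle : ∀ k < n, ‖d k‖ ≤ C₁ * (t (k + 1) - t k) * ‖(w k : X) - u (t k)‖
      + C₂ * (t (k + 1) - t k) ^ (p + 1) := by
    intro k hk
    have h1 := hrec (t k) (hmem k (by omega)) (t (k + 1) - t k) (hpos k (by omega))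
      ((hstep k (by omega)).2.trans hHη)
      (by rw [add_sub_cancel]; exact (hmem (k + 1) (by omega)).2) (w k) (hη' k hk)
    rwa [add_sub_cancel, ← hw.2 k (by omega)] at h1
  -- The sum of the local errors is extended from `k` to `n`, because the Gronwall lemma takes a
  -- source term independent of `k`.
  have hbound : ∀ k ≤ n, ‖(w k : X) - u (t k)‖
      ≤ D * C₂ * ∑ ν ∈ Finset.range n, (t (ν + 1) - t ν) ^ (p + 1)
        + ∑ ν ∈ Finset.range k, (D * C₁ * (t (ν + 1) - t ν)) * ‖(w ν : X) - u (t ν)‖ := by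
    intro k hk
    have e := eq_sum_propagatorProd (L := L) (N := N) (u := u) (t := t)
      (e := fun k => (w k : X) - u (t k)) (d := d) (n := k)
      (by simp only [hw.1, ht0, sub_self]) (fun ν _ => by simp only [hd]; abel)
    rw [e]
    calc _ ≤ ∑ ν ∈ Finset.range k, D * (C₁ * (t (ν + 1) - t ν) * ‖(w ν : X) - u (t ν)‖
          + C₂ * (t (ν + 1) - t ν) ^ (p + 1)) := by
          refine norm_sum_le_of_le _ fun ν hν => ?_
          have hν' := Finset.mem_range.1 hν
          exact (ContinuousLinearMap.le_of_opNorm_le_of_le _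
            (hCS.norm_propagatorProd_le (by omega)) (hdle ν (by omega)))
      _ = D * C₂ * ∑ ν ∈ Finset.range k, (t (ν + 1) - t ν) ^ (p + 1)
          + ∑ ν ∈ Finset.range k, (D * C₁ * (t (ν + 1) - t ν)) * ‖(w ν : X) - u (t ν)‖ := by
          rw [Finset.mul_sum, ← Finset.sum_add_distrib]
          exact Finset.sum_congr rfl fun ν _ => by ring
      _ ≤ _ := by
          have := Finset.sum_le_sum_of_subset_of_nonneg (Finset.range_mono hk)
            fun ν hν (_ : ν ∉ Finset.range k) => pow_nonneg
              (hpos ν ((Finset.mem_range.1 hν).trans_le hn)) (p + 1)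
          gcongr
  have hS0 : 0 ≤ ∑ ν ∈ Finset.range n, (t (ν + 1) - t ν) ^ (p + 1) :=
    Finset.sum_nonneg fun ν hν => pow_nonneg (hpos ν ((Finset.mem_range.1 hν).trans_le hn)) _
  have hg := le_mul_exp_of_le_add_sum (a := fun k => ‖(w k : X) - u (t k)‖)
    (α := fun ν => D * C₁ * (t (ν + 1) - t ν))
    (fun ν hν => mul_nonneg (by positivity) (hpos ν (by omega))) (by positivity) hbound
  refine hg.trans ?_
  rw [← Finset.mul_sum, hsum]
  have h1 : Real.exp (D * C₁ * (t n - t₀)) ≤ Real.exp (D * C₁ * (T - t₀)) := by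
    have := (hmem n hn).2
    gcongr
  calc _ ≤ D * C₂ * (∑ ν ∈ Finset.range n, (t (ν + 1) - t ν) ^ (p + 1))
        * Real.exp (D * C₁ * (T - t₀)) := by gcongr
    _ = _ := by rw [hC]; ring
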